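/- Conventions. Rings are commutative. Complexes are indexed homologically. For an $A$-linear map $g\colon P\to Q$ of finitely generated free $A$-modules, $\mathbf I^r(g)\subseteq A$ is the ideal generated by the $r\times r$ minors of a matrix of $g$, with the convention $\mathbf I^r(g)=A$ if $P=0$ or $Q=0$; for a complex $C$ of such modules, $\mathbf I^r_\ell(C)=\mathbf I^r(C_\ell\to C_{\ell-1})$. For a ring $S$ and $f_1,\dots,f_c\in S$ put $R=S/(f_1,\dots,f_c)$ and $\tilde S=S[t_1,\dots,t_c]$, graded with $S$ in degree $0$ and $\deg t_i=-2$. Multi-indices are $a\in\mathbb Z_{\ge 0}^c$, $|a|=\sum a_i$, and $e_i$ is the $i$-th standard basis vector. A *graded matrix factorization* of $\tilde f=\sum f_it_i$ is a pair $(F,d)$ of a finitely generated graded free $\tilde S$-module $F$ and an $\tilde S$-linear endomorphism $d$ of degree $-1$ with $d^2=\tilde f\cdot\mathrm{id}_F$. $\Phi(F,d)$ is the complex of $R$-modules with $\Phi(F,d)_i=\operatorname{Hom}_S(F_{-i},S)\otimes_SR$ and differential induced by the transpose of $d$. A complex of $R$-modules is a *Shamash complex* if it is isomorphic to some $\Phi(F,d)$.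 A *system of higher homotopies* $\sigma$ for $f_1,\dots,f_c$ on a complex $G$ of free $S$-modules is a family of graded $S$-linear maps $\sigma_a\colon G_i\to G_{i+2|a|-1}$ such that $\sigma_0$ is the differential of $G$, $\sigma_0\sigma_{e_i}+\sigma_{e_i}\sigma_0=f_i\cdot\mathrm{id}_G$ for all $i$, and $\sum_{u+v=a}\sigma_u\sigma_v=0$ whenever $|a|\ge 2$. The *Shamash construction* $\operatorname{Sh}(G,\sigma)$ is the complex of $R$-modules with underlying module $D\otimes_SG\otimes_SR$, where $D$ is the free $S$-module on the divided power monomials $y^{(b)}$ of degree $2|b|$, and differential $y^{(b)}\otimes g\mapsto\sum_{a+b'=b}y^{(b')}\otimes\sigma_a(g)$. **Theorem.** Let $c>1$ and $r\ge 1$ be integers. (A) Let $S$ be a ring, $f_1,\dots,f_c\in S$. (A1) Assume the $f_i$ are not all zero, and let $(F,d)$ be a graded matrix factorization of $\tilde f$. For $i=0$ (even) and $i=1$ (odd) let $n_i$ and $N_i$ be the smallest and largest degrees of parity $i$ of an element of a homogeneous $\tilde S$-basis of $F$ (whenever such a degree exists), and let $M_i=-(r-1)(N_i-n_i+4)+n_i$.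 If $\ell$ is even and $\ell\ge -M_1+1$, then $\mathbf I^r_\ell(\Phi(F,d))=\mathbf I^1_{-n_1+1}(\Phi(F,d))^r$. If $\ell$ is odd and $\ell\ge -M_0+1$, then $\mathbf I^r_\ell(\Phi(F,d))=\mathbf I^1_{-n_0+1}(\Phi(F,d))^r$. (A2) For every Shamash complex $C$ there is $L$ with $\mathbf I^r_\ell(C)=\mathbf I^r_{\ell+2}(C)$ for all $\ell\ge L$. (B) Let $S$ be a regular local ring with maximal ideal $\mathfrak m$ and $f_1,\dots,f_c$ a regular sequence in $S$ (so $R\neq 0$). (B1) Let $M$ be a finitely generated $R$-module, $G$ a minimal free resolution of $M$ over $S$, and $\sigma$ any system of higher homotopies for $f_1,\dots,f_c$ on $G$. Then $\mathbf I^r_\ell(\operatorname{Sh}(G,\sigma))=\mathbf I^r_{\ell+2}(\operatorname{Sh}(G,\sigma))$ for all integers $\ell\ge 0$ with $\ell\ge r\cdot\operatorname{pd}_S(M)+4(r-1)+1$ (where $\operatorname{pd}_S(0)=-\infty$), and also for all $\ell\ge r\cdot\dim S+4(r-1)+1$. (B2) Assume moreover that $f_1,\dots,f_c\in\mathfrak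 m^2$, and let $F$ be a minimal free resolution over $R$ of the residue field of $R$. Then $\mathbf I^r_\ell(F)=\mathbf I^r_{\ell+2}(F)$ for all $\ell\ge r\cdot c+4(r-1)+1$. -/

import Mathlib

open scoped TensorProduct DirectSum
open CategoryTheory

universe u

noncomputable section

/-! ## Ideals of minors -/

section Minors

variable {A : Type*} [CommRing A] {P Q : Type*} [AddCommGroup P] [Module A P]
  [AddCommGroup Q] [Module A Q]

open scoped Classical in
/-- The ideal of `r × r` minors of an `A`-linear map `g : P → Q` of finite free modules, with the
convention that it is the unit ideal when `P` or `Q` is zero. It is written without bases: it is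
generated by the determinants of the matrices `(φ i (g (x j)))` with `x j ∈ P` and `φ i ∈ Q^*`.
By `minorsIdeal_eq_span_minors` below it is the ideal generated by the `r × r` minors of the matrix
of `g` in any pair of finite bases. -/
def minorsIdeal (r : ℕ) (g : P →ₗ[A] Q) : Ideal A :=
  if Subsingleton P ∨ Subsingleton Q then ⊤ else
    Ideal.span {a | ∃ (x : Fin r → P) (φ : Fin r → Module.Dual A Q),
      a = Matrix.det (Matrix.of fun i j => φ i (g (x j)))}

theorem det_mul_mem_span_minors {κ : Type*} [Fintype κ] [DecidableEq κ] {r : ℕ}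
    (U : Matrix (Fin r) κ A) (V : Matrix κ (Fin r) A) {I : Ideal A}
    (h : ∀ p : Fin r → κ, (V.submatrix p id).det ∈ I) : (U * V).det ∈ I := by
  have e : (U * V).det = Matrix.detRowAlternating (fun i => ∑ k, U i k • V k) := by
    congr 1
    ext i j
    simp [Matrix.mul_apply]
  rw [e]
  change (Matrix.detRowAlternating (n := Fin r) (R := A)).toMultilinearMap _ ∈ I
  rw [MultilinearMap.map_sum]
  refine Ideal.sum_mem _ fun p _ => ?_
  rw [MultilinearMap.map_smul_univ]
  exact Ideal.mul_mem_left _ _ (h p)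

theorem minorsIdeal_eq_span_minors {ι κ : Type*} [Fintype ι] [Fintype κ] [DecidableEq ι]
    [DecidableEq κ] (b : Module.Basis ι A P) (b' : Module.Basis κ A Q) (r : ℕ) (g : P →ₗ[A] Q)
    (h : ¬ (Subsingleton P ∨ Subsingleton Q)) :
    minorsIdeal r g = Ideal.span {a | ∃ (p : Fin r → κ) (q : Fin r → ι),
      a = ((LinearMap.toMatrix b b' g).submatrix p q).det} := by
  rw [minorsIdeal, if_neg h]
  apply le_antisymm
  · rw [Ideal.span_le]
    rintro _ ⟨x, φ, rfl⟩
    have e : (Matrix.of fun i j => φ i (g (x j))) =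
        (Matrix.of fun i k => φ i (b' k)) *
          (LinearMap.toMatrix b b' g * (Matrix.of fun l j => b.repr (x j) l)) := by
      ext i j
      have h1 : LinearMap.toMatrix b b' g * (Matrix.of fun l j => b.repr (x j) l) =
          Matrix.of fun k j => b'.repr (g (x j)) k := by
        ext k j
        have := congrFun (LinearMap.toMatrix_mulVec_repr b b' g (x j)) k
        simpa [Matrix.mul_apply, Matrix.mulVec, dotProduct] using this
      rw [h1]
      simp only [Matrix.mul_apply, Matrix.of_apply]
      have h2 := congrArg (φ i) (b'.sum_repr (g (x j)))
      rw [← h2, map_sum]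
      simp only [map_smul, smul_eq_mul, mul_comm]
    rw [e]
    refine det_mul_mem_span_minors _ _ fun p => ?_
    rw [Matrix.submatrix_mul _ _ p id id Function.bijective_id, ← Matrix.det_transpose,
      Matrix.transpose_mul]
    refine det_mul_mem_span_minors _ _ fun q => ?_
    refine Ideal.subset_span ⟨p, q, ?_⟩
    rw [← Matrix.det_transpose]
    rfl
  · apply Ideal.span_mono
    rintro _ ⟨p, q, rfl⟩
    refine ⟨fun j => b (q j), fun i => b'.coord (p i), ?_⟩
    congr 1
    ext i j
    simp [LinearMap.toMatrix_apply]

/-- `I^r_ℓ(C)`: the ideal of `r × r` minors of the differential `C_ℓ → C_{ℓ-1}`. -/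
def complexMinors (C : ChainComplex (ModuleCat.{u} A) ℤ) (r : ℕ) (l : ℤ) : Ideal A :=
  minorsIdeal r (C.d l (l - 1)).hom

/-- `ε : G_0 → M` makes the complex `G` a minimal free resolution of `M` over the local ring `A`. -/
structure IsMinimalFreeResolution [IsLocalRing A] {M : Type*} [AddCommGroup M] [Module A M]
    (G : ChainComplex (ModuleCat.{u} A) ℤ) (ε : G.X 0 →ₗ[A] M) : Prop where
  free (i : ℤ) : Module.Free A (G.X i)
  finite (i : ℤ) : Module.Finite A (G.X i)
  zero_of_neg (i : ℤ) : i < 0 → Subsingleton (G.X i)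
  exact (i : ℤ) : 0 < i → Function.Exact (G.d (i + 1) i).hom (G.d i (i - 1)).hom
  exact_zero : Function.Exact (G.d 1 0).hom ε
  surjective : Function.Surjective ε
  minimal (i : ℤ) : LinearMap.range (G.d (i + 1) i).hom ≤
    IsLocalRing.maximalIdeal A • (⊤ : Submodule A (G.X i))

end Minors

/-! ## The Shamash construction -/

section Shamash

variable {S : Type u} [CommRing S] {c : ℕ}

/-- The ring `R = S / (f_1, …, f_c)`. -/
abbrev CIRing (f : Fin c → S) : Type u := S ⧸ Ideal.span (Set.range f)

theorem isLocalRing_ciRing [IsLocalRing S] (f : Fin c → S)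
    (hf : RingTheory.Sequence.IsRegular S (List.ofFn f)) : IsLocalRing (CIRing f) := by
  have h : Ideal.span (Set.range f) ≠ ⊤ := by
    intro h
    apply hf.top_ne_smul
    have : Ideal.ofList (List.ofFn f) = Ideal.span (Set.range f) := by
      unfold Ideal.ofList
      congr 1
      ext x
      exact List.mem_ofFn' f x
    rw [this, h, Submodule.top_smul]
  have : Nontrivial (CIRing f) := Ideal.Quotient.nontrivial_iff.mpr h
  exact IsLocalRing.of_surjective' (Ideal.Quotient.mk _) Ideal.Quotient.mk_surjective

theorem baseChange_finsetSum {α : Type*} (B : Type*) [CommRing B] [Algebra S B] {V W : Type*}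
    [AddCommGroup V] [Module S V] [AddCommGroup W] [Module S W] (t : Finset α)
    (g : α → V →ₗ[S] W) :
    (∑ i ∈ t, g i).baseChange B = ∑ i ∈ t, (g i).baseChange B :=
  map_sum (LinearMap.baseChangeHom S B V W) g t

theorem baseChange_smul_eq_zero (f : Fin c → S) (k : Fin c) {V W : Type*} [AddCommGroup V]
    [Module S V] [AddCommGroup W] [Module S W] (g : V →ₗ[S] W) :
    (f k • g).baseChange (CIRing f) = 0 := by
  apply TensorProduct.AlgebraTensorModule.ext
  intro a v
  have h : f k • a = 0 := by
    rw [Algebra.smul_def]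
    have : algebraMap S (CIRing f) (f k) = 0 :=
      Ideal.Quotient.eq_zero_iff_mem.mpr (Ideal.subset_span ⟨k, rfl⟩)
    rw [this, zero_mul]
  change a ⊗ₜ[S] (f k • g v) = 0
  rw [← TensorProduct.smul_tmul, h, TensorProduct.zero_tmul]

/-- A system of higher homotopies for `f_1, …, f_c` on the complex `G`: maps
`σ_a : G_i → G_{i + 2|a| - 1}` for every multi-index `a`. The map `σ a i j : G_i → G_j` is the
component of `σ_a`; it vanishes unless `j = i + 2|a| - 1`. -/
structure HigherHomotopies (f : Fin c → S) (G : ChainComplex (ModuleCat.{u} S) ℤ) where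
  σ (a : Fin c →₀ ℕ) (i j : ℤ) : G.X i →ₗ[S] G.X j
  shape (a : Fin c →₀ ℕ) (i j : ℤ) : j ≠ i + 2 * a.degree - 1 → σ a i j = 0
  zero (i j : ℤ) : σ 0 i j = (G.d i j).hom
  single (k : Fin c) (i : ℤ) :
    σ 0 (i + 1) i ∘ₗ σ (Finsupp.single k 1) i (i + 1) +
      σ (Finsupp.single k 1) (i - 1) i ∘ₗ σ 0 i (i - 1) = f k • LinearMap.id
  relation (a : Fin c →₀ ℕ) (i : ℤ) : 2 ≤ a.degree →
    ∑ p ∈ Finset.HasAntidiagonal.antidiagonal a,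
      σ p.1 (i + 2 * p.2.degree - 1) (i + 2 * a.degree - 2) ∘ₗ
        σ p.2 i (i + 2 * p.2.degree - 1) = 0

namespace HigherHomotopies

variable {f : Fin c → S} {G : ChainComplex (ModuleCat.{u} S) ℤ}

/-- The degree `n` part of `D ⊗ G ⊗ R`, where `D` is the divided power algebra, with `S`-basis the
monomials `y^(b)` of degree `2|b|`: the summand with index `b` is `y^(b) ⊗ G_{n - 2|b|} ⊗ R`. -/
abbrev ShX (f : Fin c → S) (G : ChainComplex (ModuleCat.{u} S) ℤ) (n : ℤ) : Type u :=
  ⨁ b : Fin c →₀ ℕ, (CIRing f ⊗[S] G.X (n - 2 * b.degree))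

/-- The differential `∑ t^a ⊗ σ_a ⊗ id`, where `t^a` acts on `D` by contraction: it sends
`y^(b) ⊗ g` to the sum of `y^(b') ⊗ σ_a(g)` over all `a + b' = b`. It vanishes for `m ≠ n - 1`. -/
def shD (s : HigherHomotopies f G) (n m : ℤ) : ShX f G n →ₗ[CIRing f] ShX f G m :=
  DirectSum.toModule (CIRing f) (Fin c →₀ ℕ) _ fun b =>
    ∑ p ∈ Finset.HasAntidiagonal.antidiagonal b,
      DirectSum.lof (CIRing f) (Fin c →₀ ℕ)
          (fun b' => CIRing f ⊗[S] G.X (m - 2 * b'.degree)) p.2 ∘ₗ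
        (s.σ p.1 (n - 2 * b.degree) (m - 2 * p.2.degree)).baseChange (CIRing f)

theorem shD_lof (s : HigherHomotopies f G) (n m : ℤ) (b : Fin c →₀ ℕ)
    (x : CIRing f ⊗[S] G.X (n - 2 * b.degree)) :
    s.shD n m (DirectSum.lof (CIRing f) (Fin c →₀ ℕ)
      (fun b' => CIRing f ⊗[S] G.X (n - 2 * b'.degree)) b x) =
    ∑ p ∈ Finset.HasAntidiagonal.antidiagonal b,
      DirectSum.lof (CIRing f) (Fin c →₀ ℕ)
          (fun b' => CIRing f ⊗[S] G.X (m - 2 * b'.degree)) p.2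
        ((s.σ p.1 (n - 2 * b.degree) (m - 2 * p.2.degree)).baseChange (CIRing f) x) := by
  rw [shD, DirectSum.toModule_lof, LinearMap.sum_apply]
  rfl

theorem shD_shape (s : HigherHomotopies f G) (n m : ℤ) (h : m + 1 ≠ n) : s.shD n m = 0 := by
  refine DirectSum.linearMap_ext _ fun b => ?_
  refine LinearMap.ext fun x => ?_
  rw [LinearMap.comp_apply, shD_lof]
  refine Finset.sum_eq_zero fun p hp => ?_
  rw [Finset.HasAntidiagonal.mem_antidiagonal] at hp
  rw [s.shape, LinearMap.baseChange_zero, LinearMap.zero_apply, map_zero]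
  rw [← hp, map_add]
  push_cast
  intro h'
  apply h
  linarith

theorem baseChange_relation (s : HigherHomotopies f G) (e : Fin c →₀ ℕ) (i k : ℤ)
    (j : (Fin c →₀ ℕ) × (Fin c →₀ ℕ) → ℤ)
    (hj : ∀ p ∈ Finset.HasAntidiagonal.antidiagonal e, j p = i + 2 * p.2.degree - 1)
    (hk : k = i + 2 * e.degree - 2) :
    (∑ p ∈ Finset.HasAntidiagonal.antidiagonal e,
      s.σ p.1 (j p) k ∘ₗ s.σ p.2 i (j p)).baseChange (CIRing f) = 0 := by
  subst hk
  have h1 : ∑ p ∈ Finset.HasAntidiagonal.antidiagonal e,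
        s.σ p.1 (j p) (i + 2 * e.degree - 2) ∘ₗ s.σ p.2 i (j p) =
      ∑ p ∈ Finset.HasAntidiagonal.antidiagonal e,
        s.σ p.1 (i + 2 * p.2.degree - 1) (i + 2 * e.degree - 2) ∘ₗ
          s.σ p.2 i (i + 2 * p.2.degree - 1) :=
    Finset.sum_congr rfl fun p hp => by rw [hj p hp]
  rw [h1]
  rcases Nat.lt_or_ge e.degree 2 with h | h
  · rcases Nat.lt_or_ge e.degree 1 with h0 | h0
    · have he : e = 0 := (Finsupp.degree_eq_zero_iff e).mp (by lia)
      subst he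
      rw [Finsupp.antidiagonal_zero, Finset.sum_singleton]
      simp only [s.zero]
      rw [← ModuleCat.hom_comp, G.d_comp_d, ModuleCat.hom_zero, LinearMap.baseChange_zero]
    · obtain ⟨k, rfl⟩ : ∃ k, e = Finsupp.single k 1 := by
        have h2 : e.degree = 1 := by lia
        have hne : e ≠ 0 := by
          rintro rfl
          simp at h2
        obtain ⟨k, hk⟩ := Finsupp.ne_iff.mp hne
        refine ⟨k, ?_⟩
        have h3 : Finsupp.single k 1 ≤ e := by
          rw [Finsupp.single_le_iff]
          exact Nat.one_le_iff_ne_zero.mpr hk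
        obtain ⟨r, hr⟩ := exists_add_of_le h3
        have h4 : r.degree = 0 := by
          have := congrArg Finsupp.degree hr
          rw [map_add, Finsupp.degree_single] at this
          lia
        rw [hr, (Finsupp.degree_eq_zero_iff r).mp h4, add_zero]
      have h2 : ∀ T : (Fin c →₀ ℕ) × (Fin c →₀ ℕ) → (G.X i →ₗ[S] G.X i),
          ∑ p ∈ Finset.HasAntidiagonal.antidiagonal (Finsupp.single k 1), T p =
            T (0, Finsupp.single k 1) + T (Finsupp.single k 1, 0) := by
        intro T
        rw [Finsupp.antidiagonal_single, Finset.sum_map]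
        simp [Finset.Nat.antidiagonal_succ]
      obtain ⟨i', hi'⟩ : ∃ i', i' = i + 2 * ((Finsupp.single k 1 : Fin c →₀ ℕ).degree : ℤ) - 2 :=
        ⟨_, rfl⟩
      have hi : i' = i := by
        rw [hi', Finsupp.degree_single]
        push_cast
        ring
      rw [← hi']
      subst hi
      rw [h2]
      have ha : i' + 2 * ((Finsupp.single k 1 : Fin c →₀ ℕ).degree : ℤ) - 1 = i' + 1 := by
        rw [Finsupp.degree_single]
        push_cast
        ring
      have hb : i' + 2 * ((0 : Fin c →₀ ℕ).degree : ℤ) - 1 = i' - 1 := by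
        simp
      rw [ha, hb, s.single]
      exact baseChange_smul_eq_zero f k LinearMap.id
  · rw [s.relation e i h, LinearMap.baseChange_zero]

theorem shD_comp (s : HigherHomotopies f G) (n m k : ℤ) (hm : m + 1 = n) (hk : k + 1 = m) :
    s.shD m k ∘ₗ s.shD n m = 0 := by
  refine DirectSum.linearMap_ext _ fun b => ?_
  refine LinearMap.ext fun x => ?_
  rw [LinearMap.comp_apply, LinearMap.comp_apply, shD_lof, map_sum]
  simp only [shD_lof]
  have key : ∑ p ∈ Finset.HasAntidiagonal.antidiagonal b,
        ∑ q ∈ Finset.HasAntidiagonal.antidiagonal p.2,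
          DirectSum.lof (CIRing f) (Fin c →₀ ℕ)
              (fun b' => CIRing f ⊗[S] G.X (k - 2 * b'.degree)) q.2
            ((s.σ q.1 (m - 2 * p.2.degree) (k - 2 * q.2.degree)).baseChange (CIRing f)
              ((s.σ p.1 (n - 2 * b.degree) (m - 2 * p.2.degree)).baseChange (CIRing f) x)) =
      ∑ p ∈ Finset.HasAntidiagonal.antidiagonal b,
        ∑ q ∈ Finset.HasAntidiagonal.antidiagonal p.1,
          DirectSum.lof (CIRing f) (Fin c →₀ ℕ)
              (fun b' => CIRing f ⊗[S] G.X (k - 2 * b'.degree)) p.2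
            ((s.σ q.1 (m - 2 * (q.1 + p.2).degree) (k - 2 * p.2.degree)).baseChange (CIRing f)
              ((s.σ q.2 (n - 2 * b.degree) (m - 2 * (q.1 + p.2).degree)).baseChange
                (CIRing f) x)) := by
    rw [Finset.sum_sigma', Finset.sum_sigma']
    refine Finset.sum_bij' (fun z _ => ⟨(z.2.1 + z.1.1, z.2.2), (z.2.1, z.1.1)⟩)
      (fun z _ => ⟨(z.2.2, z.2.1 + z.1.2), (z.2.1, z.1.2)⟩) ?_ ?_ ?_ ?_ ?_
    · rintro ⟨⟨a, b1⟩, ⟨u, v⟩⟩ h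
      simp only [Finset.mem_sigma, Finset.HasAntidiagonal.mem_antidiagonal] at h ⊢
      obtain ⟨h1, h2⟩ := h
      refine ⟨?_, trivial⟩
      rw [← h1, ← h2]
      abel
    · rintro ⟨⟨a, b1⟩, ⟨u, v⟩⟩ h
      simp only [Finset.mem_sigma, Finset.HasAntidiagonal.mem_antidiagonal] at h ⊢
      obtain ⟨h1, h2⟩ := h
      refine ⟨?_, trivial⟩
      rw [← h1, ← h2]
      abel
    · rintro ⟨⟨a, b1⟩, ⟨u, v⟩⟩ h
      simp only [Finset.mem_sigma, Finset.HasAntidiagonal.mem_antidiagonal] at h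
      obtain ⟨h1, rfl⟩ := h
      rfl
    · rintro ⟨⟨a, b1⟩, ⟨u, v⟩⟩ h
      simp only [Finset.mem_sigma, Finset.HasAntidiagonal.mem_antidiagonal] at h
      obtain ⟨h1, rfl⟩ := h
      rfl
    · rintro ⟨⟨a, b1⟩, ⟨u, v⟩⟩ h
      simp only [Finset.mem_sigma, Finset.HasAntidiagonal.mem_antidiagonal] at h
      obtain ⟨h1, rfl⟩ := h
      rfl
  rw [key]
  refine Finset.sum_eq_zero fun p hp => ?_
  rw [Finset.HasAntidiagonal.mem_antidiagonal] at hp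
  have hd : (b.degree : ℤ) = p.1.degree + p.2.degree := by
    rw [← hp, map_add]
    push_cast
    ring
  have := s.baseChange_relation p.1 (n - 2 * b.degree) (k - 2 * p.2.degree)
    (fun q => m - 2 * (q.1 + p.2).degree) (by
      intro q hq
      rw [Finset.HasAntidiagonal.mem_antidiagonal] at hq
      have hq' : (p.1.degree : ℤ) = q.1.degree + q.2.degree := by
        rw [← hq, map_add]
        push_cast
        ring
      simp only [map_add]
      push_cast
      linarith) (by linarith)
  have h2 := LinearMap.congr_fun this x
  simp only [baseChange_finsetSum, LinearMap.baseChange_comp, LinearMap.sum_apply,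
    LinearMap.comp_apply, LinearMap.zero_apply] at h2
  rw [← map_sum, h2, map_zero]

/-- The Shamash construction `Sh(G, σ)`, as a complex of `R`-modules. -/
def Sh (s : HigherHomotopies f G) : ChainComplex (ModuleCat.{u} (CIRing f)) ℤ where
  X n := ModuleCat.of (CIRing f) (ShX f G n)
  d n m := ModuleCat.ofHom (s.shD n m)
  shape n m h := by
    rw [s.shD_shape n m h]
    rfl
  d_comp_d' n m k hm hk := by
    rw [← ModuleCat.ofHom_comp, s.shD_comp n m k hm hk]
    rfl

end HigherHomotopies

end Shamash

/-! ## Graded matrix factorizations -/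

/-- A graded matrix factorization of `f_1 t_1 + ⋯ + f_c t_c` over `S[t_1, …, t_c]`, `deg t_i = -2`:
a finitely generated graded free module `F` with an endomorphism `d` of degree `-1` whose square
is multiplication by `f_1 t_1 + ⋯ + f_c t_c`. -/
structure GradedMatrixFactorization {S : Type u} [CommRing S] {c : ℕ} (f : Fin c → S) where
  F : Type u
  [addCommGroup : AddCommGroup F]
  [module : Module (MvPolynomial (Fin c) S) F]
  [moduleBase : Module S F]
  [isScalarTower : IsScalarTower S (MvPolynomial (Fin c) S) F]
  grading : ℤ → Submodule S F
  [decomposition : DirectSum.Decomposition grading]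
  X_smul_mem (k : Fin c) (i : ℤ) (x : F) : x ∈ grading i →
    (MvPolynomial.X k : MvPolynomial (Fin c) S) • x ∈ grading (i - 2)
  free : ∃ (n : ℕ) (b : Module.Basis (Fin n) (MvPolynomial (Fin c) S) F) (e : Fin n → ℤ),
    ∀ k, b k ∈ grading (e k)
  d : F →ₗ[MvPolynomial (Fin c) S] F
  d_mem (i : ℤ) (x : F) : x ∈ grading i → d x ∈ grading (i - 1)
  d_d (x : F) : d (d x) = (∑ k, MvPolynomial.C (f k) * MvPolynomial.X k) • x

namespace GradedMatrixFactorization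

attribute [instance] addCommGroup module moduleBase isScalarTower decomposition

variable {S : Type u} [CommRing S] {c : ℕ} {f : Fin c → S}

/-- The component `F_i → F_j` of `d`. -/
def dComp (E : GradedMatrixFactorization f) (i j : ℤ) : E.grading i →ₗ[S] E.grading j :=
  DirectSum.component S ℤ (fun i => E.grading i) j ∘ₗ
    (DirectSum.decomposeLinearEquiv E.grading).toLinearMap ∘ₗ
      E.d.restrictScalars S ∘ₗ (E.grading i).subtype

theorem dComp_apply (E : GradedMatrixFactorization f) (i j : ℤ) (x : E.grading i) :
    E.dComp i j x = DirectSum.decompose E.grading (E.d x) j := rfl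

theorem coe_dComp (E : GradedMatrixFactorization f) (i j : ℤ) (h : j + 1 = i) (x : E.grading i) :
    (E.dComp i j x : E.F) = E.d x := by
  rw [dComp_apply]
  apply DirectSum.decompose_of_mem_same
  obtain rfl : j = i - 1 := by lia
  exact E.d_mem i x x.2

theorem dComp_shape (E : GradedMatrixFactorization f) (i j : ℤ) (h : j + 1 ≠ i) :
    E.dComp i j = 0 := by
  ext x
  rw [dComp_apply, DirectSum.decompose_of_mem_ne E.grading (E.d_mem i x x.2) (by lia)]
  simp

/-- Multiplication by `t_k`, as a map `F_i → F_j` (zero unless `j = i - 2`). -/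
def tComp (E : GradedMatrixFactorization f) (k : Fin c) (i j : ℤ) :
    E.grading i →ₗ[S] E.grading j :=
  DirectSum.component S ℤ (fun i => E.grading i) j ∘ₗ
    (DirectSum.decomposeLinearEquiv E.grading).toLinearMap ∘ₗ
      (LinearMap.lsmul (MvPolynomial (Fin c) S) E.F (MvPolynomial.X k)).restrictScalars S ∘ₗ
        (E.grading i).subtype

theorem coe_tComp (E : GradedMatrixFactorization f) (k : Fin c) (i j : ℤ) (h : j + 2 = i)
    (x : E.grading i) :
    (E.tComp k i j x : E.F) = (MvPolynomial.X k : MvPolynomial (Fin c) S) • (x : E.F) := by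
  change ((DirectSum.decompose E.grading
    ((MvPolynomial.X k : MvPolynomial (Fin c) S) • (x : E.F)) j : E.grading j) : E.F) = _
  apply DirectSum.decompose_of_mem_same
  obtain rfl : j = i - 2 := by lia
  exact E.X_smul_mem k i x x.2

theorem dComp_comp (E : GradedMatrixFactorization f) (i j k : ℤ) (hj : j + 1 = i)
    (hk : k + 1 = j) : E.dComp j k ∘ₗ E.dComp i j = ∑ l, f l • E.tComp l i k := by
  ext x
  rw [LinearMap.comp_apply, E.coe_dComp j k hk, E.coe_dComp i j hj, E.d_d, LinearMap.sum_apply,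
    AddSubmonoidClass.coe_finsetSum, Finset.sum_smul]
  refine Finset.sum_congr rfl fun l _ => ?_
  rw [LinearMap.smul_apply, Submodule.coe_smul, E.coe_tComp l i k (by lia), mul_smul,
    ← MvPolynomial.algebraMap_eq, algebraMap_smul]

/-- The differential `Φ_i → Φ_j` of `Φ(F, d)`. -/
def phiD (E : GradedMatrixFactorization f) (i j : ℤ) :
    CIRing f ⊗[S] Module.Dual S (E.grading (-i)) →ₗ[CIRing f]
      CIRing f ⊗[S] Module.Dual S (E.grading (-j)) :=
  (E.dComp (-j) (-i)).dualMap.baseChange (CIRing f)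

theorem phiD_comp (E : GradedMatrixFactorization f) (i j k : ℤ) (hj : j + 1 = i)
    (hk : k + 1 = j) : E.phiD j k ∘ₗ E.phiD i j = 0 := by
  rw [phiD, phiD, ← LinearMap.baseChange_comp, LinearMap.dualMap_comp_dualMap,
    E.dComp_comp _ _ _ (by lia) (by lia)]
  have h : (∑ l, f l • E.tComp l (-k) (-i)).dualMap =
      ∑ l, f l • (E.tComp l (-k) (-i)).dualMap := by
    ext φ x
    simp [LinearMap.dualMap_apply]
  rw [h, baseChange_finsetSum]
  exact Finset.sum_eq_zero fun l _ => baseChange_smul_eq_zero f l _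

/-- The complex `Φ(F, d) = F^∨ ⊗_S R`, where `F^∨` is the graded `S`-dual of `F`. Its term in degree
`i` is `Hom_S(F_{-i}, S) ⊗_S R`. -/
def Phi (E : GradedMatrixFactorization f) : ChainComplex (ModuleCat.{u} (CIRing f)) ℤ where
  X i := ModuleCat.of (CIRing f) (CIRing f ⊗[S] Module.Dual S (E.grading (-i)))
  d i j := ModuleCat.ofHom (E.phiD i j)
  shape i j h := by
    have h' : j + 1 ≠ i := h
    have : E.phiD i j = 0 := by
      rw [phiD, E.dComp_shape _ _ (by lia)]
      have : (0 : E.grading (-j) →ₗ[S] E.grading (-i)).dualMap = 0 := by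
        ext
        simp
      rw [this, LinearMap.baseChange_zero]
    rw [this]
    rfl
  d_comp_d' i j k hj hk := by
    rw [← ModuleCat.ofHom_comp, E.phiD_comp i j k hj hk]
    rfl

end GradedMatrixFactorization

/-- A Shamash complex: a complex of `R`-modules isomorphic to `Φ(F, d)` for some `(F, d)`. -/
def IsShamashComplex {S : Type u} [CommRing S] {c : ℕ} (f : Fin c → S)
    (C : ChainComplex (ModuleCat.{u} (CIRing f)) ℤ) : Prop :=
  ∃ E : GradedMatrixFactorization f, Nonempty (C ≅ E.Phi)

end

/-! (A) and (B1) rest on one feature of the differentials. In the monomial bases (dual to $t^a b_k$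
for $\Phi$, $y^{(b)}\otimes g$ for $\operatorname{Sh}$) the entry from $(b,k)$ to $(b',k')$ depends
only on $k$, $k'$ and $b-b'$, and vanishes unless $b'\le b$; this is `HasDividedMatrix`. In degree
$\ell$ all entries lie in the ideal generated by the coefficients whose target generator has the
right parity, so $\mathbf I^r_\ell$ lies in its $r$-th power. Conversely, let $D$ bound $|a|$ for
the nonzero coefficients. Any $r$ of these can be made the diagonal of a triangular minor: the
$j$-th one goes into a row whose exponent in the first variable is $j(D+1)$, and a second variable,
available since $c>1$, corrects the total degree. Below the diagonal the first exponent would have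
to rise, so the entry is zero. Hence for large $\ell$ the ideal $\mathbf I^r_\ell$ is the $r$-th
power of an ideal depending only on the parity of $\ell$ (`HasDividedMatrix.minorsIdeal_eq`). The
explicit bounds come from estimates of $D$.

For (A1), $f\ne0$ forces $d$ to be nonzero on every basis element; applying $d$ twice returns to the
original parity and gives $D\le(N-n)/2+1$. For (B1) it suffices that $G$ has length at most
$\operatorname{pd}M$, respectively $\dim S$. The first holds because a projective syzygy splits off,
contradicting minimality unless it is trivial. The second is proved by dividing out a regular
sequence that generates $\mathfrak m$; its existence comes from regular local rings being domains
(`isDomain_of_span_eq_maximalIdeal`).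

(B2) does not follow from (B1), since the residue field has projective dimension $\dim S$ over $S$,
which may exceed $c$. Instead Tate's resolution is built: a Koszul complex on generators of
$\mathfrak m$, then one divided power variable for each $f_q$ (`TateModel`). The Koszul entries
generate $\mathfrak m$ in degrees $1$ and $2$; the first divided variable spreads this to all
positive degrees, and the second supplies the triangular minors. So $\mathbf I^r_\ell=\mathfrak m^r$
for $\ell\ge 2r-1$, $\ell\ge1$. Uniqueness of minimal resolutions (`exists_equiv_of_minimal`)
carries this to an arbitrary $F$. -/

noncomputable section

/-! ### Bounds for ideals of minors, and their invariance under isomorphism -/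

section MinorsLemmas

variable {A : Type*} [CommRing A] {P Q P' Q' : Type*} [AddCommGroup P] [Module A P]
  [AddCommGroup Q] [Module A Q] [AddCommGroup P'] [Module A P'] [AddCommGroup Q']
  [Module A Q']

theorem Module.Basis.mem_ideal_smul_top_iff {ι : Type*} (b : Module.Basis ι A P) (I : Ideal A)
    (x : P) : x ∈ I • (⊤ : Submodule A P) ↔ ∀ i, b.repr x i ∈ I := by
  constructor
  · intro hx i
    induction hx using Submodule.smul_induction_on' with
    | smul a ha y hy => simpa using I.mul_mem_right _ ha
    | add y hy z hz h1 h2 => simpa using I.add_mem h1 h2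
  · intro h
    rw [← b.linearCombination_repr x, Finsupp.linearCombination_apply]
    exact Submodule.sum_mem _ fun i _ => Submodule.smul_mem_smul (h i) trivial

theorem minorsIdeal_of_subsingleton (r : ℕ) (g : P →ₗ[A] Q)
    (h : Subsingleton P ∨ Subsingleton Q) : minorsIdeal r g = ⊤ := by
  rw [minorsIdeal, if_pos h]

theorem minorsIdeal_le_pow {I : Ideal A} (r : ℕ) (g : P →ₗ[A] Q)
    (h : ¬ (Subsingleton P ∨ Subsingleton Q)) (hg : ∀ x, g x ∈ I • (⊤ : Submodule A Q)) :
    minorsIdeal r g ≤ I ^ r := by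
  rw [minorsIdeal, if_neg h, Ideal.span_le]
  rintro _ ⟨x, φ, rfl⟩
  have key : ∀ i j, φ i (g (x j)) ∈ I := by
    intro i j
    have h1 : φ i (g (x j)) ∈ (I • (⊤ : Submodule A Q)).map (φ i) := ⟨_, hg _, rfl⟩
    rw [Submodule.map_smul''] at h1
    exact Ideal.mul_le_left h1
  rw [SetLike.mem_coe, Matrix.det_apply]
  refine Ideal.sum_mem _ fun τ _ => ?_
  rw [Units.smul_def, zsmul_eq_mul]
  refine Ideal.mul_mem_left _ _ ?_
  have h2 := Ideal.prod_mem_prod (s := Finset.univ) (I := fun _ : Fin r => I)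
    (x := fun i => Matrix.of (fun i j => φ i (g (x j))) (τ i) i) (fun i _ => key _ _)
  simpa using h2

/-- If every product of `r` elements of `Z` is a triangular minor, then the `r`-th power of the
ideal spanned by `Z` is contained in the ideal of minors. -/
theorem span_pow_le_minorsIdeal (Z : Set A) (r : ℕ) (g : P →ₗ[A] Q)
    (h : ∀ z : Fin r → A, (∀ j, z j ∈ Z) → ∃ (x : Fin r → P) (φ : Fin r → Module.Dual A Q),
      (∀ i j, j < i → φ i (g (x j)) = 0) ∧ ∀ i, φ i (g (x i)) = z i) :
    Ideal.span Z ^ r ≤ minorsIdeal r g := by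
  rw [minorsIdeal]
  split_ifs
  · exact le_top
  · rw [Ideal.span, Submodule.span_pow, Submodule.span_le]
    intro a ha
    rw [Set.mem_pow] at ha
    obtain ⟨z, rfl⟩ := ha
    obtain ⟨x, φ, h1, h2⟩ := h (fun i => z i) (fun i => (z i).2)
    refine Ideal.subset_span ⟨x, φ, ?_⟩
    rw [Matrix.det_of_isUpperTriangular, List.prod_ofFn]
    · exact Finset.prod_congr rfl fun i _ => (h2 i).symm
    · intro i j hij
      exact h1 i j hij

theorem minorsIdeal_congr (r : ℕ) (g : P →ₗ[A] Q) (g' : P' →ₗ[A] Q') (e : P ≃ₗ[A] P')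
    (e' : Q ≃ₗ[A] Q') (h : ∀ x, e' (g x) = g' (e x)) : minorsIdeal r g = minorsIdeal r g' := by
  have hs : (Subsingleton P ∨ Subsingleton Q) ↔ (Subsingleton P' ∨ Subsingleton Q') := by
    rw [e.toEquiv.subsingleton_congr, e'.toEquiv.subsingleton_congr]
  rw [minorsIdeal, minorsIdeal]
  by_cases h0 : Subsingleton P ∨ Subsingleton Q
  · rw [if_pos h0, if_pos (hs.mp h0)]
  rw [if_neg h0, if_neg (mt hs.mpr h0)]
  congr 1
  ext a
  constructor
  · rintro ⟨x, φ, rfl⟩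
    refine ⟨fun i => e (x i), fun i => φ i ∘ₗ e'.symm.toLinearMap, ?_⟩
    simp [← h]
  · rintro ⟨x, φ, rfl⟩
    refine ⟨fun i => e.symm (x i), fun i => φ i ∘ₗ e'.toLinearMap, ?_⟩
    simp [h]

theorem complexMinors_of_iso {B : Type u} [CommRing B] {C C' : ChainComplex (ModuleCat.{u} B) ℤ}
    (e : C ≅ C') (r : ℕ) (l : ℤ) : complexMinors C r l = complexMinors C' r l := by
  refine minorsIdeal_congr r _ _ (HomologicalComplex.Hom.isoApp e l).toLinearEquiv
    (HomologicalComplex.Hom.isoApp e (l - 1)).toLinearEquiv fun x => ?_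
  have := congrArg (fun q => q.hom x) (e.hom.comm l (l - 1))
  exact this.symm

end MinorsLemmas

/-! ### Matrices whose entries depend only on differences of exponents -/

section MultigradedMatrix

variable {A : Type*} [CommRing A] {K : Type*} {c : ℕ}

/-- The index set of the degree `l` part of `D ⊗ K`, where `K` is a set of generators of weights
`w` and `D` is spanned by monomials `y^(b)` of degree `2|b|`. -/
abbrev DividedIndex (c : ℕ) (w : K → ℤ) (l : ℤ) : Type _ :=
  {x : (Fin c →₀ ℕ) × K // w x.2 + 2 * (x.1.degree : ℤ) = l}

open scoped Classical in
/-- With respect to the given bases, the matrix of `g` has entries `p k' k (b - b')`. -/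
def HasDividedMatrix {w : K → ℤ} (p : K → K → (Fin c →₀ ℕ) → A) {l : ℤ} {P Q : Type*}
    [AddCommGroup P] [Module A P] [AddCommGroup Q] [Module A Q]
    (B : Module.Basis (DividedIndex c w l) A P) (B' : Module.Basis (DividedIndex c w (l - 1)) A Q)
    (g : P →ₗ[A] Q) : Prop :=
  ∀ x y, B'.repr (g (B x)) y =
    if y.1.1 ≤ x.1.1 then p y.1.2 x.1.2 (x.1.1 - y.1.1) else 0

/-- The ideal generated by the entries of the matrices in degrees of the parity of `l`. -/
def entryIdeal (w : K → ℤ) (p : K → K → (Fin c →₀ ℕ) → A) (l : ℤ) : Ideal A :=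
  Ideal.span {z | ∃ k' k a, Even (w k' + 1 - l) ∧ z = p k' k a}

theorem entryIdeal_add_two (w : K → ℤ) (p : K → K → (Fin c →₀ ℕ) → A) (l : ℤ) :
    entryIdeal w p (l + 2) = entryIdeal w p l := by
  unfold entryIdeal
  congr 1
  ext z
  refine exists_congr fun k' => exists_congr fun k => exists_congr fun a =>
    and_congr_left fun _ => ?_
  have : w k' + 1 - (l + 2) = w k' + 1 - l - 2 := by ring
  rw [this, Int.even_sub]
  simp

variable {w : K → ℤ} {p : K → K → (Fin c →₀ ℕ) → A} {l : ℤ} {P Q : Type*}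
    [AddCommGroup P] [Module A P] [AddCommGroup Q] [Module A Q]
    {B : Module.Basis (DividedIndex c w l) A P} {B' : Module.Basis (DividedIndex c w (l - 1)) A Q}
    {g : P →ₗ[A] Q}

/-- The inclusion from right to left is the triangular minor argument. Rows are spaced $D+1$ apart
in the first variable, so the last one uses up $(r-1)(D+1)$ of the exponent; `hl` says that the
target degree $l-1$ leaves room for this, the rest being absorbed by the second variable. -/
theorem HasDividedMatrix.minorsIdeal_eq (hg : HasDividedMatrix p B B' g)
    (hp : ∀ k' k a, p k' k a ≠ 0 → w k' = w k + 2 * a.degree - 1) (hc : 1 < c) (r : ℕ)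
    (D : ℕ) (hD : ∀ k' k a, Even (w k' + 1 - l) → p k' k a ≠ 0 → a.degree ≤ D)
    (hl : ∀ k', Even (w k' + 1 - l) → w k' + 2 * ((r : ℤ) - 1) * (D + 1) ≤ l - 1)
    (hn : ¬ (Subsingleton P ∨ Subsingleton Q)) :
    minorsIdeal r g = entryIdeal w p l ^ r := by
  classical
  apply le_antisymm
  · refine minorsIdeal_le_pow r g hn fun x => ?_
    have hB : ∀ i, g (B i) ∈ entryIdeal w p l • (⊤ : Submodule A Q) := by
      intro i
      rw [B'.mem_ideal_smul_top_iff]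
      intro y
      rw [hg i y]
      split_ifs
      · refine Ideal.subset_span ⟨_, _, _, ?_, rfl⟩
        rw [show w y.1.2 = l - 1 - 2 * (y.1.1.degree : ℤ) by linarith [y.2]]
        exact ⟨-(y.1.1.degree : ℤ), by ring⟩
      · exact Ideal.zero_mem _
    have hx : x ∈ Submodule.span A (Set.range B) := by rw [B.span_eq]; trivial
    induction hx using Submodule.span_induction with
    | mem x hx => obtain ⟨i, rfl⟩ := hx; exact hB i
    | zero => rw [map_zero]; exact Submodule.zero_mem _
    | add x y _ _ h1 h2 => rw [map_add]; exact Submodule.add_mem _ h1 h2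
    | smul a x _ h => rw [map_smul]; exact Submodule.smul_mem _ _ h
  -- Only nonzero coefficients are homogeneous and bounded by `D`, so zero is dropped from the
  -- generators.
  · rw [show entryIdeal w p l = Ideal.span
      ({z | ∃ k' k a, Even (w k' + 1 - l) ∧ z = p k' k a} \ {0}) by
        rw [Ideal.span_sdiff_singleton_zero]; rfl]
    refine span_pow_le_minorsIdeal _ r g fun z hz => ?_
    choose hz hz0 using hz
    choose k' k a he hza using hz
    have ha : ∀ j, w (k' j) = w (k j) + 2 * (a j).degree - 1 := fun j =>
      hp _ _ _ fun h => hz0 j ((hza j).trans h)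
    have haD : ∀ j, (a j).degree ≤ D := fun j =>
      hD _ _ _ (he j) fun h => hz0 j ((hza j).trans h)
    let i0 : Fin c := ⟨0, by lia⟩
    let i1 : Fin c := ⟨1, hc⟩
    have h01 : i0 ≠ i1 := by simp [i0, i1, Fin.ext_iff]
    -- `y j` is the exponent of the second variable that brings the `j`-th row to degree `l - 1`. It
    -- is an integer by the parity condition and nonnegative by `hl`.
    have hy : ∀ j : Fin r, ∃ y : ℕ, w (k' j) + 2 * ((j : ℕ) * (D + 1) + y : ℕ) = l - 1 := by
      intro j
      obtain ⟨m, hm⟩ := he j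
      have h1 : (j : ℤ) * (D + 1) ≤ ((r : ℤ) - 1) * (D + 1) := by
        refine mul_le_mul_of_nonneg_right ?_ (by positivity)
        have := j.2
        lia
      have h2 := hl _ (he j)
      refine ⟨(-m - (j : ℤ) * (D + 1)).toNat, ?_⟩
      push_cast
      rw [Int.toNat_of_nonneg (by linarith)]
      linarith
    choose y hy using hy
    let b' : Fin r → (Fin c →₀ ℕ) := fun j =>
      Finsupp.single i0 ((j : ℕ) * (D + 1)) + Finsupp.single i1 (y j)
    have hb' : ∀ j, (b' j).degree = (j : ℕ) * (D + 1) + y j := by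
      intro j
      rw [map_add, Finsupp.degree_single, Finsupp.degree_single]
    let X : Fin r → DividedIndex c w l := fun j => ⟨(b' j + a j, k j), by
      have := hy j
      have h2 := ha j
      rw [map_add, hb']
      push_cast at this ⊢
      linarith⟩
    let Y : Fin r → DividedIndex c w (l - 1) := fun j => ⟨(b' j, k' j), by
      rw [hb']
      exact hy j⟩
    refine ⟨fun j => B (X j), fun j => B'.coord (Y j), ?_, ?_⟩
    · intro i j hij
      rw [Module.Basis.coord_apply, hg, if_neg]
      intro hle
      have h1 : (b' i) i0 ≤ (b' j + a j) i0 := hle i0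
      have h2 : (a j) i0 ≤ (a j).degree := Finsupp.le_degree i0 (a j)
      have h3 : (b' i) i0 = (i : ℕ) * (D + 1) := by simp [b', h01]
      have h4 : (b' j) i0 = (j : ℕ) * (D + 1) := by simp [b', h01]
      change (b' i) i0 ≤ (b' j) i0 + (a j) i0 at h1
      rw [h3, h4] at h1
      -- For `j < i` the first exponents of the two rows differ by at least `D + 1`, more than `a j`
      -- can make up.
      have h5 : ((j : ℕ) + 1) * (D + 1) ≤ (i : ℕ) * (D + 1) :=
        Nat.mul_le_mul_right _ hij
      have := haD j
      lia
    · intro i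
      rw [Module.Basis.coord_apply, hg, if_pos]
      · simp [X, Y, hza]
      · exact le_self_add

theorem HasDividedMatrix.minorsIdeal_one_eq (hg : HasDividedMatrix p B B' g)
    (hp : ∀ k' k a, p k' k a ≠ 0 → w k' = w k + 2 * a.degree - 1) (hc : 1 < c)
    (D : ℕ) (hD : ∀ k' k a, Even (w k' + 1 - l) → p k' k a ≠ 0 → a.degree ≤ D)
    (hl : ∀ k', Even (w k' + 1 - l) → w k' ≤ l - 1)
    (hn : ¬ (Subsingleton P ∨ Subsingleton Q)) :
    minorsIdeal 1 g = entryIdeal w p l := by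
  rw [hg.minorsIdeal_eq hp hc 1 D hD (by simpa using hl) hn, pow_one]

theorem nonempty_dividedIndex (hc : 0 < c) {k : K} (h : Even (w k - l)) (hk : w k ≤ l) :
    Nonempty (DividedIndex c w l) := by
  obtain ⟨m, hm⟩ := h
  refine ⟨⟨(Finsupp.single ⟨0, hc⟩ (-m).toNat, k), ?_⟩⟩
  rw [Finsupp.degree_single, Int.toNat_of_nonneg (by lia)]
  lia

/-- The ideal of minors is the unit ideal by convention when a term vanishes, so periodicity also
requires the vanishing of terms to depend only on parity. -/
theorem nonempty_dividedIndex_iff (hc : 0 < c) (h : ∀ k, w k ≤ l) :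
    Nonempty (DividedIndex c w l) ↔ ∃ k, Even (w k - l) := by
  constructor
  · rintro ⟨⟨⟨b, k⟩, hb⟩⟩
    refine ⟨k, -(b.degree : ℤ), ?_⟩
    simp only at hb
    linarith
  · rintro ⟨k, hk⟩
    exact nonempty_dividedIndex hc hk (h k)

theorem Module.Basis.subsingleton_iff_isEmpty [Nontrivial A] {ι : Type*} (b : Module.Basis ι A P) :
    Subsingleton P ↔ ¬ Nonempty ι := by
  rw [← not_nontrivial_iff_subsingleton, not_iff_not]
  constructor
  · intro _
    exact b.index_nonempty
  · rintro ⟨i⟩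
    exact ⟨b i, 0, b.ne_zero i⟩

/-- Both ideals are the $r$-th power of the same parity ideal, or both are the unit ideal because a
term is zero in both degrees. -/
theorem HasDividedMatrix.minorsIdeal_eq_of_add_two [Nontrivial A] {P₂ Q₂ : Type*}
    [AddCommGroup P₂] [Module A P₂] [AddCommGroup Q₂] [Module A Q₂]
    {B₂ : Module.Basis (DividedIndex c w (l + 2)) A P₂}
    {B₂' : Module.Basis (DividedIndex c w (l + 2 - 1)) A Q₂} {g₂ : P₂ →ₗ[A] Q₂}
    (hg : HasDividedMatrix p B B' g) (hg₂ : HasDividedMatrix p B₂ B₂' g₂)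
    (hp : ∀ k' k a, p k' k a ≠ 0 → w k' = w k + 2 * a.degree - 1) (hc : 1 < c) (r : ℕ)
    (hr : 1 ≤ r) (D : ℕ) (hD : ∀ k' k a, p k' k a ≠ 0 → a.degree ≤ D)
    (hl : ∀ k', w k' + 2 * ((r : ℤ) - 1) * (D + 1) ≤ l - 1) :
    minorsIdeal r g = minorsIdeal r g₂ := by
  have hw : ∀ k, w k ≤ l - 1 := by
    intro k
    have h1 : 0 ≤ 2 * ((r : ℤ) - 1) * (D + 1) :=
      mul_nonneg (by lia) (by positivity)
    linarith [hl k]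
  have hpar : ∀ k, Even (w k - (l + 2)) ↔ Even (w k - l) := by
    intro k
    rw [show w k - (l + 2) = w k - l - 2 by ring, Int.even_sub]
    simp
  have hpar' : ∀ k, Even (w k - (l + 2 - 1)) ↔ Even (w k - (l - 1)) := by
    intro k
    rw [show w k - (l + 2 - 1) = w k - (l - 1) - 2 by ring, Int.even_sub]
    simp
  have hs : (Subsingleton P ∨ Subsingleton Q) ↔ (Subsingleton P₂ ∨ Subsingleton Q₂) := by
    rw [B.subsingleton_iff_isEmpty, B'.subsingleton_iff_isEmpty, B₂.subsingleton_iff_isEmpty,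
      B₂'.subsingleton_iff_isEmpty, nonempty_dividedIndex_iff (by lia) fun k => by linarith [hw k],
      nonempty_dividedIndex_iff (by lia) hw,
      nonempty_dividedIndex_iff (by lia) fun k => by linarith [hw k],
      nonempty_dividedIndex_iff (by lia) fun k => by linarith [hw k]]
    simp only [hpar, hpar']
  by_cases hn : Subsingleton P ∨ Subsingleton Q
  · rw [minorsIdeal_of_subsingleton r g hn, minorsIdeal_of_subsingleton r g₂ (hs.mp hn)]
  · rw [hg.minorsIdeal_eq hp hc r D (fun k' k a _ => hD k' k a) (fun k' _ => hl k') hn,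
      hg₂.minorsIdeal_eq hp hc r D (fun k' k a _ => hD k' k a)
        (fun k' _ => by linarith [hl k']) (mt hs.mpr hn), entryIdeal_add_two]

end MultigradedMatrix

end

noncomputable section

/-! ### Bases of the graded components of a module with a homogeneous basis -/

section HomogeneousBasis

variable {S M J : Type*} [CommRing S] [AddCommGroup M] [Module S M] (ℳ : ℤ → Submodule S M)
  [DirectSum.Decomposition ℳ] (b : Module.Basis J S M) (deg : J → ℤ)

theorem Module.Basis.repr_eq_zero_of_mem_grading (hb : ∀ j, b j ∈ ℳ (deg j)) {i : ℤ} {x : M}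
    (hx : x ∈ ℳ i) {j : J} (hj : deg j ≠ i) : b.repr x j = 0 := by
  classical
  -- `π` projects to degree `i`. It fixes `x`, while composed with the coordinate `j` it kills every
  -- basis vector.
  let π : M →ₗ[S] M := (ℳ i).subtype ∘ₗ DirectSum.component S ℤ (fun i => ℳ i) i ∘ₗ
    (DirectSum.decomposeLinearEquiv ℳ).toLinearMap
  have hπ : ∀ y, π y = (DirectSum.decompose ℳ y i : M) := fun y => rfl
  have key : b.coord j ∘ₗ π = 0 := by
    refine b.ext fun j' => ?_
    rw [LinearMap.comp_apply, hπ, LinearMap.zero_apply]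
    by_cases h : deg j' = i
    · rw [DirectSum.decompose_of_mem_same ℳ (h ▸ hb j'), Module.Basis.coord_apply,
        b.repr_self, Finsupp.single_eq_of_ne]
      rintro rfl
      exact hj h
    · rw [DirectSum.decompose_of_mem_ne ℳ (hb j') h, map_zero]
  have h1 := LinearMap.congr_fun key x
  rwa [LinearMap.comp_apply, hπ, DirectSum.decompose_of_mem_same ℳ hx] at h1

/-- The basis of a graded component given by the elements of a homogeneous basis of that degree. -/
def Module.Basis.gradedComponent (hb : ∀ j, b j ∈ ℳ (deg j)) (i : ℤ) (q : J → Prop)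
    (hq : ∀ j, q j ↔ deg j = i) : Module.Basis {j // q j} S (ℳ i) :=
  Module.Basis.mk (v := fun j : {j // q j} => (⟨b j, (hq j).mp j.2 ▸ hb j⟩ : ℳ i))
    (LinearIndependent.of_comp (M := ℳ i) (M' := M) (ℳ i).subtype
      (b.linearIndependent.comp (fun j : {j // q j} => (j : J)) Subtype.val_injective)) (by
      rintro ⟨x, hx⟩ -
      have h1 : (⟨x, hx⟩ : ℳ i) ∈ (Submodule.map (ℳ i).subtype (Submodule.span S (Set.range
          fun j : {j // q j} => (⟨b j, (hq j).mp j.2 ▸ hb j⟩ : ℳ i)))).comap (ℳ i).subtype := by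
        rw [Submodule.mem_comap, Submodule.map_span, Submodule.subtype_apply]
        change x ∈ _
        rw [← b.linearCombination_repr x, Finsupp.linearCombination_apply]
        refine Submodule.sum_mem _ fun j hj => Submodule.smul_mem _ _ (Submodule.subset_span ?_)
        have : q j := by
          rw [hq]
          by_contra h
          exact Finsupp.mem_support_iff.mp hj (b.repr_eq_zero_of_mem_grading ℳ deg hb hx h)
        exact ⟨_, ⟨⟨j, this⟩, rfl⟩, rfl⟩
      obtain ⟨y, hy, hyx⟩ := h1
      have h2 : y = ⟨x, hx⟩ := Subtype.ext hyx
      rwa [← h2])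

theorem Module.Basis.coe_gradedComponent (hb : ∀ j, b j ∈ ℳ (deg j)) (i : ℤ) (q : J → Prop)
    (hq : ∀ j, q j ↔ deg j = i) (j : {j // q j}) :
    (b.gradedComponent ℳ deg hb i q hq j : M) = b j := by
  rw [Module.Basis.gradedComponent, Module.Basis.mk_apply]

theorem Module.Basis.gradedComponent_repr (hb : ∀ j, b j ∈ ℳ (deg j)) (i : ℤ) (q : J → Prop)
    (hq : ∀ j, q j ↔ deg j = i) (x : ℳ i) (j : {j // q j}) :
    (b.gradedComponent ℳ deg hb i q hq).repr x j = b.repr (x : M) j := by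
  have h : (b.gradedComponent ℳ deg hb i q hq).coord j = b.coord j ∘ₗ (ℳ i).subtype := by
    refine (b.gradedComponent ℳ deg hb i q hq).ext fun j' => ?_
    rw [Module.Basis.coord_apply, Module.Basis.repr_self, LinearMap.comp_apply,
      Submodule.subtype_apply, b.coe_gradedComponent ℳ deg hb i q hq, Module.Basis.coord_apply,
      Module.Basis.repr_self]
    classical
    simp [Finsupp.single_apply, Subtype.ext_iff]
  exact LinearMap.congr_fun h x

end HomogeneousBasis

/-! ### Graded matrix factorizations and part (A) -/

namespace GradedMatrixFactorization

variable {S : Type u} [CommRing S] {c : ℕ} {f : Fin c → S} (E : GradedMatrixFactorization f)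

theorem monomial_smul_mem (a : Fin c →₀ ℕ) {i : ℤ} {x : E.F} (hx : x ∈ E.grading i) :
    (MvPolynomial.monomial a 1 : MvPolynomial (Fin c) S) • x ∈ E.grading (i - 2 * a.degree) := by
  induction a using Finsupp.induction_linear generalizing i x with
  | zero => simpa using hx
  | add a b ha hb =>
    have h : (MvPolynomial.monomial (a + b) 1 : MvPolynomial (Fin c) S) =
        MvPolynomial.monomial a 1 * MvPolynomial.monomial b 1 := by simp
    rw [h, mul_smul, map_add]
    convert ha (hb hx) using 2
    push_cast
    ring
  | single k n =>
    induction n generalizing i x with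
    | zero => simpa using hx
    | succ n ih =>
      have h : (MvPolynomial.monomial (Finsupp.single k (n + 1)) 1 : MvPolynomial (Fin c) S) =
          MvPolynomial.monomial (Finsupp.single k n) 1 * MvPolynomial.X k := by
        simp [MvPolynomial.X, MvPolynomial.monomial_mul]
      rw [h, mul_smul]
      convert ih (E.X_smul_mem k i x hx) using 2
      simp only [Finsupp.degree_single]
      push_cast
      ring

variable {m : ℕ} (b : Module.Basis (Fin m) (MvPolynomial (Fin c) S) E.F) (e : Fin m → ℤ)

/-- The `S`-basis `t^a b_k` of a graded matrix factorization. -/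
def baseBasis : Module.Basis ((Fin c →₀ ℕ) × Fin m) S E.F :=
  (MvPolynomial.basisMonomials (Fin c) S).smulTower b

theorem baseBasis_apply (x : (Fin c →₀ ℕ) × Fin m) :
    E.baseBasis b x = (MvPolynomial.monomial x.1 1 : MvPolynomial (Fin c) S) • b x.2 := by
  rw [baseBasis, Module.Basis.smulTower_apply, MvPolynomial.coe_basisMonomials]

theorem baseBasis_repr (y : E.F) (x : (Fin c →₀ ℕ) × Fin m) :
    (E.baseBasis b).repr y x = (b.repr y x.2).coeff x.1 :=
  Module.Basis.smulTower_repr _ _ _ _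

theorem baseBasis_mem (he : ∀ k, b k ∈ E.grading (e k))
    (x : (Fin c →₀ ℕ) × Fin m) :
    E.baseBasis b x ∈ E.grading (e x.2 - 2 * (x.1.degree : ℤ)) := by
  rw [baseBasis_apply]
  exact E.monomial_smul_mem _ (he _)

/-- The basis `t^a b_k` of a graded component of `F`. -/
def gradingBasis (he : ∀ k, b k ∈ E.grading (e k)) (l : ℤ) :
    Module.Basis (DividedIndex c (fun k => -e k) l) S (E.grading (-l)) :=
  (E.baseBasis b).gradedComponent E.grading (fun x => e x.2 - 2 * (x.1.degree : ℤ))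
    (E.baseBasis_mem b e he) (-l) _ fun x => by constructor <;> intro h <;> linarith

instance finite_dividedIndex {K : Type*} [Finite K] (w : K → ℤ) (l : ℤ) :
    Finite (DividedIndex c w l) := by
  have h : ∀ k : K, {x : (Fin c →₀ ℕ) × K | x.2 = k ∧ w x.2 + 2 * (x.1.degree : ℤ) = l}.Finite := by
    intro k
    refine Set.Finite.subset ((Finsupp.finite_of_degree_eq (σ := Fin c)
      ((l - w k) / 2).toNat).prod (Set.finite_singleton k)) ?_
    rintro ⟨a, k'⟩ ⟨rfl, h⟩
    simp only at h
    simp only [Set.mem_prod, Set.mem_ofPred_eq, Set.mem_singleton_iff, and_true]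
    lia
  refine Set.Finite.to_subtype (Set.Finite.subset (Set.finite_iUnion h) ?_)
  intro x hx
  exact Set.mem_iUnion.mpr ⟨x.2, rfl, hx⟩

open scoped Classical in
/-- The basis of `Φ_l` dual to the monomial basis of `F_{-l}`. -/
def phiBasis (he : ∀ k, b k ∈ E.grading (e k)) (l : ℤ) : Module.Basis (DividedIndex c (fun k => -e k) l) (CIRing f)
    (CIRing f ⊗[S] Module.Dual S (E.grading (-l))) :=
  (E.gradingBasis b e he l).dualBasis.baseChange (CIRing f)

/-- The coefficients of the matrix of `d`. -/
def coeffD (k' k : Fin m) (a : Fin c →₀ ℕ) : S := (b.repr (E.d (b k')) k).coeff a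

/-- The weight of `b k` in $\Phi$ is `-e k`, because dualising reverses the grading; this is
homogeneity of `d` in terms of these weights. -/
theorem coeffD_shape (he : ∀ k, b k ∈ E.grading (e k))
    {k' k : Fin m} {a : Fin c →₀ ℕ} (h : E.coeffD b k' k a ≠ 0) :
    -e k' = -e k + 2 * a.degree - 1 := by
  by_contra h1
  apply h
  have := (E.baseBasis b).repr_eq_zero_of_mem_grading E.grading
    (fun x => e x.2 - 2 * (x.1.degree : ℤ)) (E.baseBasis_mem b e he)
    (E.d_mem _ _ (he k')) (j := (a, k)) (by intro h2; simp only at h2; apply h1; linarith)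
  rwa [baseBasis_repr] at this

/-- If $d b_{k'}=0$, then $\tilde f b_{k'}=d^2b_{k'}=0$, and comparing the coefficients of $t_j
b_{k'}$ gives $f_j=0$ for all $j$. -/
theorem exists_coeffD_ne_zero (hf : f ≠ 0) (k' : Fin m) : ∃ k a, E.coeffD b k' k a ≠ 0 := by
  by_contra! h
  have h1 : E.d (b k') = 0 := by
    apply b.repr.injective
    ext k a
    rw [map_zero]
    exact h k a
  have h2 := E.d_d (b k')
  rw [h1, map_zero] at h2
  have h3 := congrArg (fun y => b.repr y k') h2
  simp only [map_zero, map_smul, Module.Basis.repr_self, Finsupp.smul_single, smul_eq_mul, mul_one,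
    Finsupp.single_eq_same, Finsupp.zero_apply] at h3
  apply hf
  ext j
  have h4 := congrArg (MvPolynomial.coeff (Finsupp.single j 1)) h3
  classical
  simp only [MvPolynomial.coeff_zero, MvPolynomial.coeff_sum, MvPolynomial.coeff_C_mul,
    MvPolynomial.coeff_X, Finsupp.single_left_inj one_ne_zero] at h4
  simpa using h4.symm

/-- Since $d$ is linear over $S[t]$, $d(t^{b'}b_{k'})=t^{b'}d(b_{k'})$, whose coefficient at $t^b
b_k$ is that of $t^{b-b'}$ in the $k$-th coordinate of $d(b_{k'})$. Transposition turns $(b',k')$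
into the row index. -/
theorem hasDividedMatrix_phiD (he : ∀ k, b k ∈ E.grading (e k)) (l : ℤ) : HasDividedMatrix
    (fun k' k a => algebraMap S (CIRing f) (E.coeffD b k' k a))
    (E.phiBasis b e he l) (E.phiBasis b e he (l - 1)) (E.phiD l (l - 1)) := by
  classical
  intro x y
  rw [phiBasis, phiBasis, Module.Basis.baseChange_apply, phiD, LinearMap.baseChange_tmul,
    Module.Basis.baseChange_repr_tmul, Module.Basis.dualBasis_repr, LinearMap.dualMap_apply,
    Module.Basis.dualBasis_apply, gradingBasis, Module.Basis.gradedComponent_repr,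
    E.coe_dComp _ _ (by ring), gradingBasis, Module.Basis.coe_gradedComponent, baseBasis_apply,
    map_smul, baseBasis_repr, map_smul, Finsupp.smul_apply, smul_eq_mul,
    MvPolynomial.coeff_monomial_mul', Algebra.smul_def, mul_one]
  split_ifs
  · simp [coeffD]
  · simp

/-- The differential of `Φ(F, d)` in degrees far enough to the left of the generators. -/
theorem complexMinors_phi_eq (he : ∀ k, b k ∈ E.grading (e k))
    (hc : 1 < c) (hf : f ≠ 0) (r : ℕ) (hr : 1 ≤ r) {n N : ℤ}
    (hn : IsLeast {j | Even (j - n) ∧ ∃ k, e k = j} n)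
    (hN : IsGreatest {j | Even (j - n) ∧ ∃ k, e k = j} N) (l : ℤ) (hln : Even (1 - n - l))
    (hl : ((r : ℤ) - 1) * (N - n + 4) - n + 1 ≤ l) :
    complexMinors E.Phi r l = complexMinors E.Phi 1 (-n + 1) ^ r := by
  rcases subsingleton_or_nontrivial (CIRing f) with h0 | h0
  · exact Subsingleton.elim _ _
  have hnN : n ≤ N := hn.2 hN.1
  obtain ⟨t, ht⟩ := hN.1.1
  have hbound : ∀ k, Even (e k - n) → n ≤ e k ∧ e k ≤ N := fun k hk =>
    ⟨hn.2 ⟨hk, k, rfl⟩, hN.2 ⟨hk, k, rfl⟩⟩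
  have hp : ∀ k' k a, algebraMap S (CIRing f) (E.coeffD b k' k a) ≠ 0 →
      -e k' = -e k + 2 * (a.degree : ℤ) - 1 := fun k' k a h =>
    E.coeffD_shape b e he fun h1 => h (by rw [h1, map_zero])
  have hpar : ∀ l, Even (1 - n - l) → ∀ k', Even (-e k' + 1 - l) → Even (e k' - n) := by
    intro l hln k' h
    have h1 := h.sub hln
    rw [show -e k' + 1 - l - (1 - n - l) = -(e k' - n) by ring, even_neg] at h1
    exact h1
  -- With $N-n=2t$, the exponents of the relevant coefficients are bounded by $t+1$.
  have hD : ∀ l, Even (1 - n - l) → ∀ k' k a, Even (-e k' + 1 - l) →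
      algebraMap S (CIRing f) (E.coeffD b k' k a) ≠ 0 → a.degree ≤ t.toNat + 1 := by
    intro l hln k' k a hk h
    have h1 := hbound k' (hpar l hln k' hk)
    have h2 := hp k' k a h
    -- The generator `k` has the other parity, about which nothing is known. A further nonzero
    -- coefficient of `d (b k)` leads to `k₂`, again of the parity of `n`, with
    -- $e_{k_2}=e_{k'}+2(|a_2|+|a|-1)\le N$.
    obtain ⟨k₂, a₂, h3⟩ := E.exists_coeffD_ne_zero b hf k
    have h4 := E.coeffD_shape b e he h3
    have h5 : Even (e k₂ - n) := by
      have h6 := (hpar l hln k' hk)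
      rw [show e k₂ - n = e k' - n + 2 * ((a₂.degree : ℤ) + a.degree - 1) by linarith]
      exact h6.add (even_two_mul _)
    have := (hbound k₂ h5).2
    lia
  -- Neither term of the differential vanishes from degree $-n+1$ on: `k₀`, of degree $n$,
  -- contributes to the target, and `k₁`, which occurs in $d(b_{k_0})$, to the source.
  obtain ⟨-, k₀, hk₀⟩ := hn.1
  obtain ⟨k₁, a₁, h₁⟩ := E.exists_coeffD_ne_zero b hf k₀
  have h₁' := E.coeffD_shape b e he h₁
  have hns : ∀ l, Even (1 - n - l) → -n + 1 ≤ l →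
      ¬ (Subsingleton (CIRing f ⊗[S] Module.Dual S (E.grading (-l))) ∨
        Subsingleton (CIRing f ⊗[S] Module.Dual S (E.grading (-(l - 1))))) := by
    intro l hln hl
    rw [(E.phiBasis b e he l).subsingleton_iff_isEmpty,
      (E.phiBasis b e he (l - 1)).subsingleton_iff_isEmpty, ← not_and_or, not_not]
    constructor
    · refine nonempty_dividedIndex (by lia) (k := k₁) ?_ (by linarith)
      rw [show -e k₁ - l = 1 - n - l - 2 * (a₁.degree : ℤ) by linarith]
      exact hln.sub (even_two_mul _)
    · refine nonempty_dividedIndex (by lia) (k := k₀) ?_ (by linarith)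
      rw [show -e k₀ - (l - 1) = 1 - n - l by linarith]
      exact hln
  have hr1 : 0 ≤ ((r : ℤ) - 1) * (N - n + 4) := mul_nonneg (by lia) (by linarith)
  have hl1 : Even (1 - n - (-n + 1)) := by
    rw [show 1 - n - (-n + 1) = 0 by ring]
    exact Even.zero
  have e1 : complexMinors E.Phi r l = _ :=
    (E.hasDividedMatrix_phiD b e he l).minorsIdeal_eq hp hc r (t.toNat + 1) (hD l hln) (by
      intro k' hk'
      have h1 := hbound k' (hpar l hln k' hk')
      -- The constant $N-n+4$ of the theorem is $2(D+1)$ for $D=t+1$.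
      have h2 : (2 : ℤ) * (((t.toNat + 1 : ℕ) : ℤ) + 1) = N - n + 4 := by lia
      rw [mul_comm 2, mul_assoc, h2]
      linarith) (hns l hln (by linarith))
  have e2 : complexMinors E.Phi 1 (-n + 1) = _ :=
    (E.hasDividedMatrix_phiD b e he (-n + 1)).minorsIdeal_one_eq hp hc (t.toNat + 1)
      (hD _ hl1) (by
      intro k' hk'
      have h1 := hbound k' (hpar _ hl1 k' hk')
      linarith) (hns _ hl1 le_rfl)
  rw [e1, e2]
  congr 1
  unfold entryIdeal
  congr 1
  ext z
  refine exists_congr fun k' => exists_congr fun k => exists_congr fun a =>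
    and_congr_left fun _ => ?_
  rw [show -e k' + 1 - l = -e k' + 1 - (-n + 1) + (1 - n - l) by ring, Int.even_add]
  simp [hln]

/-- For odd $n$ the odd integers are those differing from $n$ by an even number; both parities are
thus instances of one statement phrased relative to $n$. -/
theorem complexMinors_phi_odd (he : ∀ k, b k ∈ E.grading (e k))
    (hc : 1 < c) (hf : f ≠ 0) (r : ℕ) (hr : 1 ≤ r) {n N : ℤ}
    (hn : IsLeast {j | Odd j ∧ ∃ k, e k = j} n)
    (hN : IsGreatest {j | Odd j ∧ ∃ k, e k = j} N) (l : ℤ) (hln : Even l)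
    (hl : -(-((r : ℤ) - 1) * (N - n + 4) + n) + 1 ≤ l) :
    complexMinors E.Phi r l = complexMinors E.Phi 1 (-n + 1) ^ r := by
  have ho := hn.1.1
  have : ∀ j, Odd j ↔ Even (j - n) := by
    intro j
    rw [Int.even_sub, ← Int.not_odd_iff_even, ← Int.not_odd_iff_even]
    simp [ho]
  simp only [this] at hn hN
  refine E.complexMinors_phi_eq b e he hc hf r hr hn hN l ?_ (by linarith)
  exact (odd_one.sub_odd ho).sub hln

theorem complexMinors_phi_even (he : ∀ k, b k ∈ E.grading (e k))
    (hc : 1 < c) (hf : f ≠ 0) (r : ℕ) (hr : 1 ≤ r) {n N : ℤ}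
    (hn : IsLeast {j | Even j ∧ ∃ k, e k = j} n)
    (hN : IsGreatest {j | Even j ∧ ∃ k, e k = j} N) (l : ℤ) (hln : Odd l)
    (hl : -(-((r : ℤ) - 1) * (N - n + 4) + n) + 1 ≤ l) :
    complexMinors E.Phi r l = complexMinors E.Phi 1 (-n + 1) ^ r := by
  have ho := hn.1.1
  have : {j | Even j ∧ ∃ k, e k = j} = {j | Even (j - n) ∧ ∃ k, e k = j} := by
    ext j
    refine and_congr_left fun _ => ?_
    rw [Int.even_sub]
    simp [ho]
  rw [this] at hn hN
  refine E.complexMinors_phi_eq b e he hc hf r hr hn hN l ?_ (by linarith)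
  exact (odd_one.sub_even ho).sub_odd hln

/-- With `f = 0` allowed, applying `d` twice no longer bounds exponents. As no explicit `L` is asked
for, a common bound `W` for all $|e_k|$ serves for both parities. -/
theorem exists_complexMinors_phi_eq_add_two (hc : 1 < c) (r : ℕ) (hr : 1 ≤ r) :
    ∃ L : ℤ, ∀ l : ℤ, L ≤ l → complexMinors E.Phi r l = complexMinors E.Phi r (l + 2) := by
  rcases subsingleton_or_nontrivial (CIRing f) with h0 | h0
  · exact ⟨0, fun l _ => Subsingleton.elim _ _⟩
  obtain ⟨m, b, e, he⟩ := E.free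
  obtain ⟨W, hW⟩ : ∃ W : ℕ, ∀ k, |e k| ≤ W := by
    refine ⟨∑ k, (e k).natAbs, fun k => ?_⟩
    rw [Int.abs_eq_natAbs]
    exact_mod_cast Finset.single_le_sum (f := fun k => (e k).natAbs)
      (fun _ _ => Nat.zero_le _) (Finset.mem_univ k)
  have hp : ∀ k' k a, algebraMap S (CIRing f) (E.coeffD b k' k a) ≠ 0 →
      -e k' = -e k + 2 * (a.degree : ℤ) - 1 := fun k' k a h =>
    E.coeffD_shape b e he fun h1 => h (by rw [h1, map_zero])
  -- Here $D=W+1$, because $2|a|=e_k-e_{k'}+1\le 2W+1$.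
  refine ⟨W + 2 * ((r : ℤ) - 1) * ((W + 1 : ℕ) + 1) + 1, fun l hl => ?_⟩
  refine (E.hasDividedMatrix_phiD b e he l).minorsIdeal_eq_of_add_two
    (E.hasDividedMatrix_phiD b e he (l + 2)) hp hc r hr (W + 1) ?_ ?_
  · intro k' k a h
    have := hp k' k a h
    have h1 := abs_le.mp (hW k)
    have h2 := abs_le.mp (hW k')
    lia
  · intro k'
    have h2 := abs_le.mp (hW k')
    linarith

end GradedMatrixFactorization

theorem IsShamashComplex.exists_complexMinors_eq_add_two {S : Type u} [CommRing S] {c : ℕ}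
    {f : Fin c → S} {C : ChainComplex (ModuleCat.{u} (CIRing f)) ℤ} (hC : IsShamashComplex f C)
    (hc : 1 < c) (r : ℕ) (hr : 1 ≤ r) :
    ∃ L : ℤ, ∀ l : ℤ, L ≤ l → complexMinors C r l = complexMinors C r (l + 2) := by
  obtain ⟨E, ⟨i⟩⟩ := hC
  obtain ⟨L, hL⟩ := E.exists_complexMinors_phi_eq_add_two hc r hr
  refine ⟨L, fun l hl => ?_⟩
  rw [complexMinors_of_iso i, complexMinors_of_iso i, hL l hl]

end

noncomputable section

/-! ### The Shamash construction in its monomial basis -/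

namespace HigherHomotopies

variable {S : Type u} [CommRing S] {c : ℕ} {f : Fin c → S} {G : ChainComplex (ModuleCat.{u} S) ℤ}
  {ι : ℤ → Type*}

/-- The index `y^(b) ⊗ g` of an element of the monomial basis of the Shamash construction. -/
def shIndex (ι : ℤ → Type*) (n : ℤ) (x : Σ b : Fin c →₀ ℕ, ι (n - 2 * b.degree)) :
    DividedIndex c (fun k : Σ i, ι i => k.1) n :=
  ⟨(x.1, ⟨n - 2 * x.1.degree, x.2⟩), by ring⟩

theorem shIndex_bijective (n : ℤ) : Function.Bijective (shIndex (c := c) ι n) := by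
  constructor
  · rintro ⟨b, t⟩ ⟨b', t'⟩ h
    have h1 := congrArg Subtype.val h
    simp only [shIndex, Prod.mk.injEq] at h1
    obtain ⟨rfl, h2⟩ := h1
    simp only [Sigma.mk.injEq, heq_eq_eq, true_and] at h2
    rw [h2]
  · rintro ⟨⟨b, ⟨i, t⟩⟩, h⟩
    obtain rfl : i = n - 2 * b.degree := by simp only at h; linarith
    exact ⟨⟨b, t⟩, rfl⟩

/-- The basis `y^(b) ⊗ g` of the Shamash construction. -/
def shBasis (f : Fin c → S) (β : ∀ i, Module.Basis (ι i) S (G.X i)) (n : ℤ) :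
    Module.Basis (DividedIndex c (fun k : Σ i, ι i => k.1) n) (CIRing f) (ShX f G n) :=
  (DFinsupp.basis fun b : Fin c →₀ ℕ =>
    (β (n - 2 * b.degree)).baseChange (CIRing f)).reindex
      (Equiv.ofBijective (shIndex ι n) (shIndex_bijective n))

variable (β : ∀ i, Module.Basis (ι i) S (G.X i))

theorem shBasis_repr (n : ℤ) (z : ShX f G n) (b : Fin c →₀ ℕ) (t : ι (n - 2 * b.degree)) :
    (shBasis f β n).repr z (shIndex ι n ⟨b, t⟩) =
      ((β (n - 2 * b.degree)).baseChange (CIRing f)).repr (z b) t := by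
  have : shIndex ι n ⟨b, t⟩ = Equiv.ofBijective (shIndex ι n) (shIndex_bijective n) ⟨b, t⟩ := rfl
  rw [shBasis, this, Module.Basis.repr_reindex_apply, Equiv.symm_apply_apply]
  rfl

theorem shBasis_shIndex (n : ℤ) (b : Fin c →₀ ℕ) (t : ι (n - 2 * b.degree)) :
    shBasis f β n (shIndex ι n ⟨b, t⟩) = DirectSum.lof (CIRing f) (Fin c →₀ ℕ)
      (fun b' => CIRing f ⊗[S] G.X (n - 2 * b'.degree)) b (1 ⊗ₜ β _ t) := by
  classical
  apply (shBasis f β n).repr.injective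
  ext x
  obtain ⟨⟨b', t'⟩, rfl⟩ := (shIndex_bijective n).2 x
  rw [Module.Basis.repr_self, shBasis_repr, Finsupp.single_apply]
  simp only [(shIndex_bijective n).1.eq_iff]
  by_cases h : b = b'
  · subst h
    rw [DirectSum.lof_apply, Module.Basis.baseChange_repr_tmul, Module.Basis.repr_self,
      Finsupp.single_apply]
    simp
  · rw [if_neg fun h' => h (congrArg Sigma.fst h')]
    have : (DirectSum.lof (CIRing f) (Fin c →₀ ℕ)
      (fun b' => CIRing f ⊗[S] G.X (n - 2 * b'.degree)) b (1 ⊗ₜ β _ t)) b' = 0 :=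
      DirectSum.of_eq_of_ne b b' _ (Ne.symm h)
    rw [this, map_zero, Finsupp.zero_apply]

variable (s : HigherHomotopies f G)

/-- The coefficients of the matrices of the higher homotopies. -/
def coeffσ (k' k : Σ i, ι i) (a : Fin c →₀ ℕ) : S := (β k'.1).repr (s.σ a k.1 k'.1 (β k.1 k.2)) k'.2

theorem coeffσ_shape {k' k : Σ i, ι i} {a : Fin c →₀ ℕ} (h : coeffσ β s k' k a ≠ 0) :
    k'.1 = k.1 + 2 * a.degree - 1 := by
  by_contra h1
  apply h
  rw [coeffσ, s.shape _ _ _ h1]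
  simp

/-- In $\sum_{a+b''=b}y^{(b'')}\otimes\sigma_a(g)$ the monomial $y^{(b')}$ occurs at most once, with
$a=b-b'$, and only if $b'\le b$. -/
theorem hasDividedMatrix_shD (n : ℤ) : HasDividedMatrix
    (P := ShX f G n) (Q := ShX f G (n - 1))
    (fun k' k a => algebraMap S (CIRing f) (coeffσ β s k' k a))
    (shBasis f β n) (shBasis f β (n - 1)) (s.shD n (n - 1)) := by
  intro x y
  obtain ⟨⟨b, t⟩, rfl⟩ := (shIndex_bijective n).2 x
  obtain ⟨⟨b', t'⟩, rfl⟩ := (shIndex_bijective (n - 1)).2 y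
  rw [shBasis_shIndex, shBasis_repr, shD_lof, DFinsupp.finsetSum_apply, map_sum,
    Finsupp.finsetSum_apply]
  have h0 : ∀ p ∈ Finset.HasAntidiagonal.antidiagonal b, p.2 ≠ b' →
      (((β (n - 1 - 2 * b'.degree)).baseChange (CIRing f)).repr
        ((DirectSum.lof (CIRing f) (Fin c →₀ ℕ)
          (fun b' => CIRing f ⊗[S] G.X (n - 1 - 2 * b'.degree)) p.2
        ((s.σ p.1 (n - 2 * b.degree) (n - 1 - 2 * p.2.degree)).baseChange (CIRing f)
          (1 ⊗ₜ β _ t))) b')) t' = 0 := by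
    intro p _ hp
    have : ∀ v, (DirectSum.lof (CIRing f) (Fin c →₀ ℕ)
      (fun b' => CIRing f ⊗[S] G.X (n - 1 - 2 * b'.degree)) p.2 v) b' = 0 := fun v =>
      DirectSum.of_eq_of_ne (β := fun b' : Fin c →₀ ℕ => CIRing f ⊗[S] G.X (n - 1 - 2 * b'.degree))
        p.2 b' v (Ne.symm hp)
    rw [this, map_zero, Finsupp.zero_apply]
  by_cases h : b' ≤ b
  · refine Eq.trans ?_ (if_pos h).symm
    rw [Finset.sum_eq_single (b - b', b')]
    · rw [DirectSum.lof_apply, LinearMap.baseChange_tmul, Module.Basis.baseChange_repr_tmul,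
        Algebra.smul_def, mul_one]
      rfl
    · rintro ⟨a, b''⟩ hp hne
      refine h0 _ hp ?_
      rintro rfl
      apply hne
      rw [Finset.HasAntidiagonal.mem_antidiagonal] at hp
      simp only at hp ⊢
      rw [← hp, add_tsub_cancel_right]
    · intro hp
      exfalso
      apply hp
      rw [Finset.HasAntidiagonal.mem_antidiagonal]
      exact tsub_add_cancel_of_le h
  · refine Eq.trans ?_ (if_neg h).symm
    refine Finset.sum_eq_zero fun p hp => h0 p hp ?_
    rintro rfl
    apply h
    rw [Finset.HasAntidiagonal.mem_antidiagonal] at hp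
    rw [← hp]
    exact le_add_self

/-- The ideals of minors of the Shamash construction on a complex of free modules of length `p`
are eventually `2`-periodic. -/
theorem complexMinors_sh_eq_add_two (hc : 1 < c) (r : ℕ) (hr : 1 ≤ r) (p : ℕ)
    (hfree : ∀ i, Module.Free S (G.X i)) (h0 : ∀ i < 0, Subsingleton (G.X i))
    (h1 : ∀ i : ℤ, p < i → Subsingleton (G.X i)) (l : ℕ) (hl : r * p + 4 * (r - 1) + 1 ≤ l) :
    complexMinors s.Sh r l = complexMinors s.Sh r (l + 2) := by
  rcases subsingleton_or_nontrivial (CIRing f) with hR | hR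
  · exact Subsingleton.elim _ _
  have hS : Nontrivial S := (algebraMap S (CIRing f)).domain_nontrivial
  let β := fun i => Module.Free.chooseBasis S (G.X i)
  have hk : ∀ k : Σ i, Module.Free.ChooseBasisIndex S (G.X i), 0 ≤ k.1 ∧ k.1 ≤ p := by
    rintro ⟨i, t⟩
    constructor
    · by_contra! h
      exact (β i).ne_zero t (@Subsingleton.elim _ (h0 i h) _ _)
    · by_contra! h
      exact (β i).ne_zero t (@Subsingleton.elim _ (h1 i h) _ _)
  have hp : ∀ k' k a, algebraMap S (CIRing f) (coeffσ β s k' k a) ≠ 0 →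
      k'.1 = k.1 + 2 * (a.degree : ℤ) - 1 := fun k' k a h =>
    coeffσ_shape β s fun h1 => h (by rw [h1, map_zero])
  -- All generators have weight in $[0,p]$, so a nonzero coefficient has $2|a|\le p+1$.
  refine (hasDividedMatrix_shD β s l).minorsIdeal_eq_of_add_two
    (hasDividedMatrix_shD β s (l + 2)) hp hc r hr ((p + 1) / 2) ?_ ?_
  · intro k' k a h
    have h2 := hp k' k a h
    have h3 := hk k
    have h4 := hk k'
    lia
  · intro k'
    have h4 := hk k'
    -- This already gives the bound $p+(r-1)(p+3)+1$, which is at most the required $rp+4(r-1)+1$.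
    have h5 : (2 : ℤ) * ((((p + 1) / 2 : ℕ) : ℤ) + 1) ≤ p + 3 := by lia
    have h6 : ((r : ℤ) - 1) * (2 * ((((p + 1) / 2 : ℕ) : ℤ) + 1)) ≤ ((r : ℤ) - 1) * (p + 3) :=
      mul_le_mul_of_nonneg_left h5 (by lia)
    have h7 : (r : ℤ) * p + 4 * (r - 1) + 1 ≤ l := by
      have : ((r - 1 : ℕ) : ℤ) = r - 1 := by push_cast [hr]; ring
      rw [← this]
      exact_mod_cast hl
    have h8 : 0 ≤ (r : ℤ) - 1 := by lia
    nlinarith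

end HigherHomotopies

end

noncomputable section

/-! ### Regular local rings: integrality and regular generators of the maximal ideal -/

section RegularLocal

open IsLocalRing

theorem natCast_le_of_add_one_le {n : ℕ} {d : WithBot ℕ∞} (k : ℕ)
    (h : ((n + k : ℕ) : WithBot ℕ∞) ≤ d + k) : (n : WithBot ℕ∞) ≤ d := by
  induction d with
  | bot =>
    exfalso
    rw [WithBot.bot_add] at h
    exact absurd h (by rw [le_bot_iff]; exact WithBot.coe_ne_bot)
  | coe d =>
    induction d with
    | top => exact le_top
    | coe d =>
      have h' : ((n + k : ℕ) : WithBot ℕ∞) ≤ ((d + k : ℕ) : WithBot ℕ∞) := by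
        refine h.trans_eq ?_
        push_cast
        rfl
      rw [Nat.cast_le] at h'
      have : (n : WithBot ℕ∞) ≤ ((d : ℕ) : WithBot ℕ∞) := Nat.cast_le.mpr (by lia)
      exact this

theorem maximalIdeal_quotient {R : Type*} [CommRing R] [IsLocalRing R] (I : Ideal R)
    [IsLocalRing (R ⧸ I)] (hI : I ≤ maximalIdeal R) :
    maximalIdeal (R ⧸ I) = (maximalIdeal R).map (Ideal.Quotient.mk I) := by
  ext y
  obtain ⟨a, rfl⟩ := Ideal.Quotient.mk_surjective y
  rw [Ideal.mem_quotient_iff_mem hI, mem_maximalIdeal, mem_nonunits_iff, mem_maximalIdeal,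
    mem_nonunits_iff, not_iff_not]
  constructor
  · intro h
    by_contra ha
    obtain ⟨b, hb⟩ := h.exists_right_inv
    obtain ⟨b, rfl⟩ := Ideal.Quotient.mk_surjective b
    rw [← map_mul, ← map_one (Ideal.Quotient.mk I), Ideal.Quotient.eq] at hb
    have h1 : a * b ∈ maximalIdeal R := Ideal.mul_mem_right _ _ ha
    have h2 := (maximalIdeal R).sub_mem h1 (hI hb)
    rw [sub_sub_cancel] at h2
    exact h2 isUnit_one
  · exact fun h => h.map _

/-- Induction on the number of generators. An element $y\in\mathfrak m\setminus\mathfrak m^2$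
outside all minimal primes can replace one generator, so $R/(y)$ is a domain by induction and $(y)$
is prime. A minimal prime $q\subseteq(y)$ satisfies $q=yq$, hence $q=0$ by Nakayama. Assuming only
$n\le\dim R$ lets the hypothesis pass to the quotient by a single dimension inequality. -/
theorem isDomain_of_span_eq_maximalIdeal (n : ℕ) : ∀ (R : Type u) [CommRing R] [IsLocalRing R]
    [IsNoetherianRing R] (x : Fin n → R), Ideal.span (Set.range x) = maximalIdeal R →
    (n : WithBot ℕ∞) ≤ ringKrullDim R → IsDomain R := by
  induction n with
  | zero =>
    intro R _ _ _ x hx _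
    have h : maximalIdeal R = ⊥ := by rw [← hx, Set.range_eq_empty, Ideal.span_empty]
    exact (isField_iff_maximalIdeal_eq.mpr h).isDomain
  | succ n ih =>
    intro R _ _ _ x hx hn
    have hpos : ringKrullDim R ≠ 0 := by
      intro h
      rw [h] at hn
      have : ((n + 1 : ℕ) : WithBot ℕ∞) ≤ ((0 : ℕ) : WithBot ℕ∞) := hn
      rw [Nat.cast_le] at this
      lia
    obtain ⟨y, hym, hy⟩ : ∃ y ∈ maximalIdeal R, y ∉ maximalIdeal R ^ 2 ∧
        ∀ q ∈ minimalPrimes R, y ∉ q := by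
      by_contra! h
      have hfin := minimalPrimes.finite_of_isNoetherianRing R
      classical
      have h1 : (maximalIdeal R : Set R) ⊆
          ⋃ i ∈ (↑(insert (maximalIdeal R ^ 2) hfin.toFinset) : Set (Ideal R)), (i : Set R) := by
        intro y hy
        by_cases hy2 : y ∈ maximalIdeal R ^ 2
        · exact Set.mem_biUnion (x := maximalIdeal R ^ 2) (by simp) hy2
        · obtain ⟨q, hq, hyq⟩ := h y hy hy2
          exact Set.mem_biUnion (x := q) (by simp [hq]) hyq
      -- Prime avoidance tolerates exceptional ideals that are not prime; here $\mathfrak m^2$ is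
      -- the only one.
      rw [Ideal.subset_union_prime (maximalIdeal R ^ 2) (maximalIdeal R ^ 2)] at h1
      · obtain ⟨q, hq, hle⟩ := h1
        rw [Finset.mem_insert, Set.Finite.mem_toFinset] at hq
        rcases hq with rfl | hq
        · have h2 : maximalIdeal R = ⊥ := by
            refine Submodule.eq_bot_of_le_smul_of_le_jacobson_bot (maximalIdeal R) _
              (IsNoetherian.noetherian _) ?_ (IsLocalRing.maximalIdeal_le_jacobson _)
            rwa [smul_eq_mul, ← pow_two]
          apply hpos
          exact ringKrullDim_eq_zero_of_isField (isField_iff_maximalIdeal_eq.mpr h2)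
        · have hqp : q.IsPrime := hq.1.1
          have h2 : q = maximalIdeal R := le_antisymm (le_maximalIdeal hqp.ne_top) hle
          have h3 : (maximalIdeal R).height = 0 := by
            rw [← h2]
            exact Ideal.height_eq_zero_iff.mpr hq
          rw [← maximalIdeal_height_eq_ringKrullDim, h3] at hpos
          exact hpos rfl
      · intro i hi h2 _
        rw [Finset.mem_insert, Set.Finite.mem_toFinset] at hi
        exact (hi.resolve_left h2).1.1
    obtain ⟨hy2, hyq⟩ := hy
    obtain ⟨a, ha⟩ := Ideal.mem_span_range_iff_exists_fun.mp (hx ▸ hym)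
    have hxm : ∀ i, x i ∈ maximalIdeal R := fun i => hx ▸ Ideal.subset_span ⟨i, rfl⟩
    obtain ⟨i, hi⟩ : ∃ i, IsUnit (a i) := by
      by_contra! h
      apply hy2
      rw [← ha, pow_two]
      exact Ideal.sum_mem _ fun i _ => Ideal.mul_mem_mul (h i) (hxm i)
    have hle : Ideal.span {y} ≤ maximalIdeal R := (Ideal.span_singleton_le_iff_mem _).mpr hym
    have hnt : Nontrivial (R ⧸ Ideal.span {y}) :=
      Ideal.Quotient.nontrivial_iff.mpr fun h => (h ▸ hle).not_gt (lt_top_iff_ne_top.mpr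
        (maximalIdeal.isMaximal R).ne_top)
    have hloc : IsLocalRing (R ⧸ Ideal.span {y}) :=
      IsLocalRing.of_surjective' (Ideal.Quotient.mk _) Ideal.Quotient.mk_surjective
    have hdom : IsDomain (R ⧸ Ideal.span {y}) := by
      refine ih (R ⧸ Ideal.span {y}) (fun j => Ideal.Quotient.mk _ (x (i.succAbove j))) ?_ ?_
      · rw [maximalIdeal_quotient _ hle]
        apply le_antisymm
        · rw [Ideal.span_le]
          rintro _ ⟨j, rfl⟩
          exact Ideal.mem_map_of_mem _ (hxm _)
        · rw [← hx, Ideal.map_span, Ideal.span_le]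
          rintro _ ⟨_, ⟨k, rfl⟩, rfl⟩
          rcases Fin.eq_self_or_eq_succAbove i k with rfl | ⟨j, rfl⟩
          · obtain ⟨b, hb⟩ := hi.exists_left_inv
            rw [Fin.sum_univ_succAbove _ k] at ha
            have h1 : x k = b * y - ∑ j, b * a (k.succAbove j) * x (k.succAbove j) := by
              rw [← ha, mul_add, ← mul_assoc, hb, Finset.mul_sum]
              simp [mul_assoc]
            have h2 : Ideal.Quotient.mk (Ideal.span {y}) y = 0 :=
              Ideal.Quotient.eq_zero_iff_mem.mpr (Ideal.mem_span_singleton_self y)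
            rw [SetLike.mem_coe, h1, map_sub, map_mul, h2, mul_zero, zero_sub, map_sum]
            refine Ideal.neg_mem_iff _ |>.mpr (Ideal.sum_mem _ fun j _ => ?_)
            rw [map_mul]
            exact Ideal.mul_mem_left _ _ (Ideal.subset_span ⟨j, rfl⟩)
          · exact Ideal.subset_span ⟨j, rfl⟩
      · refine natCast_le_of_add_one_le 1 (hn.trans ?_)
        have := ringKrullDim_le_ringKrullDim_quotient_add_card ({y} : Finset R) (by
          rw [IsLocalRing.ringJacobson_eq_maximalIdeal]
          simpa using hym)
        rw [Finset.coe_singleton, Finset.card_singleton] at this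
        exact this
    have hprime : (Ideal.span {y}).IsPrime := (Ideal.Quotient.isDomain_iff_prime _).mp hdom
    obtain ⟨q, hq, hqy⟩ := Ideal.exists_minimalPrimes_le (I := ⊥) (J := Ideal.span {y}) bot_le
    have hqp : q.IsPrime := hq.1.1
    -- Each $z\in q$ is $wy$ with $y\notin q$, so $w\in q$ and therefore $q\subseteq\mathfrak m q$.
    have hbot : q = ⊥ := by
      refine Submodule.eq_bot_of_le_smul_of_le_jacobson_bot (maximalIdeal R) _
        (IsNoetherian.noetherian _) ?_ (IsLocalRing.maximalIdeal_le_jacobson _)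
      intro z hz
      obtain ⟨w, rfl⟩ := Ideal.mem_span_singleton'.mp (hqy hz)
      have hw : w ∈ q := (hqp.mem_or_mem hz).resolve_right (hyq q hq)
      rw [mul_comm]
      exact Submodule.smul_mem_smul hym hw
    have : IsDomain (R ⧸ (⊥ : Ideal R)) := by
      rw [← hbot]
      exact (Ideal.Quotient.isDomain_iff_prime _).mpr hqp
    exact (RingEquiv.quotientBot R).symm.isDomain

/-- The maximal ideal of a regular local ring is generated by a regular sequence whose length is
the dimension. -/
theorem IsRegularLocalRing.exists_regular_generators (S : Type u) [CommRing S]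
    [IsRegularLocalRing S] : ∃ (n : ℕ) (x : ℕ → S), ringKrullDim S = n ∧
      Ideal.span (x '' Set.Iio n) = maximalIdeal S ∧
      ∀ j < n, ∀ a, x j * a ∈ Ideal.span (x '' Set.Iio j) → a ∈ Ideal.span (x '' Set.Iio j) := by
  classical
  have hfg : (maximalIdeal S).FG := IsNoetherian.noetherian _
  have hfin := Submodule.FG.finite_generators hfg
  have hcard := Submodule.FG.generators_ncard hfg
  have hspan : Ideal.span (maximalIdeal S).generators = maximalIdeal S :=
    Submodule.span_generators _
  have hdim := IsRegularLocalRing.spanFinrank_maximalIdeal (R := S)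
  obtain ⟨n, hn⟩ : ∃ n, n = (maximalIdeal S).spanFinrank := ⟨_, rfl⟩
  rw [← hn] at hcard hdim
  obtain ⟨e⟩ : Nonempty (Fin n ≃ (maximalIdeal S).generators) := by
    rw [← Nat.card_coe_set_eq] at hcard
    have := hfin.to_subtype
    exact ⟨(Finite.equivFinOfCardEq hcard).symm⟩
  let x : ℕ → S := fun i => if h : i < n then e ⟨i, h⟩ else 0
  have hx : Ideal.span (x '' Set.Iio n) = maximalIdeal S := by
    rw [← hspan]
    congr 1
    ext z
    constructor
    · rintro ⟨i, hi, rfl⟩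
      have hi' : i < n := hi
      simp only [x, dif_pos hi']
      exact (e ⟨i, hi'⟩).2
    · intro hz
      obtain ⟨i, hi⟩ := e.surjective ⟨z, hz⟩
      refine ⟨i, i.2, ?_⟩
      simp [x, hi]
  refine ⟨n, x, hdim.symm, hx, fun j hj a ha => ?_⟩
  have hxm : ∀ i < n, x i ∈ maximalIdeal S := fun i hi => hx ▸ Ideal.subset_span ⟨i, hi, rfl⟩
  set I := Ideal.span (x '' Set.Iio j) with hI
  have hle : I ≤ maximalIdeal S := by
    rw [hI, Ideal.span_le]
    rintro _ ⟨i, hi, rfl⟩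
    exact hxm i (lt_trans hi hj)
  have hnt : Nontrivial (S ⧸ I) :=
    Ideal.Quotient.nontrivial_iff.mpr fun h => (h ▸ hle).not_gt (lt_top_iff_ne_top.mpr
      (maximalIdeal.isMaximal S).ne_top)
  have hloc : IsLocalRing (S ⧸ I) :=
    IsLocalRing.of_surjective' (Ideal.Quotient.mk _) Ideal.Quotient.mk_surjective
  obtain ⟨k, rfl⟩ := Nat.exists_eq_add_of_le hj.le
  -- Dividing out $j$ elements of $\mathfrak m$ lowers the dimension by at most $j$.
  have hkdim : (k : WithBot ℕ∞) ≤ ringKrullDim (S ⧸ I) := by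
    refine natCast_le_of_add_one_le j ?_
    rw [add_comm k j, hdim]
    have h1 := ringKrullDim_le_ringKrullDim_quotient_add_card
      ((Finset.range j).image x) (by
        rw [IsLocalRing.ringJacobson_eq_maximalIdeal]
        intro z hz
        obtain ⟨i, hi, rfl⟩ := Finset.mem_image.mp hz
        exact hxm i (lt_trans (Finset.mem_range.mp hi) hj))
    have h2 : ((((Finset.range j).image x : Finset S)) : Set S) = x '' Set.Iio j := by
      rw [Finset.coe_image, Finset.coe_range]
    rw [h2] at h1
    refine h1.trans (add_le_add le_rfl ?_)
    exact Nat.cast_le.mpr (Finset.card_image_le.trans (Finset.card_range j).le)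
  have hgen : Ideal.span (Set.range fun i : Fin k => Ideal.Quotient.mk I (x (j + i))) =
      maximalIdeal (S ⧸ I) := by
    rw [maximalIdeal_quotient _ hle]
    apply le_antisymm
    · rw [Ideal.span_le]
      rintro _ ⟨i, rfl⟩
      exact Ideal.mem_map_of_mem _ (hxm _ (by lia))
    · rw [← hx, Ideal.map_span, Ideal.span_le]
      rintro _ ⟨_, ⟨i, hi, rfl⟩, rfl⟩
      have hi' : i < j + k := hi
      rcases lt_or_ge i j with h | h
      · have h1 : x i ∈ I := Ideal.subset_span ⟨i, h, rfl⟩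
        rw [Ideal.Quotient.eq_zero_iff_mem.mpr h1]
        exact Ideal.zero_mem _
      · refine Ideal.subset_span ⟨⟨i - j, by lia⟩, ?_⟩
        simp only
        congr 2
        lia
  have hdom := isDomain_of_span_eq_maximalIdeal k (S ⧸ I) _ hgen hkdim
  have hprime : I.IsPrime := (Ideal.Quotient.isDomain_iff_prime _).mp hdom
  -- In the domain $S/I$ it remains to see that the image of $x_j$ is not zero. Otherwise $k-1$
  -- elements would generate its maximal ideal, although its dimension is at least $k$.
  refine (hprime.mem_or_mem ha).resolve_left fun hxj => ?_
  have h1 := ringKrullDim_le_spanFinrank_maximalIdeal (R := S ⧸ I)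
  have h2 : (maximalIdeal (S ⧸ I)).spanFinrank ≤ k - 1 := by
    have h3 : maximalIdeal (S ⧸ I) =
        Ideal.span ↑((Finset.Ico 1 k).image fun i => Ideal.Quotient.mk I (x (j + i))) := by
      rw [← hgen]
      apply le_antisymm
      · rw [Ideal.span_le]
        rintro _ ⟨⟨i, hi⟩, rfl⟩
        rcases Nat.eq_zero_or_pos i with rfl | h
        · simp only [add_zero]
          rw [Ideal.Quotient.eq_zero_iff_mem.mpr hxj]
          exact Ideal.zero_mem _
        · refine Ideal.subset_span ?_
          rw [Finset.mem_coe, Finset.mem_image]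
          exact ⟨i, Finset.mem_Ico.mpr ⟨h, hi⟩, rfl⟩
      · apply Ideal.span_mono
        intro z hz
        obtain ⟨i, hi, rfl⟩ := Finset.mem_image.mp (Finset.mem_coe.mp hz)
        exact ⟨⟨i, (Finset.mem_Ico.mp hi).2⟩, rfl⟩
    rw [h3]
    refine (Submodule.spanFinrank_span_le_ncard_of_finite (Finset.finite_toSet _)).trans ?_
    rw [Set.ncard_coe_finset]
    refine Finset.card_image_le.trans ?_
    simp
  have h3 := hkdim.trans h1
  rw [Nat.cast_le] at h3
  lia

end RegularLocal

end

noncomputable section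

/-! ### Free modules modulo initial segments of a sequence -/

section ModuloIdeal

variable {S M : Type*} [CommRing S] [AddCommGroup M] [Module S M]

theorem mem_ideal_smul_top_of_smul_mem [Module.Free S M] {I : Ideal S} {x : S}
    (hx : ∀ a, x * a ∈ I → a ∈ I) {w : M} (hw : x • w ∈ I • (⊤ : Submodule S M)) :
    w ∈ I • (⊤ : Submodule S M) := by
  let b := Module.Free.chooseBasis S M
  rw [b.mem_ideal_smul_top_iff] at hw ⊢
  intro i
  apply hx
  simpa using hw i

theorem exists_sub_smul_mem {x : ℕ → S} {j : ℕ} {z : M}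
    (hz : z ∈ Ideal.span (x '' Set.Iio (j + 1)) • (⊤ : Submodule S M)) :
    ∃ w, z - x j • w ∈ Ideal.span (x '' Set.Iio j) • (⊤ : Submodule S M) := by
  have h : Set.Iio (j + 1) = insert j (Set.Iio j) := by
    ext i
    simp only [Set.mem_Iio, Set.mem_insert_iff]
    lia
  rw [h, Set.image_insert_eq, Ideal.span_insert, Submodule.sup_smul,
    Submodule.ideal_span_singleton_smul] at hz
  obtain ⟨y, hy, y', hy', rfl⟩ := Submodule.mem_sup.mp hz
  obtain ⟨w, -, rfl⟩ := Submodule.mem_smul_pointwise_iff_exists _ _ _ |>.mp hy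
  exact ⟨w, by rwa [add_sub_cancel_left]⟩

theorem span_image_Iio_mono (x : ℕ → S) {i j : ℕ} (h : i ≤ j) :
    Ideal.span (x '' Set.Iio i) ≤ Ideal.span (x '' Set.Iio j) :=
  Ideal.span_mono (Set.image_mono (Set.Iio_subset_Iio h))

theorem mem_span_image_Iio_succ (x : ℕ → S) (j : ℕ) : x j ∈ Ideal.span (x '' Set.Iio (j + 1)) :=
  Ideal.subset_span ⟨j, Nat.lt_succ_self j, rfl⟩

theorem map_mem_ideal_smul_top {N : Type*} [AddCommGroup N] [Module S N] (g : M →ₗ[S] N)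
    {I : Ideal S} {z : M} (hz : z ∈ I • (⊤ : Submodule S M)) : g z ∈ I • (⊤ : Submodule S N) := by
  have h : g z ∈ (I • (⊤ : Submodule S M)).map g := ⟨z, hz, rfl⟩
  rw [Submodule.map_smul''] at h
  exact Submodule.smul_mono le_rfl le_top h

end ModuloIdeal

/-! ### Length of minimal free resolutions -/

section Resolutions

variable {S : Type u} [CommRing S]

/-- With $I_j=(x_0,\dots,x_{j-1})$, this is the vanishing of $H_i(G/I_jG)$ for $i>j$. The step
chases the long exact sequence of multiplication by $x_j$ on $G/I_jG$: if $dz\equiv x_jw$, then $w$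
is a cycle one degree lower, hence a boundary $dv$, and $z-x_jv$ is a cycle modulo $I_j$. The drop
in degree costs one in the range of $i$. -/
theorem exists_sub_d_mem_of_regular (G : ChainComplex (ModuleCat.{u} S) ℤ)
    (hfree : ∀ i, Module.Free S (G.X i))
    (hex : ∀ i, 0 < i → Function.Exact (G.d (i + 1) i).hom (G.d i (i - 1)).hom)
    (x : ℕ → S) (n : ℕ)
    (hx : ∀ j < n, ∀ a, x j * a ∈ Ideal.span (x '' Set.Iio j) → a ∈ Ideal.span (x '' Set.Iio j))
    (j : ℕ) (hj : j ≤ n) : ∀ k i l : ℤ, i + 1 = k → l + 1 = i → (j : ℤ) < i → ∀ z : G.X i,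
      (G.d i l).hom z ∈ Ideal.span (x '' Set.Iio j) • (⊤ : Submodule S (G.X l)) →
      ∃ v : G.X k, z - (G.d k i).hom v ∈
        Ideal.span (x '' Set.Iio j) • (⊤ : Submodule S (G.X i)) := by
  have hdd : ∀ (k i l : ℤ) (v : G.X k), (G.d i l).hom ((G.d k i).hom v) = 0 := fun k i l v =>
    congrArg (fun q => q.hom v) (G.d_comp_d k i l)
  induction j with
  | zero =>
    rintro k i l rfl hl hi z hz
    obtain rfl : l = i - 1 := by lia
    have h0 : Set.Iio 0 = (∅ : Set ℕ) := by ext; simp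
    rw [h0, Set.image_empty, Ideal.span_empty, Submodule.bot_smul, Submodule.mem_bot] at hz
    obtain ⟨v, hv⟩ := (hex i (by lia) z).mp hz
    exact ⟨v, by rw [hv, sub_self]; exact Submodule.zero_mem _⟩
  | succ j ih =>
    intro k i l hk hl hi z hz
    have hj' : j < n := by lia
    have hmono := span_image_Iio_mono x (Nat.le_succ j)
    obtain ⟨w, hw⟩ := exists_sub_smul_mem hz
    have h1 := map_mem_ideal_smul_top (G.d l (l - 1)).hom hw
    rw [map_sub, hdd, zero_sub, map_smul, neg_mem_iff] at h1
    have hf := hfree (l - 1)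
    have hf' := hfree l
    obtain ⟨v, hv⟩ := ih (by lia) i l (l - 1) hl (by lia) (by push_cast at hi; lia) w
      (mem_ideal_smul_top_of_smul_mem (hx j hj') h1)
    have h2 : (G.d i l).hom (z - x j • v) ∈
        Ideal.span (x '' Set.Iio j) • (⊤ : Submodule S (G.X l)) := by
      have h3 := Submodule.add_mem _ hw (Submodule.smul_mem _ (x j) hv)
      rw [map_sub, map_smul]
      convert h3 using 1
      rw [smul_sub]
      abel
    obtain ⟨v', hv'⟩ := ih (by lia) k i l hk hl (by push_cast at hi; lia) _ h2
    refine ⟨v', ?_⟩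
    have h4 := Submodule.add_mem _ (Submodule.smul_mono_left hmono hv')
      (Submodule.smul_mem_smul (mem_span_image_Iio_succ x j) (Submodule.mem_top (x := v)))
    convert h4 using 1
    abel

theorem IsMinimalFreeResolution.subsingleton_of_top_le [IsLocalRing S] {M : Type*}
    [AddCommGroup M] [Module S M] {G : ChainComplex (ModuleCat.{u} S) ℤ} {ε : G.X 0 →ₗ[S] M}
    (hG : IsMinimalFreeResolution G ε) (i : ℤ)
    (h : (⊤ : Submodule S (G.X i)) ≤ IsLocalRing.maximalIdeal S • (⊤ : Submodule S (G.X i))) :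
    Subsingleton (G.X i) := by
  have := hG.finite i
  have h1 := Submodule.eq_bot_of_le_smul_of_le_jacobson_bot (IsLocalRing.maximalIdeal S) ⊤
    Module.Finite.fg_top h (IsLocalRing.maximalIdeal_le_jacobson _)
  exact (Submodule.subsingleton_iff S).mp (subsingleton_of_bot_eq_top h1.symm)

theorem IsMinimalFreeResolution.d_mem [IsLocalRing S] {M : Type*}
    [AddCommGroup M] [Module S M] {G : ChainComplex (ModuleCat.{u} S) ℤ} {ε : G.X 0 →ₗ[S] M}
    (hG : IsMinimalFreeResolution G ε) (k i : ℤ) (v : G.X k) : (G.d k i).hom v ∈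
      IsLocalRing.maximalIdeal S • (⊤ : Submodule S (G.X i)) := by
  by_cases h : i + 1 = k
  · subst h
    exact hG.minimal i ⟨v, rfl⟩
  · rw [G.shape k i (by simpa using h)]
    exact Submodule.zero_mem _

/-- Over a regular local ring, minimal free resolutions have length at most the dimension. -/
theorem IsMinimalFreeResolution.subsingleton_of_ringKrullDim_lt [IsRegularLocalRing S] {M : Type*}
    [AddCommGroup M] [Module S M] {G : ChainComplex (ModuleCat.{u} S) ℤ} {ε : G.X 0 →ₗ[S] M}
    (hG : IsMinimalFreeResolution G ε) {n : ℕ} (hn : ringKrullDim S = n) (i : ℤ) (hi : n < i) :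
    Subsingleton (G.X i) := by
  obtain ⟨n', x, hn', hspan, hx⟩ := IsRegularLocalRing.exists_regular_generators S
  obtain rfl : n = n' := by
    rw [hn, Nat.cast_inj] at hn'
    exact hn'
  -- Modulo $\mathfrak m$ minimality makes all differentials zero, so every `z` is a cycle; above
  -- degree `n` it is then a boundary modulo $\mathfrak m$, hence lies in $\mathfrak mG_i$.
  refine hG.subsingleton_of_top_le i fun z _ => ?_
  obtain ⟨v, hv⟩ := exists_sub_d_mem_of_regular G hG.free hG.exact x n hx n le_rfl (i + 1) i (i - 1)
    rfl (by ring) hi z (by rw [hspan]; exact hG.d_mem _ _ _)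
  rw [hspan] at hv
  have := Submodule.add_mem _ hv (hG.d_mem (i + 1) i v)
  rwa [sub_add_cancel] at this

/-- The terms of a minimal free resolution beyond the projective dimension vanish. -/
theorem IsMinimalFreeResolution.subsingleton_of_hasProjectiveDimensionLE [IsLocalRing S]
    {M : Type u} [AddCommGroup M] [Module S M] {G : ChainComplex (ModuleCat.{u} S) ℤ}
    {ε : G.X 0 →ₗ[S] M} (hG : IsMinimalFreeResolution G ε) (p : ℕ)
    (hp : HasProjectiveDimensionLE (ModuleCat.of S M) p) (i : ℤ) (hi : p < i) :
    Subsingleton (G.X i) := by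
  -- a syzygy which is projective splits off
  have hstep : ∀ (i : ℤ) (N : Type u) [AddCommGroup N] [Module S N] (e : G.X i →ₗ[S] N) (n : ℕ),
      Function.Surjective e → Function.Exact (G.d (i + 1) i).hom e →
      HasProjectiveDimensionLE (ModuleCat.of S N) (n + 1) →
      HasProjectiveDimensionLE (ModuleCat.of S (LinearMap.range (G.d (i + 1) i).hom)) n := by
    intro i N _ _ e n hs he hN
    have hfree := hG.free i
    let T : ShortComplex (ModuleCat.{u} S) := ModuleCat.shortComplexOfCompEqZero
      (LinearMap.range (G.d (i + 1) i).hom).subtype e (by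
        ext ⟨_, v, rfl⟩
        exact he.apply_apply_eq_zero v)
    have hT : T.ShortExact := by
      refine ModuleCat.shortComplex_shortExact T ?_ Subtype.val_injective hs
      intro y
      refine (he y).trans ?_
      constructor
      · rintro ⟨v, rfl⟩
        exact ⟨⟨_, v, rfl⟩, rfl⟩
      · rintro ⟨⟨_, v, rfl⟩, rfl⟩
        exact ⟨v, rfl⟩
    have hproj : Projective (ModuleCat.of S (G.X i)) :=
      (IsProjective.iff_projective _).mp (Module.Projective.of_free)
    have : HasProjectiveDimensionLT T.X₂ (n + 1) :=
      hasProjectiveDimensionLT_of_ge (ModuleCat.of S (G.X i)) 1 _ (by lia)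
    exact hT.hasProjectiveDimensionLT_X₁ (n + 1) this hN
  have hsplit : ∀ (i : ℤ) (N : Type u) [AddCommGroup N] [Module S N] (e : G.X i →ₗ[S] N),
      Function.Surjective e → Function.Exact (G.d (i + 1) i).hom e →
      HasProjectiveDimensionLE (ModuleCat.of S N) 0 → ∀ v, (G.d (i + 1) i).hom v = 0 := by
    intro i N _ _ e hs he hN v
    have hproj : Module.Projective S N :=
      (IsProjective.iff_projective N).mpr ((projective_iff_hasProjectiveDimensionLE_zero _).mpr hN)
    obtain ⟨t, ht⟩ := Module.projective_lifting_property e LinearMap.id hs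
    have hte : ∀ y, e (t y) = y := fun y => LinearMap.congr_fun ht y
    -- Since `N` is projective, `π` projects $G_i$ onto the kernel of `e`, which is the image of the
    -- differential and so lies in $\mathfrak mG_i$. Applying `π` once more puts its range inside
    -- $\mathfrak m$ times itself, and Nakayama gives zero.
    let π : G.X i →ₗ[S] G.X i := LinearMap.id - t ∘ₗ e
    have hπ : ∀ y, e y = 0 → π y = y := fun y hy => by simp [π, hy]
    have hπe : ∀ y, e (π y) = 0 := fun y => by simp [π, hte]
    have hfin := hG.finite i
    have h1 : LinearMap.range π = ⊥ := by
      refine Submodule.eq_bot_of_le_smul_of_le_jacobson_bot (IsLocalRing.maximalIdeal S) _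
        ?_ ?_ (IsLocalRing.maximalIdeal_le_jacobson _)
      · rw [LinearMap.range_eq_map]
        exact Module.Finite.fg_top.map π
      · rintro _ ⟨y, rfl⟩
        obtain ⟨w, hw⟩ := (he (π y)).mp (hπe y)
        have h2 : π (π y) ∈ (IsLocalRing.maximalIdeal S • (⊤ : Submodule S (G.X i))).map π :=
          ⟨π y, hw ▸ hG.d_mem _ _ _, rfl⟩
        rwa [hπ _ (hπe y), Submodule.map_smul'', ← LinearMap.range_eq_map] at h2
    have h3 : π ((G.d (i + 1) i).hom v) ∈ LinearMap.range π := ⟨_, rfl⟩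
    rwa [h1, Submodule.mem_bot, hπ _ (he.apply_apply_eq_zero v)] at h3
  -- the differential vanishes beyond the projective dimension
  have hzero : ∀ (n : ℕ) (i : ℤ) (N : Type u) [AddCommGroup N] [Module S N] (e : G.X i →ₗ[S] N),
      0 ≤ i → Function.Surjective e → Function.Exact (G.d (i + 1) i).hom e →
      HasProjectiveDimensionLE (ModuleCat.of S N) n →
      ∀ k, k = i + n → ∀ v, (G.d (k + 1) k).hom v = 0 := by
    intro n
    induction n with
    | zero =>
      rintro i N _ _ e h0 hs he hN k rfl
      rw [Nat.cast_zero, add_zero]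
      exact hsplit i N e hs he hN
    | succ n ih =>
      rintro i N _ _ e h0 hs he hN k rfl
      refine ih (i + 1) (LinearMap.range (G.d (i + 1) i).hom) (G.d (i + 1) i).hom.rangeRestrict
        (by lia) (LinearMap.surjective_rangeRestrict _) ?_ (hstep i N e n hs he hN) _
        (by push_cast; ring)
      intro y
      have h1 := hG.exact (i + 1) (by lia)
      rw [show i + 1 - 1 = i by ring] at h1
      refine Iff.trans ?_ (h1 y)
      rw [← LinearMap.mem_ker, LinearMap.ker_rangeRestrict, LinearMap.mem_ker]
  -- All degrees from `p` on are reached by regarding every larger number as a bound for the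
  -- projective dimension.
  have hvan : ∀ k : ℤ, p ≤ k → ∀ v, (G.d (k + 1) k).hom v = 0 := by
    intro k hk
    obtain ⟨q, rfl⟩ := Int.eq_ofNat_of_zero_le (show 0 ≤ k by lia)
    have hq : HasProjectiveDimensionLE (ModuleCat.of S M) q :=
      hasProjectiveDimensionLT_of_ge (ModuleCat.of S M) (p + 1) _ (by lia)
    exact hzero q 0 M ε le_rfl hG.surjective hG.exact_zero hq _ (by ring)
  refine hG.subsingleton_of_top_le i fun z _ => ?_
  obtain ⟨w, rfl⟩ := (hG.exact i (by lia) z).mp (by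
    obtain ⟨k, rfl⟩ : ∃ k, i = k + 1 := ⟨i - 1, by ring⟩
    rw [show k + 1 - 1 = k by ring]
    exact hvan k (by lia) z)
  exact hG.d_mem _ _ _

end Resolutions

end

noncomputable section

/-! ### Part (B1) -/

namespace HigherHomotopies

variable {S : Type u} [CommRing S] {c : ℕ} {f : Fin c → S} {G : ChainComplex (ModuleCat.{u} S) ℤ}

theorem complexMinors_sh_of_projectiveDimension [IsLocalRing S] {M : Type u} [AddCommGroup M]
    [Module S M] {ε : G.X 0 →ₗ[S] M} (hG : IsMinimalFreeResolution G ε) (s : HigherHomotopies f G)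
    (hc : 1 < c) (r : ℕ) (hr : 1 ≤ r) (l : ℕ)
    (hl : (r : WithBot ℕ∞) * projectiveDimension (ModuleCat.of S M) +
      ((4 * (r - 1) + 1 : ℕ) : WithBot ℕ∞) ≤ (l : WithBot ℕ∞)) :
    complexMinors s.Sh r l = complexMinors s.Sh r (l + 2) := by
  generalize hd : projectiveDimension (ModuleCat.of S M) = d at hl
  induction d with
  | bot =>
    -- For $M=0$ the inequality on $\ell$ is no restriction; but then $G=0$, and both ideals are the
    -- unit ideal by convention.
    rw [projectiveDimension_eq_bot_iff, ModuleCat.isZero_iff_subsingleton] at hd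
    have h0 : ∀ i : ℤ, 0 ≤ i → Subsingleton (G.X i) := by
      intro i hi
      obtain ⟨q, rfl⟩ := Int.eq_ofNat_of_zero_le hi
      induction q with
      | zero =>
        refine hG.subsingleton_of_top_le _ fun z _ => ?_
        have hd' : Subsingleton M := hd
        obtain ⟨w, rfl⟩ := (hG.exact_zero z).mp (Subsingleton.elim _ _)
        exact hG.d_mem _ _ _
      | succ q ih =>
        refine hG.subsingleton_of_top_le _ fun z _ => ?_
        have h1 := ih (by lia)
        have h2 := hG.exact ((q + 1 : ℕ) : ℤ) (by lia)
        rw [show ((q + 1 : ℕ) : ℤ) - 1 = q by push_cast; ring] at h2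
        obtain ⟨w, rfl⟩ := (h2 z).mp (Subsingleton.elim _ _)
        exact hG.d_mem _ _ _
    have h1 : ∀ i : ℤ, Subsingleton (G.X i) := fun i =>
      (lt_or_ge i 0).elim (hG.zero_of_neg i) (h0 i)
    have h2 : ∀ n, Subsingleton (ShX f G n) := by
      intro n
      refine ⟨fun x y => DFinsupp.ext fun b => ?_⟩
      have := h1 (n - 2 * b.degree)
      exact Subsingleton.elim _ _
    exact (minorsIdeal_of_subsingleton r _ (Or.inl (h2 _))).trans
      (minorsIdeal_of_subsingleton r _ (Or.inl (h2 _))).symm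
  | coe d =>
    induction d with
    | top =>
      -- An infinite projective dimension contradicts the bound, since `r` is not zero.
      exfalso
      have h1 : (r : WithBot ℕ∞) * ((⊤ : ℕ∞) : WithBot ℕ∞) = ((⊤ : ℕ∞) : WithBot ℕ∞) := by
        change (((r : ℕ∞) : WithBot ℕ∞)) * ((⊤ : ℕ∞) : WithBot ℕ∞) = _
        rw [← WithBot.coe_mul, ENat.mul_top]
        exact_mod_cast (by lia : r ≠ 0)
      rw [h1] at hl
      have h2 : (((⊤ : ℕ∞) + ((4 * (r - 1) + 1 : ℕ) : ℕ∞) : ℕ∞) : WithBot ℕ∞) ≤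
        ((l : ℕ∞) : WithBot ℕ∞) := hl
      rw [WithBot.coe_le_coe, top_add, top_le_iff] at h2
      exact ENat.natCast_ne_top _ h2
    | coe p =>
      have h1 : ((r * p + (4 * (r - 1) + 1) : ℕ) : WithBot ℕ∞) ≤ l := by
        refine le_trans (le_of_eq ?_) hl
        push_cast
        rfl
      rw [Nat.cast_le] at h1
      have hp : HasProjectiveDimensionLE (ModuleCat.of S M) p := by
        rw [← projectiveDimension_le_iff, hd]
        rfl
      exact s.complexMinors_sh_eq_add_two hc r hr p hG.free hG.zero_of_neg
        (hG.subsingleton_of_hasProjectiveDimensionLE p hp) l (by lia)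

theorem complexMinors_sh_of_ringKrullDim [IsRegularLocalRing S] {M : Type u} [AddCommGroup M]
    [Module S M] {ε : G.X 0 →ₗ[S] M} (hG : IsMinimalFreeResolution G ε) (s : HigherHomotopies f G)
    (hc : 1 < c) (r : ℕ) (hr : 1 ≤ r) (l : ℕ)
    (hl : (r : WithBot ℕ∞) * ringKrullDim S +
      ((4 * (r - 1) + 1 : ℕ) : WithBot ℕ∞) ≤ (l : WithBot ℕ∞)) :
    complexMinors s.Sh r l = complexMinors s.Sh r (l + 2) := by
  obtain ⟨n, x, hn, -, -⟩ := IsRegularLocalRing.exists_regular_generators S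
  rw [hn] at hl
  have h1 : ((r * n + (4 * (r - 1) + 1) : ℕ) : WithBot ℕ∞) ≤ l := by
    refine le_trans (le_of_eq ?_) hl
    push_cast
    rfl
  rw [Nat.cast_le] at h1
  exact s.complexMinors_sh_eq_add_two hc r hr n hG.free hG.zero_of_neg
    (hG.subsingleton_of_ringKrullDim_lt hn) l (by lia)

end HigherHomotopies

end

/-! ### Tate models and divided power variables -/

noncomputable section

theorem Finsupp.mem_ideal_smul_top_iff {S ι : Type*} [CommRing S] (I : Ideal S) (u : ι →₀ S) :
    u ∈ I • (⊤ : Submodule S (ι →₀ S)) ↔ ∀ i, u i ∈ I := by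
  rw [(Finsupp.basisSingleOne (R := S) (ι := ι)).mem_ideal_smul_top_iff]
  rfl

theorem exists_sub_smul_mem_of_mem_sup {S M : Type*} [CommRing S] [AddCommGroup M] [Module S M]
    {I : Ideal S} {x : S} {z : M} (hz : z ∈ (I ⊔ Ideal.span {x}) • (⊤ : Submodule S M)) :
    ∃ w, z - x • w ∈ I • (⊤ : Submodule S M) := by
  rw [Submodule.sup_smul, Submodule.ideal_span_singleton_smul, sup_comm] at hz
  obtain ⟨y, hy, y', hy', rfl⟩ := Submodule.mem_sup.mp hz
  obtain ⟨w, -, rfl⟩ := Submodule.mem_smul_pointwise_iff_exists _ _ _ |>.mp hy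
  exact ⟨w, by rwa [add_sub_cancel_left]⟩

/-- A free graded module `⊕ S` with a finite homogeneous basis in each degree, carrying maps which,
modulo the ideal `I`, form a resolution of a cyclic module with distinguished generator `o`,
together with strictly anticommuting homotopies `σ_q` for `f_q`, `q ≥ k`. All maps have entries in
the ideal `𝔪`. -/
structure TateModel {S : Type u} [CommRing S] (𝔪 I : Ideal S) (f : ℕ → S) (k : ℕ) where
  ι : Type
  deg : ι → ℕ
  finite_deg (n : ℕ) : {j | deg j = n}.Finite
  o : ι
  deg_eq_zero_iff (j : ι) : deg j = 0 ↔ j = o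
  d : (ι →₀ S) →ₗ[S] (ι →₀ S)
  σ (q : ℕ) : (ι →₀ S) →ₗ[S] (ι →₀ S)
  d_deg (j i : ι) : d (Finsupp.single j 1) i ≠ 0 → deg j = deg i + 1
  σ_deg (q : ℕ) (j i : ι) : σ q (Finsupp.single j 1) i ≠ 0 → deg i = deg j + 1
  d_mem (j i : ι) : d (Finsupp.single j 1) i ∈ 𝔪
  σ_mem (q : ℕ) (j i : ι) : σ q (Finsupp.single j 1) i ∈ 𝔪
  d_d (u : ι →₀ S) : d (d u) ∈ I • (⊤ : Submodule S (ι →₀ S))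
  homotopy (q : ℕ) (hq : k ≤ q) (u : ι →₀ S) :
    d (σ q u) + σ q (d u) - f q • u ∈ I • (⊤ : Submodule S (ι →₀ S))
  σ_σ (q q' : ℕ) (u : ι →₀ S) : σ q (σ q' u) + σ q' (σ q u) = 0
  σ_σ_self (q : ℕ) (u : ι →₀ S) : σ q (σ q u) = 0
  exact (u : ι →₀ S) : d u ∈ I • (⊤ : Submodule S (ι →₀ S)) →
    ∃ (v : ι →₀ S) (γ : S), u - d v - γ • Finsupp.single o (1 : S) ∈ I • (⊤ : Submodule S (ι →₀ S))

namespace TateModel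

variable {S : Type u} [CommRing S] {𝔪 I : Ideal S} {f : ℕ → S} {k : ℕ}

theorem d_o (T : TateModel 𝔪 I f k) (γ : S) : T.d (γ • Finsupp.single T.o 1) = 0 := by
  rw [map_smul]
  convert smul_zero γ
  ext i
  by_contra h
  have h1 := T.d_deg _ _ h
  rw [(T.deg_eq_zero_iff _).mpr rfl] at h1
  lia

/-- The nonzero entries of the differential in degree `l`. -/
def entries (T : TateModel 𝔪 I f k) (l : ℕ) : Set S :=
  {z | ∃ j i, T.deg j = l ∧ z = T.d (Finsupp.single j 1) i}

/-- The minors of the differential in degree `l`. -/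
def minors (T : TateModel 𝔪 I f k) (r l : ℕ) : Set S :=
  {z | ∃ (j i : Fin r → T.ι), (∀ a, T.deg (j a) = l) ∧
    z = Matrix.det (Matrix.of fun a b => T.d (Finsupp.single (j b) 1) (i a))}

section DividedVariable

variable (T : TateModel 𝔪 I f k)

/-- The coefficient of `y^(b)`. -/
def comp {ι : Type} (b : ℕ) : (ℕ × ι →₀ S) →ₗ[S] (ι →₀ S) :=
  Finsupp.lcomapDomain (Prod.mk b) (Prod.mk_right_injective b)

/-- Multiplication by `y^(b)`. -/
def emb {ι : Type} (b : ℕ) : (ι →₀ S) →ₗ[S] (ℕ × ι →₀ S) := Finsupp.lmapDomain S S (Prod.mk b)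

theorem comp_apply {ι : Type} (b : ℕ) (u : ℕ × ι →₀ S) (i : ι) : comp b u i = u (b, i) := rfl

theorem comp_single_same {ι : Type} (b : ℕ) (i : ι) :
    comp b (Finsupp.single (b, i) (1 : S)) = Finsupp.single i 1 := by
  classical
  ext i'
  rw [comp_apply, Finsupp.single_apply, Finsupp.single_apply]
  simp

theorem comp_single_of_ne {ι : Type} {b b' : ℕ} (h : b' ≠ b) (i : ι) :
    comp b (Finsupp.single (b', i) (1 : S)) = 0 := by
  classical
  ext i'
  rw [comp_apply, Finsupp.single_apply]
  simp [h]

theorem emb_single {ι : Type} (b : ℕ) (i : ι) (s : S) :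
    emb b (Finsupp.single i s) = Finsupp.single (b, i) s :=
  Finsupp.mapDomain_single

theorem comp_emb_same {ι : Type} (b : ℕ) (v : ι →₀ S) : comp b (emb b v) = v := by
  ext i
  exact Finsupp.mapDomain_apply (Prod.mk_right_injective b) v i

theorem comp_emb_of_ne {ι : Type} {b b' : ℕ} (h : b' ≠ b) (v : ι →₀ S) :
    comp b (emb b' v) = 0 := by
  ext i
  rw [comp_apply]
  refine Finsupp.mapDomain_of_notMem_range v _ ?_
  rintro ⟨j, hj⟩
  exact h (congrArg Prod.fst hj)

theorem ext_comp {ι : Type} {u v : ℕ × ι →₀ S} (h : ∀ b, comp b u = comp b v) : u = v := by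
  ext ⟨b, i⟩
  exact DFunLike.congr_fun (h b) i

theorem mem_iff_comp {ι : Type} (J : Ideal S) (u : ℕ × ι →₀ S) :
    u ∈ J • (⊤ : Submodule S (ℕ × ι →₀ S)) ↔
      ∀ b, comp b u ∈ J • (⊤ : Submodule S (ι →₀ S)) := by
  simp only [Finsupp.mem_ideal_smul_top_iff, comp_apply, Prod.forall]

/-- The differential `d + t σ_k` after adjoining a divided power variable. -/
def divD : (ℕ × T.ι →₀ S) →ₗ[S] (ℕ × T.ι →₀ S) :=
  Finsupp.linearCombination S fun p => emb p.1 (T.d (Finsupp.single p.2 1)) +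
    if p.1 = 0 then 0 else emb (p.1 - 1) (T.σ k (Finsupp.single p.2 1))

/-- The homotopies after adjoining a divided power variable. -/
def divσ (q : ℕ) : (ℕ × T.ι →₀ S) →ₗ[S] (ℕ × T.ι →₀ S) :=
  Finsupp.linearCombination S fun p => emb p.1 (T.σ q (Finsupp.single p.2 1))

theorem divD_single (b : ℕ) (i : T.ι) : T.divD (Finsupp.single (b, i) 1) =
    emb b (T.d (Finsupp.single i 1)) +
      if b = 0 then 0 else emb (b - 1) (T.σ k (Finsupp.single i 1)) := by
  rw [divD, Finsupp.linearCombination_single, one_smul]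

theorem divσ_single (q b : ℕ) (i : T.ι) : T.divσ q (Finsupp.single (b, i) 1) =
    emb b (T.σ q (Finsupp.single i 1)) := by
  rw [divσ, Finsupp.linearCombination_single, one_smul]

theorem divD_single_apply_same (b : ℕ) (j i : T.ι) :
    T.divD (Finsupp.single (b, j) 1) (b, i) = T.d (Finsupp.single j 1) i := by
  rw [divD_single, Finsupp.add_apply, ← comp_apply, comp_emb_same]
  convert add_zero _
  split_ifs with h
  · rfl
  · rw [← comp_apply, comp_emb_of_ne (by lia)]
    rfl

theorem divD_single_apply_of_lt {b b' : ℕ} (h : b < b') (j i : T.ι) :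
    T.divD (Finsupp.single (b, j) 1) (b', i) = 0 := by
  rw [divD_single, Finsupp.add_apply, ← comp_apply, comp_emb_of_ne (by lia), Finsupp.zero_apply,
    zero_add]
  split_ifs with h
  · rfl
  · rw [← comp_apply, comp_emb_of_ne (by lia)]
    rfl

theorem comp_divD (b : ℕ) (u : ℕ × T.ι →₀ S) :
    comp b (T.divD u) = T.d (comp b u) + T.σ k (comp (b + 1) u) := by
  have h : comp b ∘ₗ T.divD = T.d ∘ₗ comp b + T.σ k ∘ₗ comp (b + 1) := by
    refine Finsupp.lhom_ext' fun ⟨b', i⟩ => LinearMap.ext_ring ?_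
    simp only [LinearMap.comp_apply, LinearMap.add_apply, Finsupp.lsingle_apply]
    rw [divD_single, map_add]
    by_cases h1 : b' = b
    · subst h1
      rw [comp_emb_same, comp_single_same, comp_single_of_ne (by lia), map_zero]
      split_ifs
      · rw [map_zero]
      · rw [comp_emb_of_ne (by lia)]
    · rw [comp_emb_of_ne h1, comp_single_of_ne h1, map_zero, zero_add, zero_add]
      by_cases h2 : b' = b + 1
      · subst h2
        rw [if_neg (by lia), comp_single_same]
        exact comp_emb_same _ _
      · rw [comp_single_of_ne h2, map_zero]
        split_ifs
        · rw [map_zero]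
        · rw [comp_emb_of_ne (by lia)]
  exact LinearMap.congr_fun h u

theorem comp_divσ (q b : ℕ) (u : ℕ × T.ι →₀ S) : comp b (T.divσ q u) = T.σ q (comp b u) := by
  have h : comp b ∘ₗ T.divσ q = T.σ q ∘ₗ comp b := by
    refine Finsupp.lhom_ext' fun ⟨b', i⟩ => LinearMap.ext_ring ?_
    simp only [LinearMap.comp_apply, Finsupp.lsingle_apply]
    rw [divσ_single]
    by_cases h1 : b' = b
    · subst h1
      rw [comp_emb_same, comp_single_same]
    · rw [comp_emb_of_ne h1, comp_single_of_ne h1, map_zero]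
  exact LinearMap.congr_fun h u

theorem divD_emb_zero (v : T.ι →₀ S) : T.divD (emb 0 v) = emb 0 (T.d v) := by
  refine ext_comp fun b => ?_
  rw [comp_divD, comp_emb_of_ne (b := b + 1) (by lia), map_zero, add_zero]
  by_cases h : 0 = b
  · subst h
    rw [comp_emb_same, comp_emb_same]
  · rw [comp_emb_of_ne h, comp_emb_of_ne h, map_zero]

/-- With $t$ the contraction, $(d+t\sigma_k)^2=d^2+t(d\sigma_k+\sigma_kd)+t^2\sigma_k^2\equiv f_kt$
modulo $I$. That $\sigma_k^2=0$ strictly is why no higher homotopies are needed. -/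
theorem divD_divD_mem (u : ℕ × T.ι →₀ S) :
    T.divD (T.divD u) ∈ (I ⊔ Ideal.span {f k}) • (⊤ : Submodule S (ℕ × T.ι →₀ S)) := by
  have hI : I • (⊤ : Submodule S (T.ι →₀ S)) ≤ (I ⊔ Ideal.span {f k}) • ⊤ :=
    Submodule.smul_mono_left le_sup_left
  rw [mem_iff_comp]
  intro b
  rw [comp_divD, comp_divD, comp_divD, map_add, map_add, T.σ_σ_self, add_zero]
  have h1 := hI (T.d_d (comp b u))
  have h2 := hI (T.homotopy k le_rfl (comp (b + 1) u))
  have h3 : f k • comp (b + 1) u ∈ (I ⊔ Ideal.span {f k}) • (⊤ : Submodule S (T.ι →₀ S)) :=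
    Submodule.smul_mem_smul (Ideal.mem_sup_right (Ideal.mem_span_singleton_self _)) trivial
  have h4 := Submodule.add_mem _ h1 (Submodule.add_mem _ h2 h3)
  convert h4 using 1
  abel

/-- Reduction modulo $f_k$ creates a second homology class, represented by $\sigma_k(o)$, and the
new variable kills it. The proof is an induction on the highest power of $y$ on which the cycle is
not yet zero modulo $J$: its top coefficient is first reduced to a multiple of $o$, then removed. -/
theorem divD_exact (hf : ∀ a, f k * a ∈ I → a ∈ I) (B : ℕ) : ∀ u : ℕ × T.ι →₀ S,
    (∀ b, B ≤ b → comp b u ∈ (I ⊔ Ideal.span {f k}) • (⊤ : Submodule S (T.ι →₀ S))) →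
    T.divD u ∈ (I ⊔ Ideal.span {f k}) • (⊤ : Submodule S (ℕ × T.ι →₀ S)) →
    ∃ (v : ℕ × T.ι →₀ S) (γ : S), u - T.divD v - γ • Finsupp.single (0, T.o) (1 : S) ∈
      (I ⊔ Ideal.span {f k}) • (⊤ : Submodule S (ℕ × T.ι →₀ S)) := by
  set J := I ⊔ Ideal.span {f k} with hJ
  have hI : I • (⊤ : Submodule S (T.ι →₀ S)) ≤ J • ⊤ := Submodule.smul_mono_left le_sup_left
  have hfJ : ∀ w : T.ι →₀ S, f k • w ∈ J • (⊤ : Submodule S (T.ι →₀ S)) := fun w =>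
    Submodule.smul_mem_smul (Ideal.mem_sup_right (Ideal.mem_span_singleton_self _)) trivial
  induction B with
  | zero =>
    intro u hu _
    refine ⟨0, 0, ?_⟩
    rw [map_zero, zero_smul, sub_zero, sub_zero, mem_iff_comp]
    exact fun b => hu b (Nat.zero_le b)
  | succ B ih =>
    intro u hu hdu
    have hdu' := (mem_iff_comp J _).mp hdu
    have h1 : T.d (comp B u) ∈ J • (⊤ : Submodule S (T.ι →₀ S)) := by
      have h2 := hdu' B
      rw [comp_divD] at h2
      have h3 := map_mem_ideal_smul_top (T.σ k) (hu (B + 1) le_rfl)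
      have h4 := Submodule.sub_mem _ h2 h3
      rwa [add_sub_cancel_right] at h4
    -- The top coefficient is a cycle modulo $J$, so its boundary is $f_kw$ modulo $I$. As $f_k$ is
    -- a nonzerodivisor modulo $I$, `w` is a cycle modulo $I$.
    obtain ⟨w, hw⟩ := exists_sub_smul_mem_of_mem_sup h1
    have h2 : T.d w ∈ I • (⊤ : Submodule S (T.ι →₀ S)) := by
      refine mem_ideal_smul_top_of_smul_mem hf ?_
      have h3 := Submodule.sub_mem _ (T.d_d (comp B u)) (map_mem_ideal_smul_top T.d hw)
      rw [map_sub, map_smul, sub_sub_cancel] at h3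
      exact h3
    obtain ⟨s, β, hs⟩ := T.exact w h2
    set bo : T.ι →₀ S := β • Finsupp.single T.o 1 with hbo
    have hdbo : T.d bo = 0 := T.d_o β
    -- Because $d\sigma_k(\beta o)\equiv f_k\beta o$, subtracting $f_ks+\sigma_k(\beta o)$ makes the
    -- top coefficient a cycle modulo $I$. The term $f_ks$ is zero modulo $J$; the other one comes
    -- from $y^{(B+1)}\beta o$.
    have h3 : T.d (comp B u - f k • s - T.σ k bo) ∈ I • (⊤ : Submodule S (T.ι →₀ S)) := by
      have h4 := T.homotopy k le_rfl bo
      rw [hdbo, map_zero, add_zero] at h4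
      have h5 := Submodule.sub_mem _ (Submodule.add_mem _ hw (Submodule.smul_mem _ (f k) hs)) h4
      rw [map_sub, map_sub, map_smul]
      convert h5 using 1
      simp only [smul_sub]
      abel
    obtain ⟨v, γ, hv⟩ := T.exact _ h3
    set go : T.ι →₀ S := γ • Finsupp.single T.o 1 with hgo
    have hdgo : T.d go = 0 := T.d_o γ
    obtain ⟨u', hu'⟩ : ∃ u', u' = u - T.divD (emb (B + 1) bo + emb B v) := ⟨_, rfl⟩
    have hcB : comp B u' - go ∈ J • (⊤ : Submodule S (T.ι →₀ S)) := by
      rw [hu', map_sub, comp_divD, map_add (comp B), map_add (comp (B + 1)), comp_emb_same, comp_emb_same,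
        comp_emb_of_ne (by lia), comp_emb_of_ne (by lia)]
      have h4 := Submodule.add_mem _ (hI hv) (hfJ s)
      convert h4 using 1
      rw [zero_add, add_zero]
      abel
    have hcb : ∀ b, B + 1 ≤ b → comp b u' ∈ J • (⊤ : Submodule S (T.ι →₀ S)) := by
      intro b hb
      rw [hu', map_sub, comp_divD, map_add (comp b), map_add (comp (b + 1)),
        comp_emb_of_ne (b := b) (b' := B) (by lia),
        comp_emb_of_ne (b := b + 1) (b' := B) (by lia),
        comp_emb_of_ne (b := b + 1) (b' := B + 1) (by lia), add_zero, add_zero, map_zero, add_zero]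
      by_cases h : B + 1 = b
      · subst h
        rw [comp_emb_same, hdbo, sub_zero]
        exact hu _ hb
      · rw [comp_emb_of_ne h, map_zero, sub_zero]
        exact hu _ hb
    have hdu'' : T.divD u' ∈ J • (⊤ : Submodule S (ℕ × T.ι →₀ S)) := by
      rw [hu', map_sub]
      exact Submodule.sub_mem _ hdu (T.divD_divD_mem _)
    -- In $y$-degree $0$ the remaining multiple of $o$ is the permitted answer. In higher $y$-degree
    -- the next lower coefficient shows that it is a boundary.
    cases B with
    | zero =>
      refine ⟨emb (0 + 1) bo + emb 0 v, γ, ?_⟩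
      rw [← hu', mem_iff_comp]
      intro b
      rw [map_sub, map_smul]
      rcases Nat.eq_zero_or_pos b with rfl | hb
      · rw [comp_single_same]
        exact hcB
      · rw [comp_single_of_ne (by lia), smul_zero, sub_zero]
        exact hcb b hb
    | succ B =>
      have h4 : T.d (comp B u') + T.σ k go ∈ J • (⊤ : Submodule S (T.ι →₀ S)) := by
        have h5 := (mem_iff_comp J _).mp hdu'' B
        rw [comp_divD] at h5
        have h6 := map_mem_ideal_smul_top (T.σ k) hcB
        rw [map_sub] at h6
        have h7 := Submodule.sub_mem _ h5 h6
        convert h7 using 1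
        abel
      obtain ⟨w', hw'⟩ := exists_sub_smul_mem_of_mem_sup h4
      -- Applying $d$ to $d(u'_B)+\sigma_k(\gamma o)\equiv f_kw'$ gives $f_k\gamma o\equiv f_k\,dw'$
      -- modulo $I$, and $f_k$ cancels.
      have h5 : go - T.d w' ∈ I • (⊤ : Submodule S (T.ι →₀ S)) := by
        refine mem_ideal_smul_top_of_smul_mem hf ?_
        have h6 := T.homotopy k le_rfl go
        rw [hdgo, map_zero, add_zero] at h6
        have h7 := map_mem_ideal_smul_top T.d hw'
        have h8 := Submodule.sub_mem _ (Submodule.sub_mem _ h7 h6) (T.d_d (comp B u'))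
        convert h8 using 1
        simp only [map_sub, map_add, map_smul, smul_sub]
        abel
      obtain ⟨v', γ', hv'⟩ := ih (u' - T.divD (emb (B + 1) w')) (by
        intro b hb
        rw [map_sub, comp_divD, comp_emb_of_ne (b := b + 1) (by lia), map_zero, add_zero]
        by_cases h : B + 1 = b
        · subst h
          rw [comp_emb_same]
          have h6 := Submodule.add_mem _ hcB (hI h5)
          convert h6 using 1
          abel
        · rw [comp_emb_of_ne h, map_zero, sub_zero]
          exact hcb b (by lia)) (by
        rw [map_sub]
        exact Submodule.sub_mem _ hdu'' (T.divD_divD_mem _))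
      refine ⟨emb (B + 1 + 1) bo + emb (B + 1) v + emb (B + 1) w' + v', γ', ?_⟩
      convert hv' using 2
      rw [hu']
      simp only [map_add]
      abel

theorem emb_apply_ne_zero {ι : Type} {b b' : ℕ} {v : ι →₀ S} {i : ι} (h : emb b v (b', i) ≠ 0) :
    b = b' ∧ v i ≠ 0 := by
  by_cases hb : b = b'
  · subst hb
    rw [← comp_apply, comp_emb_same] at h
    exact ⟨rfl, h⟩
  · rw [← comp_apply, comp_emb_of_ne hb] at h
    exact absurd rfl h

theorem emb_apply_mem {ι : Type} {J : Ideal S} {b : ℕ} {v : ι →₀ S} (h : ∀ i, v i ∈ J)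
    (p : ℕ × ι) : emb b v p ∈ J := by
  obtain ⟨b', i⟩ := p
  by_cases hb : b = b'
  · subst hb
    rw [← comp_apply, comp_emb_same]
    exact h i
  · rw [← comp_apply, comp_emb_of_ne hb]
    exact J.zero_mem

/-- Adjoining a divided power variable of degree two which kills `f_k`. -/
def adjoinDivided (hf : ∀ a, f k * a ∈ I → a ∈ I) :
    TateModel 𝔪 (I ⊔ Ideal.span {f k}) f (k + 1) where
  ι := ℕ × T.ι
  deg p := 2 * p.1 + T.deg p.2
  finite_deg n := by
    refine Set.Finite.subset ((Set.finite_Iic n).prod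
      ((Set.finite_Iic n).biUnion fun m _ => T.finite_deg m)) ?_
    rintro ⟨b, i⟩ h
    have h' : 2 * b + T.deg i = n := h
    refine ⟨?_, ?_⟩
    · simp only [Set.mem_Iic]
      lia
    · exact Set.mem_biUnion (x := T.deg i) (by simp only [Set.mem_Iic]; lia) rfl
  o := (0, T.o)
  deg_eq_zero_iff := by
    rintro ⟨b, i⟩
    rw [Prod.mk.injEq, ← T.deg_eq_zero_iff]
    simp only
    lia
  d := T.divD
  σ := T.divσ
  d_deg := by
    rintro ⟨b, j⟩ ⟨b', i⟩ h
    rw [divD_single, Finsupp.add_apply] at h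
    simp only
    by_cases h1 : emb b (T.d (Finsupp.single j 1)) (b', i) = 0
    · rw [h1, zero_add] at h
      split_ifs at h with h2
      · exact absurd rfl h
      · obtain ⟨h3, h4⟩ := emb_apply_ne_zero h
        have := T.σ_deg _ _ _ h4
        lia
    · obtain ⟨rfl, h4⟩ := emb_apply_ne_zero h1
      have := T.d_deg _ _ h4
      lia
  σ_deg := by
    rintro q ⟨b, j⟩ ⟨b', i⟩ h
    rw [divσ_single] at h
    obtain ⟨rfl, h4⟩ := emb_apply_ne_zero h
    have := T.σ_deg _ _ _ h4
    simp only
    lia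
  d_mem := by
    rintro ⟨b, j⟩ p
    rw [divD_single, Finsupp.add_apply]
    refine Ideal.add_mem _ (emb_apply_mem (T.d_mem j) p) ?_
    split_ifs
    · exact Ideal.zero_mem _
    · exact emb_apply_mem (T.σ_mem _ j) p
  σ_mem := by
    rintro q ⟨b, j⟩ p
    rw [divσ_single]
    exact emb_apply_mem (T.σ_mem _ j) p
  d_d := T.divD_divD_mem
  homotopy q hq u := by
    rw [mem_iff_comp]
    intro b
    rw [map_sub, map_add, map_smul, comp_divD, comp_divσ, comp_divσ, comp_divσ, comp_divD, map_add]
    have h1 := T.homotopy q (by lia) (comp b u)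
    have h2 := Submodule.smul_mono_left (le_sup_left (b := Ideal.span {f k})) h1
    convert h2 using 1
    -- The cross terms $t(\sigma_k\sigma_q+\sigma_q\sigma_k)$ cancel, so the old homotopies for the
    -- later $f_q$ survive unchanged.
    have h3 := T.σ_σ k q (comp (b + 1) u)
    rw [add_eq_zero_iff_eq_neg] at h3
    rw [h3]
    abel
  σ_σ q q' u := by
    refine ext_comp fun b => ?_
    rw [map_add, comp_divσ, comp_divσ, comp_divσ, comp_divσ, T.σ_σ, map_zero]
  σ_σ_self q u := by
    refine ext_comp fun b => ?_
    rw [comp_divσ, comp_divσ, T.σ_σ_self, map_zero]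
  exact u hu := by
    obtain ⟨B, hB⟩ : ∃ B, ∀ b, B ≤ b → comp b u = 0 := by
      classical
      refine ⟨u.support.sup Prod.fst + 1, fun b hb => ?_⟩
      ext i
      rw [comp_apply, Finsupp.zero_apply]
      by_contra h
      have h1 := Finset.le_sup (f := Prod.fst) (Finsupp.mem_support_iff.mpr h)
      simp only at h1
      lia
    exact T.divD_exact hf B u (fun b hb => by rw [hB b hb]; exact Submodule.zero_mem _) hu

variable (hf : ∀ a, f k * a ∈ I → a ∈ I)

theorem adjoinDivided_d_single_apply_same (b : ℕ) (j i : T.ι) :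
    (T.adjoinDivided hf).d (Finsupp.single (b, j) 1) (b, i) = T.d (Finsupp.single j 1) i :=
  T.divD_single_apply_same b j i

theorem adjoinDivided_d_single_apply_of_lt {b b' : ℕ} (h : b < b') (j i : T.ι) :
    (T.adjoinDivided hf).d (Finsupp.single (b, j) 1) (b', i) = 0 :=
  T.divD_single_apply_of_lt h j i

/-- Multiplication by $y^{(b)}$ repeats every entry $2b$ degrees higher. -/
theorem entries_subset_adjoinDivided (l b : ℕ) :
    T.entries l ⊆ (T.adjoinDivided hf).entries (l + 2 * b) := by
  rintro _ ⟨j, i, hj, rfl⟩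
  refine ⟨(b, j), (b, i), ?_, (T.adjoinDivided_d_single_apply_same hf b j i).symm⟩
  change 2 * b + T.deg j = _
  lia

theorem minors_subset_adjoinDivided (r l : ℕ) :
    T.minors r l ⊆ (T.adjoinDivided hf).minors r l := by
  rintro _ ⟨j, i, hj, rfl⟩
  refine ⟨fun a => (0, j a), fun a => (0, i a), ?_, ?_⟩
  · intro a
    change 2 * 0 + T.deg (j a) = _
    rw [hj]
    lia
  · congr 1
    ext a b
    exact (T.adjoinDivided_d_single_apply_same hf 0 _ _).symm

/-- The new differential never raises the exponent of $y$; placing the $a$-th factor at $y^{(a)}$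
therefore yields a triangular matrix. -/
theorem prod_mem_minors_adjoinDivided (r l : ℕ) (z : Fin r → S)
    (hl : ∀ a : Fin r, 2 * (a : ℕ) ≤ l) (hz : ∀ a : Fin r, z a ∈ T.entries (l - 2 * a)) :
    ∏ a, z a ∈ (T.adjoinDivided hf).minors r l := by
  choose j i hj hji using hz
  refine ⟨fun a => ((a : ℕ), j a), fun a => ((a : ℕ), i a), ?_, ?_⟩
  · intro a
    change 2 * (a : ℕ) + T.deg (j a) = _
    rw [hj]
    have := hl a
    lia
  · rw [Matrix.det_of_isUpperTriangular]
    · refine Finset.prod_congr rfl fun a _ => ?_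
      rw [hji]
      exact (T.adjoinDivided_d_single_apply_same hf _ _ _).symm
    · intro a b hab
      exact T.adjoinDivided_d_single_apply_of_lt hf hab _ _

/-- The condition on `l` says that the source degree $l-2a$ of each of the `r` factors is still at
least $1$, even for $a=r-1$. -/
theorem pow_le_span_minors_adjoinDivided {𝔟 : Ideal S} (r l : ℕ) (hl : 2 * r ≤ l + 1)
    (h : ∀ l, 1 ≤ l → 𝔟 ≤ Ideal.span (T.entries l)) :
    𝔟 ^ r ≤ Ideal.span ((T.adjoinDivided hf).minors r l) := by
  calc 𝔟 ^ r = ∏ _a : Fin r, 𝔟 := by simp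
    _ ≤ ∏ a : Fin r, Ideal.span (T.entries (l - 2 * a)) :=
      Finset.prod_le_prod' fun a _ => h _ (by have := a.2; lia)
    _ ≤ _ := by
      rw [Ideal.prod_span]
      refine Ideal.span_mono fun z hz => ?_
      obtain ⟨g, hg, rfl⟩ := (Set.mem_finsetProd _ _ _).mp hz
      exact T.prod_mem_minors_adjoinDivided hf r l g (fun a => by have := a.2; lia)
        fun a => hg (Finset.mem_univ a)

theorem exists_d_adjoinDivided {β : S} (h : ∃ v, T.d v = β • Finsupp.single T.o 1) :
    ∃ v, (T.adjoinDivided hf).d v = β • Finsupp.single (T.adjoinDivided hf).o 1 := by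
  obtain ⟨v, hv⟩ := h
  have h : T.divD (emb 0 v) = β • Finsupp.single (0, T.o) (1 : S) := by
    rw [divD_emb_zero, hv, map_smul, emb_single]
  exact ⟨emb 0 v, h⟩

end DividedVariable

end TateModel

end

/-! ### Exterior variables and the Koszul resolution -/

noncomputable section

theorem span_image_Iio_zero {S : Type*} [CommRing S] (x : ℕ → S) :
    Ideal.span (x '' Set.Iio 0) = ⊥ := by
  have h : Set.Iio 0 = (∅ : Set ℕ) := by
    ext
    simp
  rw [h, Set.image_empty, Ideal.span_empty]

theorem span_image_Iio_succ {S : Type*} [CommRing S] (x : ℕ → S) (n : ℕ) :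
    Ideal.span (x '' Set.Iio (n + 1)) = Ideal.span (x '' Set.Iio n) ⊔ Ideal.span {x n} := by
  have h : Set.Iio (n + 1) = insert n (Set.Iio n) := by
    ext i
    simp only [Set.mem_Iio, Set.mem_insert_iff]
    lia
  rw [h, Set.image_insert_eq, Ideal.span_insert, sup_comm]

namespace TateModel

variable {S : Type u} [CommRing S] {𝔪 : Ideal S} {f : ℕ → S} {k : ℕ}

/-- The ring itself, as a model without variables. -/
def base (𝔪 : Ideal S) : TateModel 𝔪 ⊥ (fun _ => 0) k where
  ι := Unit
  deg _ := 0
  finite_deg _ := Set.toFinite _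
  o := ()
  deg_eq_zero_iff _ := by simp
  d := 0
  σ _ := 0
  d_deg _ _ h := absurd rfl h
  σ_deg _ _ _ h := absurd rfl h
  d_mem _ _ := Ideal.zero_mem _
  σ_mem _ _ _ := Ideal.zero_mem _
  d_d _ := Submodule.zero_mem _
  homotopy q _ u := by simp
  σ_σ _ _ _ := by simp
  σ_σ_self _ _ := rfl
  exact u _ := by
    refine ⟨0, u (), ?_⟩
    have : u = u () • Finsupp.single () (1 : S) := by
      ext
      simp
    rw [← this]
    simp

section ExteriorVariable

variable (T : TateModel 𝔪 ⊥ f k) (x : S) (α : ℕ → S)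

/-- The decomposition of `T ⊕ T ξ` into its two summands. -/
abbrev extEquiv (S : Type u) [CommRing S] (ι : Type) :
    (ι ⊕ ι →₀ S) ≃ₗ[S] (ι →₀ S) × (ι →₀ S) :=
  Finsupp.sumFinsuppLEquivProdFinsupp S

theorem extEquiv_single_inl {ι : Type} (j : ι) :
    extEquiv S ι (Finsupp.single (Sum.inl j) 1) = (Finsupp.single j 1, 0) := by
  classical
  refine Prod.ext ?_ ?_ <;> ext i
  · rw [Finsupp.fst_sumFinsuppLEquivProdFinsupp, Finsupp.single_apply, Finsupp.single_apply]
    simp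
  · rw [Finsupp.snd_sumFinsuppLEquivProdFinsupp, Finsupp.single_apply]
    simp

theorem extEquiv_single_inr {ι : Type} (j : ι) :
    extEquiv S ι (Finsupp.single (Sum.inr j) 1) = (0, Finsupp.single j 1) := by
  classical
  refine Prod.ext ?_ ?_ <;> ext i
  · rw [Finsupp.fst_sumFinsuppLEquivProdFinsupp, Finsupp.single_apply]
    simp
  · rw [Finsupp.snd_sumFinsuppLEquivProdFinsupp, Finsupp.single_apply, Finsupp.single_apply]
    simp

/-- The differential after adjoining an exterior variable `ξ` with `d ξ = x`. -/
def extD : (T.ι ⊕ T.ι →₀ S) →ₗ[S] (T.ι ⊕ T.ι →₀ S) :=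
  (extEquiv S T.ι).symm.toLinearMap ∘ₗ
    LinearMap.prod (T.d ∘ₗ LinearMap.fst S _ _ + x • LinearMap.snd S _ _)
      (-(T.d ∘ₗ LinearMap.snd S _ _)) ∘ₗ (extEquiv S T.ι).toLinearMap

/-- The homotopies after adjoining an exterior variable. -/
def extσ (q : ℕ) : (T.ι ⊕ T.ι →₀ S) →ₗ[S] (T.ι ⊕ T.ι →₀ S) :=
  (extEquiv S T.ι).symm.toLinearMap ∘ₗ
    LinearMap.prod (T.σ q ∘ₗ LinearMap.fst S _ _)
      (α q • LinearMap.fst S _ _ - T.σ q ∘ₗ LinearMap.snd S _ _) ∘ₗ (extEquiv S T.ι).toLinearMap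

theorem extEquiv_extD (u : T.ι ⊕ T.ι →₀ S) : extEquiv S T.ι (T.extD x u) =
    (T.d (extEquiv S T.ι u).1 + x • (extEquiv S T.ι u).2, -T.d (extEquiv S T.ι u).2) := by
  simp only [extD, LinearMap.comp_apply, LinearEquiv.coe_coe, LinearEquiv.apply_symm_apply]
  rfl

theorem extEquiv_extσ (q : ℕ) (u : T.ι ⊕ T.ι →₀ S) : extEquiv S T.ι (T.extσ α q u) =
    (T.σ q (extEquiv S T.ι u).1,
      α q • (extEquiv S T.ι u).1 - T.σ q (extEquiv S T.ι u).2) := by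
  simp only [extσ, LinearMap.comp_apply, LinearEquiv.coe_coe, LinearEquiv.apply_symm_apply]
  rfl

theorem extD_inl_inl (j i : T.ι) : T.extD x (Finsupp.single (Sum.inl j) 1) (Sum.inl i) =
    T.d (Finsupp.single j 1) i := by
  rw [← Finsupp.fst_sumFinsuppLEquivProdFinsupp S, extEquiv_extD, extEquiv_single_inl]
  simp

theorem extD_inl_inr (j i : T.ι) : T.extD x (Finsupp.single (Sum.inl j) 1) (Sum.inr i) = 0 := by
  rw [← Finsupp.snd_sumFinsuppLEquivProdFinsupp S, extEquiv_extD, extEquiv_single_inl]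
  simp

theorem extD_inr_inl (j i : T.ι) : T.extD x (Finsupp.single (Sum.inr j) 1) (Sum.inl i) =
    x * Finsupp.single j (1 : S) i := by
  rw [← Finsupp.fst_sumFinsuppLEquivProdFinsupp S, extEquiv_extD, extEquiv_single_inr]
  simp [-Finsupp.smul_single]

theorem extD_inr_inr (j i : T.ι) : T.extD x (Finsupp.single (Sum.inr j) 1) (Sum.inr i) =
    -T.d (Finsupp.single j 1) i := by
  rw [← Finsupp.snd_sumFinsuppLEquivProdFinsupp S, extEquiv_extD, extEquiv_single_inr]
  simp

theorem extσ_inl_inl (q : ℕ) (j i : T.ι) :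
    T.extσ α q (Finsupp.single (Sum.inl j) 1) (Sum.inl i) = T.σ q (Finsupp.single j 1) i := by
  rw [← Finsupp.fst_sumFinsuppLEquivProdFinsupp S, extEquiv_extσ, extEquiv_single_inl]

theorem extσ_inl_inr (q : ℕ) (j i : T.ι) :
    T.extσ α q (Finsupp.single (Sum.inl j) 1) (Sum.inr i) =
      α q * Finsupp.single j (1 : S) i := by
  rw [← Finsupp.snd_sumFinsuppLEquivProdFinsupp S, extEquiv_extσ, extEquiv_single_inl]
  simp [-Finsupp.smul_single]

theorem extσ_inr_inl (q : ℕ) (j i : T.ι) :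
    T.extσ α q (Finsupp.single (Sum.inr j) 1) (Sum.inl i) = 0 := by
  rw [← Finsupp.fst_sumFinsuppLEquivProdFinsupp S, extEquiv_extσ, extEquiv_single_inr]
  simp

theorem extσ_inr_inr (q : ℕ) (j i : T.ι) :
    T.extσ α q (Finsupp.single (Sum.inr j) 1) (Sum.inr i) = -T.σ q (Finsupp.single j 1) i := by
  rw [← Finsupp.snd_sumFinsuppLEquivProdFinsupp S, extEquiv_extσ, extEquiv_single_inr]
  simp

theorem d_d_eq_zero (u : T.ι →₀ S) : T.d (T.d u) = 0 := by
  simpa using T.d_d u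

theorem eq_of_mul_single_ne_zero {ι : Type} {j i : ι} {y : S}
    (h : y * Finsupp.single j (1 : S) i ≠ 0) : j = i := by
  by_contra hji
  rw [Finsupp.single_eq_of_ne (Ne.symm hji), mul_zero] at h
  exact h rfl

theorem exists_of_d_eq_zero {u : T.ι →₀ S} (hu : T.d u = 0) :
    ∃ (v : T.ι →₀ S) (γ : S), u = T.d v + γ • Finsupp.single T.o (1 : S) := by
  obtain ⟨v, γ, h⟩ := T.exact u (by rw [hu]; exact Submodule.zero_mem _)
  refine ⟨v, γ, ?_⟩
  rw [Submodule.bot_smul, Submodule.mem_bot, sub_sub, sub_eq_zero] at h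
  exact h

variable {x α} {𝔞 : Ideal S}

/-- By `h0` the degree zero homology is $S/\mathfrak a$, on which `x` is a nonzerodivisor. Writing
$b=ds+\beta o$, the relation makes $x\beta o$ a boundary, so $\beta\in\mathfrak a$ and $\beta o$ is
itself a boundary. -/
theorem exists_snd_eq_d (hx : ∀ β, x * β ∈ 𝔞 → β ∈ 𝔞)
    (h0 : ∀ β, (∃ v, T.d v = β • Finsupp.single T.o (1 : S)) ↔ β ∈ 𝔞) {a b : T.ι →₀ S} {γ : S}
    (hγ : γ ∈ 𝔞) (hb : T.d b = 0) (hab : T.d a + x • b = γ • Finsupp.single T.o (1 : S)) :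
    ∃ s, b = T.d s := by
  obtain ⟨s, β, rfl⟩ := T.exists_of_d_eq_zero hb
  obtain ⟨v, hv⟩ := (h0 γ).mpr hγ
  have h1 : x * β ∈ 𝔞 := by
    rw [← h0]
    refine ⟨v - a - x • s, ?_⟩
    rw [map_sub, map_sub, map_smul, hv, ← hab, mul_smul, smul_add]
    abel
  obtain ⟨s', hs'⟩ := (h0 β).mpr (hx β h1)
  exact ⟨s + s', by rw [map_add, hs']⟩

/-- Adjoining an exterior variable of degree one which kills `x`. -/
def adjoinExterior (hxm : x ∈ 𝔪) (hα : ∀ q, α q ∈ 𝔪) (hx : ∀ β, x * β ∈ 𝔞 → β ∈ 𝔞)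
    (h0 : ∀ β, (∃ v, T.d v = β • Finsupp.single T.o (1 : S)) ↔ β ∈ 𝔞) :
    TateModel 𝔪 ⊥ (fun q => f q + α q * x) k where
  ι := T.ι ⊕ T.ι
  deg := Sum.elim T.deg fun j => T.deg j + 1
  finite_deg n := by
    refine Set.Finite.subset (((T.finite_deg n).image Sum.inl).union
      ((T.finite_deg (n - 1)).image Sum.inr)) ?_
    rintro (j | j) h
    · exact Or.inl ⟨j, h, rfl⟩
    · have h' : T.deg j + 1 = n := h
      exact Or.inr ⟨j, by rw [Set.mem_ofPred_eq]; lia, rfl⟩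
  o := Sum.inl T.o
  deg_eq_zero_iff := by
    rintro (j | j)
    · simpa using T.deg_eq_zero_iff j
    · simp
  d := T.extD x
  σ := T.extσ α
  d_deg := by
    rintro (j | j) (i | i) h
    · rw [extD_inl_inl] at h
      exact T.d_deg _ _ h
    · rw [extD_inl_inr] at h
      exact absurd rfl h
    · rw [extD_inr_inl] at h
      rw [eq_of_mul_single_ne_zero h]
      rfl
    · rw [extD_inr_inr, neg_ne_zero] at h
      exact congrArg (· + 1) (T.d_deg _ _ h)
  σ_deg := by
    rintro q (j | j) (i | i) h
    · rw [extσ_inl_inl] at h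
      exact T.σ_deg _ _ _ h
    · rw [extσ_inl_inr] at h
      rw [eq_of_mul_single_ne_zero h]
      rfl
    · rw [extσ_inr_inl] at h
      exact absurd rfl h
    · rw [extσ_inr_inr, neg_ne_zero] at h
      exact congrArg (· + 1) (T.σ_deg _ _ _ h)
  d_mem := by
    rintro (j | j) (i | i)
    · rw [extD_inl_inl]
      exact T.d_mem _ _
    · rw [extD_inl_inr]
      exact Ideal.zero_mem _
    · rw [extD_inr_inl]
      exact Ideal.mul_mem_right _ _ hxm
    · rw [extD_inr_inr]
      exact neg_mem (T.d_mem _ _)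
  σ_mem := by
    rintro q (j | j) (i | i)
    · rw [extσ_inl_inl]
      exact T.σ_mem _ _ _
    · rw [extσ_inl_inr]
      exact Ideal.mul_mem_right _ _ (hα q)
    · rw [extσ_inr_inl]
      exact Ideal.zero_mem _
    · rw [extσ_inr_inr]
      exact neg_mem (T.σ_mem _ _ _)
  d_d u := by
    rw [Submodule.bot_smul, Submodule.mem_bot]
    apply (extEquiv S T.ι).injective
    rw [extEquiv_extD, extEquiv_extD, map_zero]
    simp [d_d_eq_zero]
  homotopy q hq u := by
    rw [Submodule.bot_smul, Submodule.mem_bot]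
    apply (extEquiv S T.ι).injective
    have h1 : ∀ a : T.ι →₀ S, T.d (T.σ q a) = f q • a - T.σ q (T.d a) := by
      intro a
      have h2 := T.homotopy q hq a
      rw [Submodule.bot_smul, Submodule.mem_bot, sub_eq_zero] at h2
      rw [← h2, add_sub_cancel_right]
    rw [map_sub, map_add, map_smul, extEquiv_extD, extEquiv_extσ, extEquiv_extσ, extEquiv_extD,
      map_zero]
    refine Prod.ext ?_ ?_
    · simp only [Prod.fst_sub, Prod.fst_add, Prod.smul_fst, h1, map_add, map_smul, smul_sub,
        add_smul, mul_smul, smul_comm x (α q), Prod.fst_zero]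
      abel
    · simp only [Prod.snd_sub, Prod.snd_add, Prod.smul_snd, h1, map_add, map_smul, smul_add,
        add_smul, mul_smul, map_sub, map_neg, Prod.snd_zero]
      abel
  σ_σ q q' u := by
    apply (extEquiv S T.ι).injective
    rw [map_add, extEquiv_extσ, extEquiv_extσ, extEquiv_extσ, extEquiv_extσ, map_zero]
    have h1 : ∀ a : T.ι →₀ S, T.σ q (T.σ q' a) = -T.σ q' (T.σ q a) := fun a =>
      eq_neg_of_add_eq_zero_left (T.σ_σ q q' a)
    refine Prod.ext ?_ ?_
    · simp only [Prod.fst_add, h1, neg_add_cancel, Prod.fst_zero]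
    · simp only [Prod.snd_add, map_sub, map_smul, h1, Prod.snd_zero]
      abel
  σ_σ_self q u := by
    apply (extEquiv S T.ι).injective
    rw [extEquiv_extσ, extEquiv_extσ, map_zero]
    refine Prod.ext ?_ ?_
    · simp only [T.σ_σ_self, Prod.fst_zero]
    · simp only [map_sub, map_smul, T.σ_σ_self, Prod.snd_zero]
      abel
  exact u hu := by
    rw [Submodule.bot_smul, Submodule.mem_bot] at hu
    have h1 := congrArg (extEquiv S T.ι) hu
    rw [extEquiv_extD, map_zero, Prod.mk_eq_zero, neg_eq_zero] at h1
    obtain ⟨s, hs⟩ := T.exists_snd_eq_d hx h0 (γ := 0) (Ideal.zero_mem _) h1.2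
      (by rw [h1.1, zero_smul])
    have h2 : T.d ((extEquiv S T.ι u).1 + x • s) = 0 := by
      rw [map_add, map_smul, ← hs, h1.1]
    obtain ⟨v, γ, hv⟩ := T.exists_of_d_eq_zero h2
    refine ⟨(extEquiv S T.ι).symm (v, -s), γ, ?_⟩
    rw [Submodule.bot_smul, Submodule.mem_bot]
    apply (extEquiv S T.ι).injective
    rw [map_sub, map_sub, map_smul, extEquiv_extD, extEquiv_single_inl, map_zero,
      LinearEquiv.apply_symm_apply]
    refine Prod.ext ?_ ?_
    · simp only [Prod.fst_sub, Prod.smul_fst, smul_neg, Prod.fst_zero]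
      rw [← sub_eq_zero] at hv
      rw [← hv]
      abel
    · simp only [Prod.snd_sub, Prod.smul_snd, smul_zero, map_neg, neg_neg, Prod.snd_zero, ← hs,
        sub_self]

variable (hxm : x ∈ 𝔪) (hα : ∀ q, α q ∈ 𝔪) (hx : ∀ β, x * β ∈ 𝔞 → β ∈ 𝔞)
    (h0 : ∀ β, (∃ v, T.d v = β • Finsupp.single T.o (1 : S)) ↔ β ∈ 𝔞)

theorem exists_d_adjoinExterior (β : S) :
    (∃ v, (T.adjoinExterior hxm hα hx h0).d v =
      β • Finsupp.single (T.adjoinExterior hxm hα hx h0).o (1 : S)) ↔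
      β ∈ 𝔞 ⊔ Ideal.span {x} := by
  change (∃ v, T.extD x v = β • Finsupp.single (Sum.inl T.o) (1 : S)) ↔ _
  have key : (∃ v, T.extD x v = β • Finsupp.single (Sum.inl T.o) (1 : S)) ↔
      ∃ a b : T.ι →₀ S, T.d a + x • b = β • Finsupp.single T.o (1 : S) ∧ T.d b = 0 := by
    constructor
    · rintro ⟨v, hv⟩
      have h1 := congrArg (extEquiv S T.ι) hv
      rw [extEquiv_extD, map_smul, extEquiv_single_inl, Prod.smul_mk, smul_zero, Prod.mk.injEq,
        neg_eq_zero] at h1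
      exact ⟨_, _, h1⟩
    · rintro ⟨a, b, h1, h2⟩
      refine ⟨(extEquiv S T.ι).symm (a, b), (extEquiv S T.ι).injective ?_⟩
      rw [extEquiv_extD, map_smul, extEquiv_single_inl, Prod.smul_mk, smul_zero,
        LinearEquiv.apply_symm_apply, h1, h2, neg_zero]
  rw [key]
  constructor
  · rintro ⟨a, b, h1, h2⟩
    obtain ⟨s, γ, rfl⟩ := T.exists_of_d_eq_zero h2
    have h3 : β - x * γ ∈ 𝔞 := by
      rw [← h0]
      refine ⟨a + x • s, ?_⟩
      rw [sub_smul, ← h1, map_add, map_smul, smul_add, mul_smul]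
      abel
    have h4 := Ideal.add_mem (𝔞 ⊔ Ideal.span {x}) (Ideal.mem_sup_left h3)
      (Ideal.mem_sup_right (Ideal.mul_mem_right γ _ (Ideal.mem_span_singleton_self x)))
    rwa [sub_add_cancel] at h4
  · intro h
    obtain ⟨β₁, h1, β₂, h2, rfl⟩ := Submodule.mem_sup.mp h
    obtain ⟨γ, rfl⟩ := Ideal.mem_span_singleton'.mp h2
    obtain ⟨a, ha⟩ := (h0 β₁).mpr h1
    refine ⟨a, γ • Finsupp.single T.o 1, ?_, T.d_o γ⟩
    rw [ha, add_smul, mul_comm, mul_smul]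

theorem entries_subset_adjoinExterior (l : ℕ) :
    T.entries l ⊆ (T.adjoinExterior hxm hα hx h0).entries l := by
  rintro _ ⟨j, i, hj, rfl⟩
  exact ⟨Sum.inl j, Sum.inl i, hj, (T.extD_inl_inl x j i).symm⟩

theorem neg_entries_subset_adjoinExterior (l : ℕ) {z : S} (hz : z ∈ T.entries l) :
    -z ∈ (T.adjoinExterior hxm hα hx h0).entries (l + 1) := by
  obtain ⟨j, i, hj, rfl⟩ := hz
  exact ⟨Sum.inr j, Sum.inr i, congrArg (· + 1) hj, (T.extD_inr_inr x j i).symm⟩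

/-- From $d(\xi u)=xu-\xi\,du$: `x` appears in each degree one above an existing generator. Degree
$2$ therefore needs an exterior variable adjoined earlier. -/
theorem mem_entries_adjoinExterior (j : T.ι) :
    x ∈ (T.adjoinExterior hxm hα hx h0).entries (T.deg j + 1) := by
  refine ⟨Sum.inr j, Sum.inl j, rfl, ?_⟩
  refine Eq.trans ?_ (T.extD_inr_inl x j j).symm
  rw [Finsupp.single_eq_same, mul_one]

end ExteriorVariable

/-- The Koszul resolution of the ideal generated by a regular sequence `x_0, …, x_{n-1}`, with
homotopies for linear combinations of the `x_i`. -/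
theorem exists_koszul (x : ℕ → S) (a : ℕ → ℕ → S) (n : ℕ) (hxm : ∀ i < n, x i ∈ 𝔪)
    (ha : ∀ q i, a q i ∈ 𝔪)
    (hx : ∀ j < n, ∀ b, x j * b ∈ Ideal.span (x '' Set.Iio j) → b ∈ Ideal.span (x '' Set.Iio j)) :
    ∃ T : TateModel 𝔪 ⊥ (fun q => ∑ i ∈ Finset.range n, a q i * x i) 0,
      (∀ β, (∃ v, T.d v = β • Finsupp.single T.o (1 : S)) ↔ β ∈ Ideal.span (x '' Set.Iio n)) ∧
      Ideal.span (x '' Set.Iio n) ≤ Ideal.span (T.entries 1) ∧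
      (1 ≤ n → ∃ j, T.deg j = 1) ∧
      (2 ≤ n → Ideal.span (x '' Set.Iio n) ≤ Ideal.span (T.entries 2)) := by
  induction n with
  | zero =>
    simp only [span_image_Iio_zero, Finset.range_zero, Finset.sum_empty]
    refine ⟨base 𝔪, fun β => ?_, bot_le, by lia, by lia⟩
    rw [Ideal.mem_bot]
    constructor
    · rintro ⟨v, hv⟩
      have h1 := DFunLike.congr_fun hv (base (k := 0) 𝔪).o
      rw [Finsupp.smul_apply, Finsupp.single_eq_same, smul_eq_mul, mul_one] at h1
      exact h1.symm
    · rintro rfl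
      exact ⟨0, by rw [map_zero, zero_smul]⟩
  | succ n ih =>
    obtain ⟨T, h0, h1, h2, h3⟩ := ih (fun i hi => hxm i (by lia)) fun j hj => hx j (by lia)
    have hs := span_image_Iio_succ x n
    have hfun : (fun q => ∑ i ∈ Finset.range (n + 1), a q i * x i) =
        fun q => (∑ i ∈ Finset.range n, a q i * x i) + a q n * x n :=
      funext fun q => Finset.sum_range_succ _ _
    rw [hfun]
    let T' := T.adjoinExterior (hxm n (by lia)) (fun q => ha q n) (hx n (by lia)) h0
    refine ⟨T', ?_, ?_, ?_, ?_⟩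
    · rw [hs]
      exact T.exists_d_adjoinExterior _ _ _ _
    · rw [hs, sup_le_iff, Ideal.span_singleton_le_iff_mem]
      constructor
      · exact h1.trans (Ideal.span_mono (T.entries_subset_adjoinExterior _ _ _ _ 1))
      · have h4 := T.mem_entries_adjoinExterior (hxm n (by lia)) (fun q => ha q n) (hx n (by lia))
          h0 T.o
        rw [(T.deg_eq_zero_iff _).mpr rfl] at h4
        exact Ideal.subset_span h4
    · intro _
      refine ⟨Sum.inr T.o, ?_⟩
      change T.deg T.o + 1 = 1
      rw [(T.deg_eq_zero_iff _).mpr rfl]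
    · intro hn
      rw [hs, sup_le_iff, Ideal.span_singleton_le_iff_mem]
      constructor
      -- The earlier generators reach degree $2$ through the copy of the degree $1$ entries, with
      -- opposite sign, on the summand of $\xi$.
      · refine h1.trans ?_
        rw [Ideal.span_le]
        intro z hz
        have h4 := T.neg_entries_subset_adjoinExterior (hxm n (by lia)) (fun q => ha q n)
          (hx n (by lia)) h0 1 hz
        exact neg_mem_iff.mp (Ideal.subset_span h4)
      · obtain ⟨j, hj⟩ := h2 (by lia)
        have h4 := T.mem_entries_adjoinExterior (hxm n (by lia)) (fun q => ha q n) (hx n (by lia))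
          h0 j
        rw [hj] at h4
        exact Ideal.subset_span h4

end TateModel

end

noncomputable section

/-! ### Uniqueness of minimal resolutions -/

section MinimalCovers

open IsLocalRing

variable {R : Type*} [CommRing R] [IsLocalRing R]

/-- Surjectivity is Nakayama; a surjective endomorphism of a finite module is injective. -/
theorem LinearMap.bijective_of_sub_mem_maximalIdeal_smul_top {P : Type*} [AddCommGroup P]
    [Module R P] [Module.Finite R P] (φ : P →ₗ[R] P)
    (h : ∀ x, x - φ x ∈ maximalIdeal R • (⊤ : Submodule R P)) : Function.Bijective φ := by
  have hs : Function.Surjective φ := by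
    rw [← LinearMap.range_eq_top, eq_top_iff]
    refine Submodule.le_of_le_smul_of_le_jacobson_bot Module.Finite.fg_top
      (maximalIdeal_le_jacobson _) fun x _ => ?_
    exact Submodule.mem_sup.mpr ⟨φ x, ⟨x, rfl⟩, _, h x, by abel⟩
  exact ⟨OrzechProperty.injective_of_surjective_endomorphism φ hs, hs⟩

/-- Two minimal covers of the same module by finite projective modules are isomorphic. -/
theorem exists_equiv_of_range_eq {P P' K : Type*} [AddCommGroup P] [Module R P]
    [Module.Finite R P] [Module.Projective R P] [AddCommGroup P'] [Module R P']
    [Module.Finite R P'] [Module.Projective R P'] [AddCommGroup K] [Module R K]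
    (e : P →ₗ[R] K) (e' : P' →ₗ[R] K) (h : LinearMap.range e = LinearMap.range e')
    (he : LinearMap.ker e ≤ maximalIdeal R • ⊤) (he' : LinearMap.ker e' ≤ maximalIdeal R • ⊤) :
    ∃ φ : P ≃ₗ[R] P', ∀ x, e' (φ x) = e x := by
  obtain ⟨φ, hφ⟩ := Module.projective_lifting_property e'.rangeRestrict
    (e.codRestrict _ fun x => h ▸ LinearMap.mem_range_self e x) e'.surjective_rangeRestrict
  obtain ⟨ψ, hψ⟩ := Module.projective_lifting_property e.rangeRestrict
    (e'.codRestrict _ fun x => h ▸ LinearMap.mem_range_self e' x) e.surjective_rangeRestrict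
  have h1 (x : P) : e' (φ x) = e x := congrArg Subtype.val (LinearMap.congr_fun hφ x)
  have h2 (x : P') : e (ψ x) = e' x := congrArg Subtype.val (LinearMap.congr_fun hψ x)
  -- The composite of the two lifts differs from the identity by elements of the kernel, which
  -- minimality places in $\mathfrak mP$.
  have h3 := LinearMap.bijective_of_sub_mem_maximalIdeal_smul_top (ψ ∘ₗ φ) fun x => he (by
    rw [LinearMap.mem_ker, map_sub, LinearMap.comp_apply, h2, h1, sub_self])
  have h4 := LinearMap.bijective_of_sub_mem_maximalIdeal_smul_top (φ ∘ₗ ψ) fun x => he' (by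
    rw [LinearMap.mem_ker, map_sub, LinearMap.comp_apply, h1, h2, sub_self])
  rw [LinearMap.coe_comp] at h3 h4
  exact ⟨LinearEquiv.ofBijective φ ⟨h3.1.of_comp, h4.2.of_comp⟩, h1⟩

/-- Two minimal resolutions of the same module by finite projective modules are isomorphic. -/
theorem exists_equiv_of_minimal {P P' : ℕ → Type*} {K : Type*}
    [∀ n, AddCommGroup (P n)] [∀ n, Module R (P n)] [∀ n, Module.Finite R (P n)]
    [∀ n, Module.Projective R (P n)]
    [∀ n, AddCommGroup (P' n)] [∀ n, Module R (P' n)] [∀ n, Module.Finite R (P' n)]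
    [∀ n, Module.Projective R (P' n)] [AddCommGroup K] [Module R K]
    (d : ∀ n, P (n + 1) →ₗ[R] P n) (d' : ∀ n, P' (n + 1) →ₗ[R] P' n)
    (ε : P 0 →ₗ[R] K) (ε' : P' 0 →ₗ[R] K)
    (hε : Function.Surjective ε) (hε' : Function.Surjective ε')
    (h0 : Function.Exact (d 0) ε) (h0' : Function.Exact (d' 0) ε')
    (h : ∀ n, Function.Exact (d (n + 1)) (d n)) (h' : ∀ n, Function.Exact (d' (n + 1)) (d' n))
    (hd : ∀ n, LinearMap.range (d n) ≤ maximalIdeal R • ⊤)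
    (hd' : ∀ n, LinearMap.range (d' n) ≤ maximalIdeal R • ⊤) (n : ℕ) :
    ∃ (a : P n ≃ₗ[R] P' n) (a' : P (n + 1) ≃ₗ[R] P' (n + 1)), ∀ x, a (d n x) = d' n (a' x) := by
  have step (n : ℕ) (a : P n ≃ₗ[R] P' n)
      (ha : ∀ y, y ∈ LinearMap.range (d n) ↔ a y ∈ LinearMap.range (d' n)) :
      ∃ (a : P n ≃ₗ[R] P' n) (a' : P (n + 1) ≃ₗ[R] P' (n + 1)),
        ∀ x, a (d n x) = d' n (a' x) := by
    obtain ⟨a', h1⟩ := exists_equiv_of_range_eq (a.toLinearMap ∘ₗ d n) (d' n) (by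
        ext y
        constructor
        · rintro ⟨x, rfl⟩
          exact (ha _).mp ⟨x, rfl⟩
        · intro hy
          obtain ⟨x, hx⟩ := (ha (a.symm y)).mpr (by rwa [a.apply_symm_apply])
          exact ⟨x, by rw [LinearMap.comp_apply, hx]; exact a.apply_symm_apply y⟩)
      (by rw [LinearEquiv.ker_comp, (h n).linearMap_ker_eq]; exact hd _)
      (by rw [(h' n).linearMap_ker_eq]; exact hd' _)
    exact ⟨a, a', fun x => (h1 x).symm⟩
  induction n with
  | zero =>
    obtain ⟨a, h1⟩ := exists_equiv_of_range_eq ε ε'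
      (by rw [LinearMap.range_eq_top.mpr hε, LinearMap.range_eq_top.mpr hε'])
      (by rw [h0.linearMap_ker_eq]; exact hd _) (by rw [h0'.linearMap_ker_eq]; exact hd' _)
    refine step 0 a fun y => ?_
    rw [← h0.linearMap_ker_eq, ← h0'.linearMap_ker_eq, LinearMap.mem_ker, LinearMap.mem_ker, h1]
  | succ n ih =>
    obtain ⟨a, a', h1⟩ := ih
    refine step (n + 1) a' fun y => ?_
    rw [← (h n).linearMap_ker_eq, ← (h' n).linearMap_ker_eq, LinearMap.mem_ker, LinearMap.mem_ker,
      ← h1, a.map_eq_zero_iff]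

end MinimalCovers

/-! ### The minimal resolution over the quotient defined by a model -/

namespace TateModel

variable {S : Type u} [CommRing S] {𝔪 I : Ideal S} {f : ℕ → S} {k : ℕ} (T : TateModel 𝔪 I f k)

/-- The term of degree `n` of the resolution over `S / I`. -/
abbrev X (n : ℕ) : Type u := {j // T.deg j = n} →₀ (S ⧸ I)

instance (n : ℕ) : Finite {j // T.deg j = n} := T.finite_deg n

/-- Reduction modulo `I`. -/
abbrev red {ι : Type} (I : Ideal S) : (ι →₀ S) →ₗ[S] (ι →₀ S ⧸ I) :=
  Finsupp.mapRange.linearMap (Algebra.linearMap S (S ⧸ I))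

theorem red_surjective {ι : Type} (u : ι →₀ S ⧸ I) : ∃ v, red I v = u :=
  Finsupp.mapRange_surjective _ (map_zero _) Ideal.Quotient.mk_surjective u

theorem red_eq_zero_iff {ι : Type} (u : ι →₀ S) :
    red I u = 0 ↔ u ∈ I • (⊤ : Submodule S (ι →₀ S)) := by
  rw [Finsupp.mem_ideal_smul_top_iff, DFunLike.ext_iff]
  exact forall_congr' fun i => Ideal.Quotient.eq_zero_iff_mem

/-- The differential modulo `I`. -/
def dR : (T.ι →₀ S ⧸ I) →ₗ[S ⧸ I] (T.ι →₀ S ⧸ I) :=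
  Finsupp.linearCombination (S ⧸ I) fun j => red I (T.d (Finsupp.single j 1))

theorem dR_single (j : T.ι) : T.dR (Finsupp.single j 1) = red I (T.d (Finsupp.single j 1)) := by
  rw [dR, Finsupp.linearCombination_single, one_smul]

theorem dR_single_apply (j i : T.ι) :
    T.dR (Finsupp.single j 1) i = Ideal.Quotient.mk I (T.d (Finsupp.single j 1) i) := by
  rw [dR_single]
  rfl

theorem dR_red (u : T.ι →₀ S) : T.dR (red I u) = red I (T.d u) := by
  have : T.dR.restrictScalars S ∘ₗ red I = red I ∘ₗ T.d := by
    refine Finsupp.lhom_ext' fun j => LinearMap.ext_ring ?_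
    have h : red I (Finsupp.single j (1 : S)) = Finsupp.single j 1 :=
      Finsupp.mapRange_single (hf := map_zero _)
    change T.dR (red I (Finsupp.single j 1)) = red I (T.d (Finsupp.single j 1))
    rw [h, dR_single]
  exact LinearMap.congr_fun this u

/-- The inclusion of the elements of degree `n`. -/
def inc (n : ℕ) : T.X n →ₗ[S ⧸ I] (T.ι →₀ S ⧸ I) := Finsupp.lmapDomain _ _ Subtype.val

/-- The projection to degree `n`. -/
def res (n : ℕ) : (T.ι →₀ S ⧸ I) →ₗ[S ⧸ I] T.X n :=
  Finsupp.lcomapDomain Subtype.val Subtype.val_injective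

theorem inc_single (n : ℕ) (j : {j // T.deg j = n}) (z : S ⧸ I) :
    T.inc n (Finsupp.single j z) = Finsupp.single j.1 z :=
  Finsupp.mapDomain_single

theorem res_apply (n : ℕ) (u : T.ι →₀ S ⧸ I) (j : {j // T.deg j = n}) :
    T.res n u j = u j.1 := rfl

theorem inc_apply (n : ℕ) (x : T.X n) (j : {j // T.deg j = n}) : T.inc n x j.1 = x j :=
  Finsupp.mapDomain_apply Subtype.val_injective x j

theorem inc_apply_of_ne (n : ℕ) (x : T.X n) (j : T.ι) (h : T.deg j ≠ n) : T.inc n x j = 0 :=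
  Finsupp.mapDomain_of_notMem_range x _ fun ⟨i, hi⟩ => h (hi ▸ i.2)

theorem res_inc (n : ℕ) (x : T.X n) : T.res n (T.inc n x) = x := by
  ext j
  rw [res_apply, inc_apply]

/-- The differential of the resolution over `S / I`. -/
def dX (n : ℕ) : T.X (n + 1) →ₗ[S ⧸ I] T.X n := T.res n ∘ₗ T.dR ∘ₗ T.inc (n + 1)

theorem dX_res (n : ℕ) (v : T.ι →₀ S ⧸ I) : T.dX n (T.res (n + 1) v) = T.res n (T.dR v) := by
  have : T.dX n ∘ₗ T.res (n + 1) = T.res n ∘ₗ T.dR := by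
    refine Finsupp.lhom_ext' fun j => LinearMap.ext_ring ?_
    change T.res n (T.dR (T.inc (n + 1) (T.res (n + 1) (Finsupp.single j 1)))) =
      T.res n (T.dR (Finsupp.single j 1))
    by_cases h : T.deg j = n + 1
    · have h1 : (Finsupp.single j 1 : T.ι →₀ S ⧸ I) = T.inc (n + 1) (Finsupp.single ⟨j, h⟩ 1) :=
        (T.inc_single (n + 1) ⟨j, h⟩ 1).symm
      rw [h1, res_inc]
    · have h1 : T.res (n + 1) (Finsupp.single j 1) = 0 := by
        ext i
        rw [res_apply, Finsupp.single_eq_of_ne (by rintro rfl; exact h i.2)]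
        rfl
      rw [h1, map_zero, map_zero, map_zero]
      ext i
      rw [res_apply, dR_single_apply, Finsupp.zero_apply]
      by_contra h2
      have h3 : T.d (Finsupp.single j 1) i.1 ≠ 0 := by
        intro h3
        rw [h3, map_zero] at h2
        exact h2 rfl
      have := T.d_deg _ _ h3
      rw [i.2] at this
      exact h this
  exact LinearMap.congr_fun this v

theorem inc_dX (n : ℕ) (x : T.X (n + 1)) : T.inc n (T.dX n x) = T.dR (T.inc (n + 1) x) := by
  have : T.inc n ∘ₗ T.dX n = T.dR ∘ₗ T.inc (n + 1) := by
    refine Finsupp.lhom_ext' fun j => LinearMap.ext_ring ?_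
    change T.inc n (T.res n (T.dR (T.inc (n + 1) (Finsupp.single j 1)))) =
      T.dR (T.inc (n + 1) (Finsupp.single j 1))
    rw [inc_single]
    ext i
    by_cases h : T.deg i = n
    · exact T.inc_apply n _ ⟨i, h⟩
    · rw [inc_apply_of_ne _ _ _ _ h, dR_single_apply]
      symm
      by_contra h2
      have h3 : T.d (Finsupp.single j.1 1) i ≠ 0 := by
        intro h3
        rw [h3, map_zero] at h2
        exact h2 rfl
      have := T.d_deg _ _ h3
      rw [j.2] at this
      lia
  exact LinearMap.congr_fun this x

theorem inc_injective (n : ℕ) : Function.Injective (T.inc n) :=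
  Function.LeftInverse.injective (T.res_inc n)

theorem exact_dX (n : ℕ) : Function.Exact (T.dX (n + 1)) (T.dX n) := by
  intro x
  constructor
  · intro hx
    obtain ⟨u, hu⟩ := red_surjective (T.inc (n + 1) x)
    have h1 : T.d u ∈ I • (⊤ : Submodule S (T.ι →₀ S)) := by
      rw [← red_eq_zero_iff, ← dR_red, hu, ← inc_dX, hx, map_zero]
    obtain ⟨v, γ, h2⟩ := T.exact u h1
    rw [← red_eq_zero_iff, map_sub, map_sub, sub_sub, sub_eq_zero, ← dR_red, hu] at h2
    refine ⟨T.res (n + 2) (red I v), ?_⟩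
    -- The ambiguity $\gamma o$ lives in degree $0$ and vanishes on projection to degree $n+1$.
    rw [dX_res, ← T.res_inc (n + 1) x, h2, map_add, left_eq_add]
    ext i
    rw [res_apply]
    change Ideal.Quotient.mk I (γ • Finsupp.single T.o (1 : S) i.1) = 0
    rw [Finsupp.single_eq_of_ne, smul_zero, map_zero]
    intro h
    have := (T.deg_eq_zero_iff i.1).mpr h
    rw [i.2] at this
    lia
  · rintro ⟨y, rfl⟩
    obtain ⟨u, hu⟩ := red_surjective (T.inc (n + 2) y)
    apply T.inc_injective
    rw [inc_dX, inc_dX, map_zero, ← hu, dR_red, dR_red, red_eq_zero_iff]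
    exact T.d_d u

/-- The augmentation to the quotient by an ideal. -/
def aug {J : Ideal (S ⧸ I)} : T.X 0 →ₗ[S ⧸ I] (S ⧸ I) ⧸ J :=
  J.mkQ ∘ₗ Finsupp.lapply ⟨T.o, (T.deg_eq_zero_iff _).mpr rfl⟩

theorem aug_surjective {J : Ideal (S ⧸ I)} : Function.Surjective (T.aug (J := J)) := by
  intro z
  obtain ⟨z, rfl⟩ := J.mkQ_surjective z
  exact ⟨Finsupp.single ⟨T.o, (T.deg_eq_zero_iff _).mpr rfl⟩ z,
    congrArg J.mkQ (Finsupp.single_eq_same)⟩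

theorem dX_apply_mem (n : ℕ) (x : T.X (n + 1)) (i : {j // T.deg j = n}) :
    T.dX n x i ∈ 𝔪.map (Ideal.Quotient.mk I) := by
  induction x using Finsupp.induction_linear with
  | zero => rw [map_zero]; exact Ideal.zero_mem _
  | add x y hx hy => rw [map_add]; exact Ideal.add_mem _ hx hy
  | single j z =>
    rw [← mul_one z, ← smul_eq_mul, ← Finsupp.smul_single, map_smul]
    refine Ideal.mul_mem_left _ _ ?_
    have : T.dX n (Finsupp.single j 1) i = Ideal.Quotient.mk I (T.d (Finsupp.single j.1 1) i.1) := by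
      rw [dX, LinearMap.comp_apply, LinearMap.comp_apply, inc_single, res_apply, dR_single_apply]
    rw [this]
    exact Ideal.mem_map_of_mem _ (T.d_mem _ _)

theorem range_dX_le (n : ℕ) :
    LinearMap.range (T.dX n) ≤ 𝔪.map (Ideal.Quotient.mk I) • (⊤ : Submodule (S ⧸ I) (T.X n)) := by
  rintro _ ⟨x, rfl⟩
  rw [Finsupp.mem_ideal_smul_top_iff]
  exact T.dX_apply_mem n x

theorem exact_aug (h : ∀ β ∈ 𝔪, ∃ v, T.d v = β • Finsupp.single T.o (1 : S)) :
    Function.Exact (T.dX 0) (T.aug (J := 𝔪.map (Ideal.Quotient.mk I))) := by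
  intro x
  have h0 : T.aug (J := 𝔪.map (Ideal.Quotient.mk I)) x = 0 ↔
      x ⟨T.o, (T.deg_eq_zero_iff _).mpr rfl⟩ ∈ 𝔪.map (Ideal.Quotient.mk I) :=
    Ideal.Quotient.eq_zero_iff_mem
  rw [h0]
  constructor
  · intro hx
    obtain ⟨β, hβ, h1⟩ := (Ideal.mem_map_iff_of_surjective _ Ideal.Quotient.mk_surjective).mp hx
    obtain ⟨v, hv⟩ := h β hβ
    refine ⟨T.res 1 (red I v), ?_⟩
    rw [dX_res, dR_red, hv]
    ext ⟨i, hi⟩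
    obtain rfl := (T.deg_eq_zero_iff i).mp hi
    rw [← h1, res_apply]
    change Ideal.Quotient.mk I (β • Finsupp.single T.o (1 : S) T.o) = _
    rw [Finsupp.single_eq_same, smul_eq_mul, mul_one]
  · rintro ⟨y, rfl⟩
    exact T.dX_apply_mem 0 y _

theorem mk_minors_mem (r n : ℕ) {z : S} (hz : z ∈ T.minors r (n + 1)) :
    Ideal.Quotient.mk I z ∈ minorsIdeal r (T.dX n) := by
  rw [minorsIdeal]
  split_ifs with h
  · trivial
  · obtain ⟨j, i, hj, rfl⟩ := hz
    refine Ideal.subset_span ⟨fun b => Finsupp.single ⟨j b, hj b⟩ 1,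
      fun a => Finsupp.lapply (i a) ∘ₗ T.inc n, ?_⟩
    rw [RingHom.map_det]
    congr 1
    ext a b
    change Ideal.Quotient.mk I (T.d (Finsupp.single (j b) 1) (i a)) = T.inc n (T.dX n _) (i a)
    rw [inc_dX, inc_single, dR_single_apply]

/-- If the minors of the model generate the expected power, so do those of the resolution. -/
theorem minorsIdeal_dX_eq (r n : ℕ) [Nontrivial (S ⧸ I)] (hn : ∃ j, T.deg j = n)
    (hn' : ∃ j, T.deg j = n + 1) (h : 𝔪 ^ r ≤ Ideal.span (T.minors r (n + 1))) :
    minorsIdeal r (T.dX n) = 𝔪.map (Ideal.Quotient.mk I) ^ r := by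
  apply le_antisymm
  · apply minorsIdeal_le_pow
    · obtain ⟨j, hj⟩ := hn
      obtain ⟨j', hj'⟩ := hn'
      have : Nonempty {j // T.deg j = n} := ⟨⟨j, hj⟩⟩
      have : Nonempty {j // T.deg j = n + 1} := ⟨⟨j', hj'⟩⟩
      rw [not_or, not_subsingleton_iff_nontrivial, not_subsingleton_iff_nontrivial]
      exact ⟨inferInstance, inferInstance⟩
    · exact fun x => T.range_dX_le n ⟨x, rfl⟩
  · rw [← Ideal.map_pow]
    refine (Ideal.map_mono h).trans ?_
    rw [Ideal.map_span, Ideal.span_le]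
    rintro _ ⟨z, hz, rfl⟩
    exact T.mk_minors_mem r n hz

end TateModel

/-- The minors of a minimal free resolution can be computed from a model. -/
theorem IsMinimalFreeResolution.minorsIdeal_eq_dX {S : Type u} [CommRing S] {𝔪 I : Ideal S}
    {f : ℕ → S} {k : ℕ} (T : TateModel 𝔪 I f k) [IsLocalRing (S ⧸ I)]
    (hI : 𝔪.map (Ideal.Quotient.mk I) = IsLocalRing.maximalIdeal (S ⧸ I))
    (hT : ∀ β ∈ 𝔪, ∃ v, T.d v = β • Finsupp.single T.o (1 : S))
    {F : ChainComplex (ModuleCat.{u} (S ⧸ I)) ℤ}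
    {ε : F.X 0 →ₗ[S ⧸ I] IsLocalRing.ResidueField (S ⧸ I)} (hF : IsMinimalFreeResolution F ε)
    (r n : ℕ) : complexMinors F r (n + 1) = minorsIdeal r (T.dX n) := by
  have (i : ℤ) : Module.Free (S ⧸ I) (F.X i) := hF.free i
  have (i : ℤ) : Module.Finite (S ⧸ I) (F.X i) := hF.finite i
  have hx (i j k : ℤ) (hi : 0 < j) (h1 : i = j + 1) (h2 : j = k + 1) :
      Function.Exact (F.d i j).hom (F.d j k).hom := by
    subst h1
    obtain rfl : k = j - 1 := by lia
    exact hF.exact j hi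
  have hm (i j : ℤ) (h : i = j + 1) : LinearMap.range (F.d i j).hom ≤
      IsLocalRing.maximalIdeal (S ⧸ I) • (⊤ : Submodule (S ⧸ I) (F.X j)) := by
    subst h
    exact hF.minimal j
  have hX : Function.Exact (T.dX 0) (T.aug (J := IsLocalRing.maximalIdeal (S ⧸ I))) := by
    rw [← hI]
    exact T.exact_aug hT
  obtain ⟨a, a', h⟩ := exists_equiv_of_minimal (P := fun n : ℕ => F.X (n : ℤ)) (P' := T.X)
    (fun n => (F.d ((n + 1 : ℕ) : ℤ) (n : ℤ)).hom) T.dX ε T.aug hF.surjective T.aug_surjective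
    hF.exact_zero hX (fun n => hx _ _ _ (by positivity) (by push_cast; ring) (by push_cast; ring))
    T.exact_dX (fun n => hm _ _ (by push_cast; ring)) (fun n => hI ▸ T.range_dX_le n) n
  have h1 : complexMinors F r (n + 1) = minorsIdeal r (F.d ((n + 1 : ℕ) : ℤ) (n : ℤ)).hom := by
    rw [complexMinors, add_sub_cancel_right]
    rfl
  rw [h1]
  exact minorsIdeal_congr r _ _ a' a h

end

/-! ### Tate's resolution of the residue field and part (B2) -/

noncomputable section

/-- Adjoining divided power variables to a resolution over `S` with entries in degrees `1` and `2`
generating `𝔪`. -/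
theorem TateModel.exists_of_bot {S : Type u} [CommRing S] {𝔪 : Ideal S} {f : ℕ → S}
    (T₀ : TateModel 𝔪 ⊥ f 0) (h0 : ∀ β ∈ 𝔪, ∃ v, T₀.d v = β • Finsupp.single T₀.o (1 : S))
    (h1 : 𝔪 ≤ Ideal.span (T₀.entries 1)) (h2 : 𝔪 ≤ Ideal.span (T₀.entries 2))
    (h3 : ∃ j, T₀.deg j = 1) (c : ℕ) (hc : 2 ≤ c)
    (hf : ∀ k < c, ∀ b, f k * b ∈ Ideal.span (f '' Set.Iio k) → b ∈ Ideal.span (f '' Set.Iio k))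
    (r : ℕ) :
    ∃ T : TateModel 𝔪 (Ideal.span (f '' Set.Iio c)) f c,
      (∀ β ∈ 𝔪, ∃ v, T.d v = β • Finsupp.single T.o (1 : S)) ∧ (∀ l, ∃ j, T.deg j = l) ∧
      ∀ l, 2 * r ≤ l + 1 → 𝔪 ^ r ≤ Ideal.span (T.minors r l) := by
  have hdeg {k : ℕ} {I : Ideal S} (T : TateModel 𝔪 I f k) (hT : ∀ b, f k * b ∈ I → b ∈ I)
      (h : ∀ l, ∃ j, T.deg j = l) (l : ℕ) : ∃ j, (T.adjoinDivided hT).deg j = l := by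
    obtain ⟨j, hj⟩ := h l
    refine ⟨(0, j), ?_⟩
    change 2 * 0 + T.deg j = l
    lia
  obtain ⟨T₁, a0, a1, a2⟩ : ∃ T : TateModel 𝔪 (Ideal.span (f '' Set.Iio 1)) f 1,
      (∀ β ∈ 𝔪, ∃ v, T.d v = β • Finsupp.single T.o (1 : S)) ∧ (∀ l, ∃ j, T.deg j = l) ∧
      ∀ l, 1 ≤ l → 𝔪 ≤ Ideal.span (T.entries l) := by
    rw [span_image_Iio_succ f 0, span_image_Iio_zero]
    have hT : ∀ b, f 0 * b ∈ (⊥ : Ideal S) → b ∈ (⊥ : Ideal S) := by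
      rw [← span_image_Iio_zero f]
      exact hf 0 (by lia)
    refine ⟨T₀.adjoinDivided hT, fun β hβ => T₀.exists_d_adjoinDivided hT (h0 β hβ), ?_, ?_⟩
    · intro l
      -- Generators in degrees $0$ and $1$ are enough, since the new variable has degree $2$.
      obtain ⟨j, hj⟩ : ∃ j, T₀.deg j = l % 2 := by
        rcases Nat.mod_two_eq_zero_or_one l with h | h
        · exact ⟨T₀.o, by rw [h, T₀.deg_eq_zero_iff]⟩
        · exact h ▸ h3
      refine ⟨(l / 2, j), ?_⟩
      change 2 * (l / 2) + T₀.deg j = l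
      lia
    · intro l hl
      obtain ⟨b, hb | hb⟩ : ∃ b, l = 1 + 2 * b ∨ l = 2 + 2 * b := ⟨(l - 1) / 2, by lia⟩
      · rw [hb]
        exact h1.trans (Ideal.span_mono (T₀.entries_subset_adjoinDivided hT 1 b))
      · rw [hb]
        exact h2.trans (Ideal.span_mono (T₀.entries_subset_adjoinDivided hT 2 b))
  -- The second divided variable produces the minors; each later one only has to preserve them.
  induction c, hc using Nat.le_induction with
  | base =>
    rw [span_image_Iio_succ f 1]
    have hT := hf 1 (by lia)
    exact ⟨T₁.adjoinDivided hT, fun β hβ => T₁.exists_d_adjoinDivided hT (a0 β hβ),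
      hdeg T₁ hT a1, fun l hl => T₁.pow_le_span_minors_adjoinDivided hT r l hl a2⟩
  | succ k hk ih =>
    obtain ⟨T, b0, b1, b2⟩ := ih fun i hi => hf i (by lia)
    rw [span_image_Iio_succ f k]
    have hT := hf k (by lia)
    exact ⟨T.adjoinDivided hT, fun β hβ => T.exists_d_adjoinDivided hT (b0 β hβ),
      hdeg T hT b1, fun l hl =>
        (b2 l hl).trans (Ideal.span_mono (T.minors_subset_adjoinDivided hT r l))⟩

/-- The Tate resolution of the residue field of a complete intersection. -/
theorem TateModel.exists_of_regular {S : Type u} [CommRing S] (x : ℕ → S)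
    (n : ℕ) (hn : 2 ≤ n)
    (hx : ∀ j < n, ∀ b, x j * b ∈ Ideal.span (x '' Set.Iio j) → b ∈ Ideal.span (x '' Set.Iio j))
    (f : ℕ → S) (hf2 : ∀ q, f q ∈ Ideal.span (x '' Set.Iio n) ^ 2) (c : ℕ) (hc : 2 ≤ c)
    (hf : ∀ k < c, ∀ b, f k * b ∈ Ideal.span (f '' Set.Iio k) → b ∈ Ideal.span (f '' Set.Iio k))
    (r : ℕ) :
    ∃ T : TateModel (Ideal.span (x '' Set.Iio n)) (Ideal.span (f '' Set.Iio c)) f c,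
      (∀ β ∈ Ideal.span (x '' Set.Iio n), ∃ v, T.d v = β • Finsupp.single T.o (1 : S)) ∧
      (∀ l, ∃ j, T.deg j = l) ∧
      ∀ l, 2 * r ≤ l + 1 → Ideal.span (x '' Set.Iio n) ^ r ≤ Ideal.span (T.minors r l) := by
  have hsum (q : ℕ) : ∃ a : ℕ → S, (∀ i, a i ∈ Ideal.span (x '' Set.Iio n)) ∧
      f q = ∑ i ∈ Finset.range n, a i * x i := by
    have h := hf2 q
    have hr : x '' Set.Iio n = Set.range fun i : Fin n => x i := by
      ext z
      constructor
      · rintro ⟨i, hi, rfl⟩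
        exact ⟨⟨i, hi⟩, rfl⟩
      · rintro ⟨i, rfl⟩
        exact ⟨i, i.2, rfl⟩
    rw [pow_two, ← smul_eq_mul] at h
    -- Only one factor of the square is expanded in the generators, so that the coefficients stay in
    -- $\mathfrak m$. They are the entries of the homotopies, and this keeps the final differential
    -- minimal.
    nth_rewrite 2 [hr] at h
    obtain ⟨a, ha, h1⟩ := (Submodule.mem_ideal_smul_span_iff_exists_sum _ _ _).mp h
    refine ⟨fun i => if h : i < n then a ⟨i, h⟩ else 0, fun i => ?_, ?_⟩
    · dsimp only
      split_ifs
      · exact ha _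
      · exact Ideal.zero_mem _
    · rw [← h1, Finsupp.sum_fintype _ _ (by simp), Finset.sum_range]
      exact Finset.sum_congr rfl fun i _ => by simp
  choose a ha hfa using hsum
  have hT := exists_koszul x a n (fun i hi => Ideal.subset_span (Set.mem_image_of_mem x hi)) ha hx
  rw [← funext hfa] at hT
  obtain ⟨T₀, h0, h1, h2, h3⟩ := hT
  exact T₀.exists_of_bot (fun β hβ => (h0 β).mpr hβ) h1 (h3 hn) (h2 (by lia)) c hc hf r

theorem RingTheory.Sequence.IsRegular.mem_span_image_Iio_of_mul_mem {S : Type*} [CommRing S]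
    {c : ℕ} {f : ℕ → S} (hf : RingTheory.Sequence.IsRegular S (List.ofFn fun i : Fin c => f i))
    (k : ℕ) (hk : k < c) (b : S) (hb : f k * b ∈ Ideal.span (f '' Set.Iio k)) :
    b ∈ Ideal.span (f '' Set.Iio k) := by
  have h := hf.toIsWeaklyRegular.regular_mod_prev k (by rwa [List.length_ofFn])
  rw [isSMulRegular_quotient_iff_mem_of_smul_mem] at h
  have h1 : Ideal.ofList ((List.ofFn fun i : Fin c => f i).take k) • (⊤ : Submodule S S) =
      Ideal.span (f '' Set.Iio k) := by
    rw [smul_eq_mul, Ideal.mul_top, Ideal.ofList]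
    congr 1
    ext z
    rw [Set.mem_ofPred_eq, List.mem_take_iff_getElem]
    constructor
    · rintro ⟨j, hj, rfl⟩
      exact ⟨j, by rw [Set.mem_Iio]; lia, by rw [List.getElem_ofFn]⟩
    · rintro ⟨j, hj, rfl⟩
      rw [Set.mem_Iio] at hj
      exact ⟨j, by rw [List.length_ofFn]; lia, by rw [List.getElem_ofFn]⟩
  rw [h1] at h
  refine h b ?_
  rwa [List.getElem_ofFn]

/-- A regular sequence of length two does not fit into a principal maximal ideal. -/
theorem two_le_of_regular {S : Type*} [CommRing S] [IsLocalRing S] (x f : ℕ → S) (n : ℕ)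
    (hx : Ideal.span (x '' Set.Iio n) = IsLocalRing.maximalIdeal S)
    (hfm : ∀ q, f q ∈ IsLocalRing.maximalIdeal S)
    (hf : ∀ k < 2, ∀ b, f k * b ∈ Ideal.span (f '' Set.Iio k) → b ∈ Ideal.span (f '' Set.Iio k)) :
    2 ≤ n := by
  have hone (f : ℕ → S) : Ideal.span (f '' Set.Iio 1) = Ideal.span {f 0} := by
    rw [span_image_Iio_succ, span_image_Iio_zero, bot_sup_eq]
  have hf0 := hf 0 (by lia)
  have hf1 := hf 1 (by lia)
  simp only [span_image_Iio_zero, hone, Ideal.mem_bot] at hf0 hf1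
  by_contra! hn
  obtain rfl | rfl : n = 0 ∨ n = 1 := by lia
  · rw [span_image_Iio_zero] at hx
    have h := hfm 0
    rw [← hx, Ideal.mem_bot] at h
    exact one_ne_zero (hf0 1 (by rw [h, zero_mul]))
  · rw [hone] at hx
    have h0 := hfm 0
    have h1 := hfm 1
    rw [← hx, Ideal.mem_span_singleton'] at h0 h1
    obtain ⟨s, hs⟩ := h0
    obtain ⟨t, ht⟩ := h1
    -- If $f_0=sx_0$ and $f_1=tx_0$, then $f_1s=tf_0$, whence $s=vf_0$ by regularity. Then
    -- $f_0(1-vx_0)=0$ makes $x_0$ a unit.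
    obtain ⟨v, hv⟩ := Ideal.mem_span_singleton'.mp
      (hf1 s (Ideal.mem_span_singleton'.mpr ⟨t, by rw [← hs, ← ht]; ring⟩))
    have h2 : 1 - v * x 0 = 0 := hf0 _ (by linear_combination (-x 0) * hv - hs)
    have hxm : v * x 0 ∈ IsLocalRing.maximalIdeal S :=
      Ideal.mul_mem_left _ _ (hx ▸ Ideal.mem_span_singleton_self _)
    rw [← sub_eq_zero.mp h2] at hxm
    exact hxm isUnit_one

/-- Minors of the minimal resolution of the residue field of a complete intersection. -/
theorem IsMinimalFreeResolution.complexMinors_residueField {S : Type u} [CommRing S]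
    [IsRegularLocalRing S] {c : ℕ} (hc : 2 ≤ c) (f : Fin c → S)
    (hf : RingTheory.Sequence.IsRegular S (List.ofFn f))
    (hf2 : ∀ i, f i ∈ IsLocalRing.maximalIdeal S ^ 2) [IsLocalRing (CIRing f)]
    {F : ChainComplex (ModuleCat.{u} (CIRing f)) ℤ}
    {ε : F.X 0 →ₗ[CIRing f] IsLocalRing.ResidueField (CIRing f)}
    (hF : IsMinimalFreeResolution F ε) (r l : ℕ) (hl : 2 * r ≤ l + 2) :
    complexMinors F r (l + 1) = IsLocalRing.maximalIdeal (CIRing f) ^ r := by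
  obtain ⟨n, x, -, hxm, hx⟩ := IsRegularLocalRing.exists_regular_generators S
  -- Models take sequences indexed by all naturals; extending by zero keeps every term in $\mathfrak
  -- m^2$.
  obtain ⟨g, hg, hg2⟩ : ∃ g : ℕ → S, (f = fun i : Fin c => g i) ∧
      ∀ q, g q ∈ IsLocalRing.maximalIdeal S ^ 2 := by
    refine ⟨fun q => if h : q < c then f ⟨q, h⟩ else 0, ?_, fun q => ?_⟩
    · ext i
      simp
    · dsimp only
      split_ifs
      · exact hf2 _
      · exact Ideal.zero_mem _
  subst hg
  have hg1 := hf.mem_span_image_Iio_of_mul_mem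
  have hn : 2 ≤ n := two_le_of_regular x g n hxm
    (fun q => Ideal.pow_le_self two_ne_zero (hg2 q)) fun k hk => hg1 k (by lia)
  have hr : Set.range (fun i : Fin c => g i) = g '' Set.Iio c := by
    ext z
    constructor
    · rintro ⟨i, rfl⟩
      exact ⟨i, i.2, rfl⟩
    · rintro ⟨i, hi, rfl⟩
      exact ⟨⟨i, hi⟩, rfl⟩
  have hT := TateModel.exists_of_regular x n hn hx g (by rwa [hxm]) c hc hg1 r
  rw [hxm, ← hr] at hT
  obtain ⟨T, h0, h1, h2⟩ := hT
  have hI := maximalIdeal_quotient (Ideal.span (Set.range fun i : Fin c => g i)) <| by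
    rw [Ideal.span_le]
    rintro _ ⟨i, rfl⟩
    exact Ideal.pow_le_self two_ne_zero (hf2 i)
  rw [hF.minorsIdeal_eq_dX T hI.symm h0,
    T.minorsIdeal_dX_eq r l (h1 l) (h1 (l + 1)) (h2 (l + 1) (by lia)), hI]

end

theorem mainTheorem3 (c : ℕ) (hc : 1 < c) (r : ℕ) (hr : 1 ≤ r) :
    -- Shamash complexes over an arbitrary commutative ring
    (∀ (S : Type u) [CommRing S] (f : Fin c → S),
      (f ≠ 0 → ∀ (E : GradedMatrixFactorization f) (m : ℕ)
        (b : Module.Basis (Fin m) (MvPolynomial (Fin c) S) E.F) (e : Fin m → ℤ),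
        (∀ k, b k ∈ E.grading (e k)) →
        (∀ n₁ N₁ : ℤ, IsLeast {j | Odd j ∧ ∃ k, e k = j} n₁ →
          IsGreatest {j | Odd j ∧ ∃ k, e k = j} N₁ →
          ∀ l : ℤ, Even l → -(-((r : ℤ) - 1) * (N₁ - n₁ + 4) + n₁) + 1 ≤ l →
            complexMinors E.Phi r l = complexMinors E.Phi 1 (-n₁ + 1) ^ r) ∧
        (∀ n₀ N₀ : ℤ, IsLeast {j | Even j ∧ ∃ k, e k = j} n₀ →
          IsGreatest {j | Even j ∧ ∃ k, e k = j} N₀ →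
          ∀ l : ℤ, Odd l → -(-((r : ℤ) - 1) * (N₀ - n₀ + 4) + n₀) + 1 ≤ l →
            complexMinors E.Phi r l = complexMinors E.Phi 1 (-n₀ + 1) ^ r)) ∧
      (∀ C : ChainComplex (ModuleCat.{u} (CIRing f)) ℤ, IsShamashComplex f C →
        ∃ L : ℤ, ∀ l : ℤ, L ≤ l → complexMinors C r l = complexMinors C r (l + 2))) ∧
    -- Shamash resolutions over a complete intersection
    (∀ (S : Type u) [CommRing S] [IsRegularLocalRing S] (f : Fin c → S)
      (hf : RingTheory.Sequence.IsRegular S (List.ofFn f)),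
      (∀ (M : Type u) [AddCommGroup M] [Module S M] [Module (CIRing f) M]
        [IsScalarTower S (CIRing f) M] [Module.Finite (CIRing f) M]
        (G : ChainComplex (ModuleCat.{u} S) ℤ) (ε : G.X 0 →ₗ[S] M),
        IsMinimalFreeResolution G ε → ∀ s : HigherHomotopies f G,
        (∀ l : ℕ, (r : WithBot ℕ∞) * projectiveDimension (ModuleCat.of S M) +
            ((4 * (r - 1) + 1 : ℕ) : WithBot ℕ∞) ≤ (l : WithBot ℕ∞) →
          complexMinors s.Sh r l = complexMinors s.Sh r (l + 2)) ∧
        (∀ l : ℕ, (r : WithBot ℕ∞) * ringKrullDim S +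
            ((4 * (r - 1) + 1 : ℕ) : WithBot ℕ∞) ≤ (l : WithBot ℕ∞) →
          complexMinors s.Sh r l = complexMinors s.Sh r (l + 2))) ∧
      -- the residue field
      ((∀ i, f i ∈ IsLocalRing.maximalIdeal S ^ 2) →
        haveI : IsLocalRing (CIRing f) := isLocalRing_ciRing f hf
        ∀ (F : ChainComplex (ModuleCat.{u} (CIRing f)) ℤ)
          (ε : F.X 0 →ₗ[CIRing f] IsLocalRing.ResidueField (CIRing f)),
          IsMinimalFreeResolution F ε →
          ∀ l : ℕ, r * c + 4 * (r - 1) + 1 ≤ l →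
            complexMinors F r l = complexMinors F r (l + 2))) := by
  refine ⟨fun S _ f => ⟨fun hf E m b e he => ⟨?_, ?_⟩, ?_⟩, fun S _ _ f hf => ⟨?_, ?_⟩⟩
  · intro n₁ N₁ hn hN l hl hl'
    exact E.complexMinors_phi_odd b e he hc hf r hr hn hN l hl hl'
  · intro n₀ N₀ hn hN l hl hl'
    exact E.complexMinors_phi_even b e he hc hf r hr hn hN l hl hl'
  · intro C hC
    exact hC.exists_complexMinors_eq_add_two hc r hr
  · intro M _ _ _ _ _ G ε hG s
    exact ⟨s.complexMinors_sh_of_projectiveDimension hG hc r hr,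
      s.complexMinors_sh_of_ringKrullDim hG hc r hr⟩
  · intro hf2
    have : IsLocalRing (CIRing f) := isLocalRing_ciRing f hf
    intro F ε hF l hl
    -- Since $c\ge2$, the assumed bound lies well inside the range where both ideals equal
    -- $\mathfrak m^r$.
    have hc' : r * 2 ≤ r * c := Nat.mul_le_mul_left r hc
    obtain ⟨k, rfl⟩ : ∃ k, l = k + 1 := ⟨l - 1, by lia⟩
    have h1 := hF.complexMinors_residueField hc f hf hf2 r k (by lia)
    have h2 := hF.complexMinors_residueField hc f hf hf2 r (k + 2) (by lia)
    have e1 : ((k + 1 : ℕ) : ℤ) = (k : ℤ) + 1 := by push_cast; ring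
    have e2 : ((k + 1 : ℕ) : ℤ) + 2 = ((k + 2 : ℕ) : ℤ) + 1 := by push_cast; ring
    rw [e2, e1, h1, h2]
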